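/- Let $k$ be a commutative ring and let $\mathcal A$ be a small dg category over $k$. Write $H^0(\mathcal A)$ for its homotopy category (same objects, morphisms the zeroth cohomology of the Hom-complexes), and $\mathrm{DGMod}\text{-}\mathcal A$ for the dg category of right dg $\mathcal A$-modules, with its suspension $\Sigma$ and its mapping cones. The pretriangulated hull $\mathcal A^{\rm pretr}$ is the smallest full dg subcategory of $\mathrm{DGMod}\text{-}\mathcal A$ that contains the zero module and all modules $\mathcal A(-,x)$ and is closed under $\Sigma$, $\Sigma^{-1}$ and cones of closed morphisms of degree zero. The dg category $\mathcal A$ is called pretriangulated if the Yoneda embedding $\mathcal A\to\mathcal A^{\rm pretr}$ is a quasi-equivalence. A canonical triangulated structure on $H^0(\mathcal A)$ is one (including the octahedral axiom) that makes $H^0(\mathcal A)$ a triangulated subcategory of $H^0(\mathrm{DGMod}\text{-}\mathcal A)$ via the Yoneda embedding: its shift is identified with $\Sigma$ by a natural isomorphism, and its distinguished triangles are exactly those whose images are isomorphic to standard triangles $M\xrightarrow{f}N\to\mathrm{Cone}(f)\to\Sigma M$. A complex $F$ of $k$-modules is homotopically flat if $C\otimes_k F$ is acyclic for every acyclic complex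 $C$ of $k$-modules. For a full dg subcategory $\mathcal B\subseteq\mathcal A$, the dg quotient $\mathcal A/\mathcal B$ has the same objects as $\mathcal A$ and is obtained from $\mathcal A$ by freely adding, for each object $U$ of $\mathcal B$, a morphism $\varepsilon_U\colon U\to U$ of degree $-1$ with $d(\varepsilon_U)=1_U$. Let $\pi\colon\mathcal A\to\mathcal A/\mathcal B$ be the canonical dg functor. **Corollary.** Assume that $\mathcal A$ is pretriangulated, that $\mathcal B\subseteq\mathcal A$ is a full dg subcategory which is itself pretriangulated, and that the complex $\mathrm{Hom}_{\mathcal A}(x,U)$ is homotopically flat for all objects $x$ of $\mathcal A$ and $U$ of $\mathcal B$. Then $\mathcal A/\mathcal B$ is pretriangulated. Moreover, $H^0(\mathcal A)$ and $H^0(\mathcal A/\mathcal B)$ have canonical triangulated structures, and for any such structures the objects of $H^0(\mathcal A)$ isomorphic to objects of $H^0(\mathcal B)$ form a triangulated subcategory, and the canonical functor from the Verdier quotient $$\Phi\colon H^0(\mathcal A)/H^0(\mathcal B)\longrightarrow H^0(\mathcal A/\mathcal B),$$ i.e. the functor whose composite with the localization functor $H^0(\mathcal A)\to H^0(\mathcal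 A)/H^0(\mathcal B)$ is $H^0(\pi)$, exists and is an isomorphism of triangulated categories: it is an isomorphism of categories which, for suitable natural isomorphisms commuting it with the shifts, preserves and reflects distinguished triangles. -/

import Mathlib

open CategoryTheory Limits Pretriangulated
open scoped DirectSum TensorProduct

universe u v

/-- A dg category over `k` with objects `A`.  The Hom-complex is given by its homogeneous
components; `comp h g f` is the composite `g ∘ f` of homogeneous morphisms. -/
class DGCategory (k : Type u) [CommRing k] (A : Type v) where
  Hom : A → A → ℤ → Type u
  [addCommGroup : ∀ x y n, AddCommGroup (Hom x y n)]
  [module : ∀ x y n, Module k (Hom x y n)]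
  d : ∀ {x y : A} (p q : ℤ), p + 1 = q → (Hom x y p →ₗ[k] Hom x y q)
  comp : ∀ {x y z : A} {p q n : ℤ}, p + q = n → (Hom y z p →ₗ[k] Hom x y q →ₗ[k] Hom x z n)
  one : ∀ x : A, Hom x x 0
  d_d : ∀ {x y : A} (p q r : ℤ) (h : p + 1 = q) (h' : q + 1 = r) (f : Hom x y p),
    d q r h' (d p q h f) = 0
  one_comp : ∀ {x y : A} {p : ℤ} (h : 0 + p = p) (f : Hom x y p), comp h (one y) f = f
  comp_one : ∀ {x y : A} {p : ℤ} (h : p + 0 = p) (f : Hom x y p), comp h f (one x) = f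
  assoc : ∀ {w x y z : A} {p q r pq qr n : ℤ} (h₁ : p + q = pq) (h₂ : pq + r = n)
    (h₃ : q + r = qr) (h₄ : p + qr = n) (f : Hom y z p) (g : Hom x y q) (h : Hom w x r),
    comp h₂ (comp h₁ f g) h = comp h₄ f (comp h₃ g h)
  leibniz : ∀ {x y z : A} {p q n p' q' n' : ℤ} (h : p + q = n) (hn : n + 1 = n')
    (hp : p + 1 = p') (h₁ : p' + q = n') (hq : q + 1 = q') (h₂ : p + q' = n')
    (g : Hom y z p) (f : Hom x y q),
    d n n' hn (comp h g f) =
      comp h₁ (d p p' hp g) f + p.negOnePow • comp h₂ g (d q q' hq f)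

namespace DGCategory

attribute [reducible, instance] DGCategory.addCommGroup DGCategory.module

variable (k : Type u) [CommRing k] {A : Type v} [DGCategory k A]

theorem d_one (x : A) : d (k := k) 0 1 (zero_add 1) (one x : Hom k x x 0) = 0 := by
  have h := leibniz (k := k) (zero_add 0) (zero_add 1) (zero_add 1) (add_zero 1) (zero_add 1)
    (zero_add 1) (one x : Hom k x x 0) (one x)
  rw [one_comp, one_comp, comp_one] at h
  simpa using h

/-- The Hom-complex, as a cochain complex of `k`-modules. -/
def homComplex (x y : A) : CochainComplex (ModuleCat.{u} k) ℤ where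
  X n := ModuleCat.of k (Hom k x y n)
  d i j := if h : i + 1 = j then ModuleCat.ofHom (d i j h) else 0
  shape i j h := dif_neg h
  d_comp_d' i j l h h' := by
    have h1 : i + 1 = j := h
    have h2 : j + 1 = l := h'
    rw [dif_pos h1, dif_pos h2]
    ext f
    exact d_d _ _ _ h1 h2 f

/-- Closed morphisms of degree zero. -/
abbrev Z0 (x y : A) : Submodule k (Hom k x y 0) := LinearMap.ker (d 0 1 (zero_add 1))

/-- Coboundaries, inside the closed morphisms of degree zero. -/
abbrev B0 (x y : A) : Submodule k (Z0 k x y) :=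
  (LinearMap.range (d (k := k) (x := x) (y := y) (-1) 0 (neg_add_cancel 1))).submoduleOf
    (Z0 k x y)

/-- The zeroth cohomology of the Hom-complex. -/
abbrev H0Hom (x y : A) : Type u := Z0 k x y ⧸ B0 k x y

variable {k}

theorem d_comp_closed {x y z : A} (g : Z0 k y z) (f : Z0 k x y) :
    d (k := k) 0 1 (zero_add 1) (comp (zero_add 0) g.1 f.1) = 0 := by
  have hg : d (k := k) 0 1 (zero_add 1) g.1 = 0 := g.2
  have hf : d (k := k) 0 1 (zero_add 1) f.1 = 0 := f.2
  rw [leibniz (k := k) (zero_add 0) (zero_add 1) (zero_add 1) (add_zero 1) (zero_add 1)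
    (zero_add 1), hg, hf]
  simp

/-- Composition of closed morphisms of degree zero. -/
def Z0comp {x y z : A} (g : Z0 k y z) (f : Z0 k x y) : Z0 k x z :=
  ⟨comp (zero_add 0) g.1 f.1, d_comp_closed g f⟩

/-- The identity as a closed morphism. -/
def Z0one (x : A) : Z0 k x x := ⟨one x, d_one k x⟩

theorem Z0comp_mem_left {x y z : A} (g : Z0 k y z) (f : Z0 k x y) (hg : g ∈ B0 k y z) :
    Z0comp g f ∈ B0 k x z := by
  obtain ⟨t, ht⟩ := hg
  have hf : d (k := k) 0 1 (zero_add 1) f.1 = 0 := f.2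
  refine ⟨comp (add_zero (-1)) t f.1, ?_⟩
  rw [leibniz (k := k) (add_zero (-1)) (neg_add_cancel 1) (neg_add_cancel 1) (add_zero 0)
    (zero_add 1) (neg_add_cancel 1), hf, ht]
  simp [Z0comp]

theorem Z0comp_mem_right {x y z : A} (g : Z0 k y z) (f : Z0 k x y) (hf : f ∈ B0 k x y) :
    Z0comp g f ∈ B0 k x z := by
  obtain ⟨t, ht⟩ := hf
  have hg : d (k := k) 0 1 (zero_add 1) g.1 = 0 := g.2
  refine ⟨comp (zero_add (-1)) g.1 t, ?_⟩
  rw [leibniz (k := k) (zero_add (-1)) (neg_add_cancel 1) (zero_add 1) (add_neg_cancel 1)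
    (neg_add_cancel 1) (zero_add 0), hg, ht]
  simp [Z0comp]

/-- Composition of closed morphisms, with values in cohomology. -/
def compAux (x y z : A) : Z0 k y z →ₗ[k] Z0 k x y →ₗ[k] H0Hom k x z :=
  LinearMap.mk₂ k (fun g f => Submodule.Quotient.mk (Z0comp g f))
    (fun g g' f => by
      rw [← Submodule.Quotient.mk_add]; congr 1; ext; simp [Z0comp])
    (fun c g f => by
      rw [← Submodule.Quotient.mk_smul]; congr 1; ext; simp [Z0comp])
    (fun g f f' => by
      rw [← Submodule.Quotient.mk_add]; congr 1; ext; simp [Z0comp])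
    (fun c g f => by
      rw [← Submodule.Quotient.mk_smul]; congr 1; ext; simp [Z0comp])

/-- Composition in the homotopy category. -/
def H0comp (x y z : A) : H0Hom k y z →ₗ[k] H0Hom k x y →ₗ[k] H0Hom k x z :=
  (B0 k y z).liftQ
    ((B0 k x y).liftQ (compAux x y z).flip (fun f hf => by
      ext g
      exact (Submodule.Quotient.mk_eq_zero _).2 (Z0comp_mem_right g f hf))).flip
    (fun g hg => by
      ext f
      exact (Submodule.Quotient.mk_eq_zero _).2 (Z0comp_mem_left g f hg))

theorem H0comp_mk {x y z : A} (g : Z0 k y z) (f : Z0 k x y) :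
    H0comp x y z (Submodule.Quotient.mk g) (Submodule.Quotient.mk f) =
      Submodule.Quotient.mk (Z0comp g f) := rfl

end DGCategory

/-- The homotopy category `H⁰(A)`: objects of `A`, with morphisms the zeroth cohomologies of the
Hom-complexes. -/
structure H0 (k : Type u) [CommRing k] (A : Type v) [DGCategory k A] where
  obj : A

namespace H0

open DGCategory

variable {k : Type u} [CommRing k] {A : Type v} [DGCategory k A]

instance : Category.{u} (H0 k A) where
  Hom X Y := H0Hom k X.obj Y.obj
  id X := Submodule.Quotient.mk (Z0one X.obj)
  comp f g := H0comp _ _ _ g f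
  id_comp f := by
    obtain ⟨f, rfl⟩ := Submodule.Quotient.mk_surjective _ f
    rw [H0comp_mk]; congr 1; ext; exact comp_one _ _
  comp_id f := by
    obtain ⟨f, rfl⟩ := Submodule.Quotient.mk_surjective _ f
    rw [H0comp_mk]; congr 1; ext; exact one_comp _ _
  assoc f g h := by
    obtain ⟨f, rfl⟩ := Submodule.Quotient.mk_surjective _ f
    obtain ⟨g, rfl⟩ := Submodule.Quotient.mk_surjective _ g
    obtain ⟨h, rfl⟩ := Submodule.Quotient.mk_surjective _ h
    simp only [H0comp_mk]; congr 1; ext; exact (assoc _ _ _ _ _ _ _).symm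

/-- The homotopy class of a closed morphism of degree zero. -/
def homMk {x y : A} (f : Z0 k x y) : (⟨x⟩ : H0 k A) ⟶ ⟨y⟩ :=
  (Submodule.Quotient.mk f : H0Hom k x y)

instance : Preadditive (H0 k A) where
  homGroup X Y := inferInstanceAs (AddCommGroup (H0Hom k X.obj Y.obj))
  add_comp X Y Z f f' g := (H0comp X.obj Y.obj Z.obj g).map_add f f'
  comp_add X Y Z f g g' := by
    exact LinearMap.congr_fun ((H0comp X.obj Y.obj Z.obj).map_add g g') f

end H0

/-- A dg functor. -/
structure DGFunctor (k : Type u) [CommRing k] (A : Type*) [DGCategory k A]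
    (B : Type*) [DGCategory k B] where
  obj : A → B
  map : ∀ {x y : A} {n : ℤ}, DGCategory.Hom k x y n →ₗ[k] DGCategory.Hom k (obj x) (obj y) n
  map_d : ∀ {x y : A} (p q : ℤ) (h : p + 1 = q) (f : DGCategory.Hom k x y p),
    map (DGCategory.d p q h f) = DGCategory.d p q h (map f)
  map_one : ∀ x : A, map (DGCategory.one x : DGCategory.Hom k x x 0) = DGCategory.one (obj x)
  map_comp : ∀ {x y z : A} {p q n : ℤ} (h : p + q = n) (g : DGCategory.Hom k y z p)
    (f : DGCategory.Hom k x y q), map (DGCategory.comp h g f) = DGCategory.comp h (map g) (map f)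

namespace DGFunctor

open DGCategory

variable {k : Type u} [CommRing k] {A : Type*} [DGCategory k A] {B : Type*} [DGCategory k B]
  (F : DGFunctor k A B)

/-- The chain map `A(x, y) ⟶ B(Fx, Fy)`. -/
def mapComplex (x y : A) : homComplex k x y ⟶ homComplex k (F.obj x) (F.obj y) where
  f n := ModuleCat.ofHom F.map
  comm' i j h := by
    have h1 : i + 1 = j := h
    dsimp only [homComplex]
    rw [dif_pos h1, dif_pos h1]
    ext f
    exact (F.map_d i j h1 f).symm

/-- The action of a dg functor on closed morphisms of degree zero. -/
def mapZ0 (x y : A) : Z0 k x y →ₗ[k] Z0 k (F.obj x) (F.obj y) :=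
  (F.map.comp (Z0 k x y).subtype).codRestrict _ (fun f => by
    have hf : d (k := k) 0 1 (zero_add 1) f.1 = 0 := f.2
    change d (k := k) 0 1 (zero_add 1) (F.map f.1) = 0
    rw [← F.map_d, hf, map_zero])

theorem mapZ0_mem {x y : A} (f : Z0 k x y) (hf : f ∈ B0 k x y) :
    F.mapZ0 x y f ∈ B0 k (F.obj x) (F.obj y) := by
  obtain ⟨t, ht⟩ := hf
  refine ⟨F.map t, ?_⟩
  rw [← F.map_d, ht]
  rfl

/-- The functor `H⁰(F)`. -/
def mapH0 : H0 k A ⥤ H0 k B where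
  obj X := ⟨F.obj X.obj⟩
  map {X Y} f := (B0 k X.obj Y.obj).mapQ (B0 k (F.obj X.obj) (F.obj Y.obj))
    (F.mapZ0 X.obj Y.obj) (fun f hf => F.mapZ0_mem f hf) f
  map_id X := by
    refine congrArg Submodule.Quotient.mk ?_
    ext
    exact F.map_one X.obj
  map_comp f g := by
    obtain ⟨f, rfl⟩ := Submodule.Quotient.mk_surjective _ f
    obtain ⟨g, rfl⟩ := Submodule.Quotient.mk_surjective _ g
    refine congrArg Submodule.Quotient.mk ?_
    ext
    exact F.map_comp _ _ _

/-- A quasi-equivalence: quasi-fully faithful, and dense on homotopy categories. -/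
def IsQuasiEquivalence : Prop :=
  (∀ x y : A, QuasiIso (F.mapComplex x y)) ∧ F.mapH0.EssSurj

end DGFunctor

/-- The full dg subcategory on the objects satisfying `P`. -/
def DGFull {A : Type v} (P : A → Prop) : Type v := {x : A // P x}

instance DGFull.dgCategory (k : Type u) [CommRing k] {A : Type v} [DGCategory k A] (P : A → Prop) :
    DGCategory k (DGFull P) where
  Hom x y n := DGCategory.Hom k x.1 y.1 n
  d p q h := DGCategory.d p q h
  comp h := DGCategory.comp h
  one x := DGCategory.one x.1
  d_d := DGCategory.d_d
  one_comp := DGCategory.one_comp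
  comp_one := DGCategory.comp_one
  assoc := DGCategory.assoc
  leibniz := DGCategory.leibniz

/-- A right dg `A`-module, as a family of complexes with a right action of `A`. -/
structure DGMod (k : Type u) [CommRing k] (A : Type u) [DGCategory k A] where
  X : A → ℤ → Type u
  [addCommGroup : ∀ x n, AddCommGroup (X x n)]
  [module : ∀ x n, Module k (X x n)]
  d : ∀ {x : A} (p q : ℤ), p + 1 = q → (X x p →ₗ[k] X x q)
  act : ∀ {x y : A} {p q n : ℤ}, p + q = n → (X y p →ₗ[k] DGCategory.Hom k x y q →ₗ[k] X x n)
  d_d : ∀ {x : A} (p q r : ℤ) (h : p + 1 = q) (h' : q + 1 = r) (m : X x p),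
    d q r h' (d p q h m) = 0
  act_one : ∀ {x : A} {p : ℤ} (h : p + 0 = p) (m : X x p), act h m (DGCategory.one x) = m
  act_act : ∀ {w x y : A} {p q r pq qr n : ℤ} (h₁ : p + q = pq) (h₂ : pq + r = n)
    (h₃ : q + r = qr) (h₄ : p + qr = n) (m : X y p) (a : DGCategory.Hom k x y q)
    (b : DGCategory.Hom k w x r),
    act h₂ (act h₁ m a) b = act h₄ m (DGCategory.comp h₃ a b)
  d_act : ∀ {x y : A} {p q n p' q' n' : ℤ} (h : p + q = n) (hn : n + 1 = n')
    (hp : p + 1 = p') (h₁ : p' + q = n') (hq : q + 1 = q') (h₂ : p + q' = n')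
    (m : X y p) (a : DGCategory.Hom k x y q),
    d n n' hn (act h m a) =
      act h₁ (d p p' hp m) a + p.negOnePow • act h₂ m (DGCategory.d q q' hq a)

namespace DGMod

open DGCategory

attribute [instance] DGMod.addCommGroup DGMod.module

variable {k : Type u} [CommRing k] {A : Type u} [DGCategory k A]

/-- A pair of integers with difference `n`. -/
structure Deg (n : ℤ) where
  p : ℤ
  q : ℤ
  h : p + n = q

/-- Morphisms of degree `n` of right dg modules: homogeneous families of degree `n` that commute
with the action of `A`. -/
def homSubmodule (M N : DGMod k A) (n : ℤ) :
    Submodule k (∀ (x : A) (t : Deg n), M.X x t.p →ₗ[k] N.X x t.q) where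
  carrier := {f | ∀ (x y : A) (p q r p' r' : ℤ) (h : p + q = r) (hp : p + n = p')
    (hr : r + n = r') (h' : p' + q = r') (m : M.X y p) (a : Hom k x y q),
    f x ⟨r, r', hr⟩ (M.act h m a) = N.act h' (f y ⟨p, p', hp⟩ m) a}
  zero_mem' := by
    intro x y p q r p' r' h hp hr h' m a
    simp
  add_mem' := by
    intro f g hf hg x y p q r p' r' h hp hr h' m a
    have h1 := hf x y p q r p' r' h hp hr h' m a
    have h2 := hg x y p q r p' r' h hp hr h' m a
    simp [h1, h2]
  smul_mem' := by
    intro c f hf x y p q r p' r' h hp hr h' m a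
    have h1 := hf x y p q r p' r' h hp hr h' m a
    simp [h1]

/-- The module of morphisms of degree `n`. -/
abbrev Mor (M N : DGMod k A) (n : ℤ) : Type u := homSubmodule M N n

variable {M N L : DGMod k A}

/-- The component `M(x)^p → N(x)^q` of a morphism of degree `n = q - p`. -/
def Mor.app {n : ℤ} (f : Mor M N n) (x : A) (p q : ℤ) (h : p + n = q) : M.X x p →ₗ[k] N.X x q :=
  f.1 x ⟨p, q, h⟩

/-- Constructor for morphisms of degree `n`. -/
def Mor.mk {n : ℤ} (f : ∀ (x : A) (p q : ℤ), p + n = q → (M.X x p →ₗ[k] N.X x q))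
    (hf : ∀ (x y : A) (p q r p' r' : ℤ) (h : p + q = r) (hp : p + n = p')
      (hr : r + n = r') (h' : p' + q = r') (m : M.X y p) (a : Hom k x y q),
      f x r r' hr (M.act h m a) = N.act h' (f y p p' hp m) a) : Mor M N n :=
  ⟨fun x t => f x t.p t.q t.h, hf⟩

@[simp] theorem Mor.app_mk {n : ℤ}
    (f : ∀ (x : A) (p q : ℤ), p + n = q → (M.X x p →ₗ[k] N.X x q)) (hf) (x : A) (p q : ℤ)
    (h : p + n = q) : (Mor.mk f hf : Mor M N n).app x p q h = f x p q h := rfl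

@[simp] theorem Mor.app_add {n : ℤ} (f g : Mor M N n) (x : A) (p q : ℤ) (h : p + n = q) :
    (f + g).app x p q h = f.app x p q h + g.app x p q h := rfl

@[simp] theorem Mor.app_zero {n : ℤ} (x : A) (p q : ℤ) (h : p + n = q) :
    (0 : Mor M N n).app x p q h = 0 := rfl

@[simp] theorem Mor.app_smul {n : ℤ} (c : k) (f : Mor M N n) (x : A) (p q : ℤ) (h : p + n = q) :
    (c • f).app x p q h = c • f.app x p q h := rfl

@[simp] theorem Mor.app_units_smul {n : ℤ} (c : ℤˣ) (f : Mor M N n) (x : A) (p q : ℤ)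
    (h : p + n = q) : (c • f).app x p q h = c • f.app x p q h := rfl

theorem Mor.comm {n : ℤ} (f : Mor M N n) {x y : A} {p q r p' r' : ℤ} (h : p + q = r)
    (hp : p + n = p') (hr : r + n = r') (h' : p' + q = r') (m : M.X y p) (a : Hom k x y q) :
    f.app x r r' hr (M.act h m a) = N.act h' (f.app y p p' hp m) a :=
  f.2 x y p q r p' r' h hp hr h' m a

theorem Mor.ext {n : ℤ} {f g : Mor M N n}
    (h : ∀ (x : A) (p q : ℤ) (e : p + n = q) (m : M.X x p), f.app x p q e m = g.app x p q e m) :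
    f = g :=
  Subtype.ext (funext fun x => funext fun t => LinearMap.ext fun m => h x t.p t.q t.h m)

theorem smul_negOnePow_succ {V : Type*} [AddCommGroup V] (n : ℤ) (v : V) :
    (n + 1).negOnePow • v = -(n.negOnePow • v) := by
  rw [Int.negOnePow_succ, Units.neg_smul]

theorem map_units_smul_int {V W : Type*} [AddCommGroup V] [AddCommGroup W] [Module k V]
    [Module k W] (f : V →ₗ[k] W) (n : ℤ) (v : V) : f (n.negOnePow • v) = n.negOnePow • f v := by
  rw [Units.smul_def, Units.smul_def, map_zsmul]

theorem map_units_smul_int₂ {V W U : Type*} [AddCommGroup V] [AddCommGroup W] [AddCommGroup U]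
    [Module k V] [Module k W] [Module k U] (f : V →ₗ[k] W →ₗ[k] U) (n : ℤ) (v : V) (w : W) :
    f (n.negOnePow • v) w = n.negOnePow • f v w := by
  rw [map_units_smul_int]; rfl

/-- The differential `d(f) = d_N ∘ f - (-1)^|f| f ∘ d_M`. -/
def dMor (M N : DGMod k A) (n n' : ℤ) (hn : n + 1 = n') : Mor M N n →ₗ[k] Mor M N n' where
  toFun f := Mor.mk (fun x p q h =>
      N.d (p + n) q (by omega) ∘ₗ f.app x p (p + n) rfl -
        n.negOnePow • (f.app x (p + 1) q (by omega) ∘ₗ M.d p (p + 1) rfl)) (by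
    intro x y p q r p' r' h hp hr h' m a
    subst h hp hn
    simp only [LinearMap.sub_apply, LinearMap.smul_apply, LinearMap.comp_apply, map_sub]
    rw [f.comm rfl rfl rfl (by omega : p + n + q = p + q + n),
      N.d_act (by omega) (by omega) (by omega : p + n + 1 = p + (n + 1)) (by omega)
        (rfl : q + 1 = q + 1) (by omega),
      M.d_act rfl rfl (rfl : p + 1 = p + 1) (by omega) (rfl : q + 1 = q + 1) (by omega),
      map_add, f.comm (by omega : p + 1 + q = p + q + 1)
        (by omega : p + 1 + n = p + (n + 1)) (by omega) (by omega), map_units_smul_int,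
      f.comm (by omega : p + (q + 1) = p + q + 1) rfl (by omega) (by omega), Int.negOnePow_add, smul_add, mul_comm, mul_smul,
      map_units_smul_int₂, smul_comm]
    abel)
  map_add' f g := by
    refine Mor.ext fun x p q e m => ?_
    simp; abel
  map_smul' c f := by
    refine Mor.ext fun x p q e m => ?_
    simp [smul_sub, smul_comm c]

theorem dMor_app {n n' : ℤ} (hn : n + 1 = n') (f : Mor M N n) (x : A) {p q p' q' : ℤ}
    (h : p + n' = q) (h₁ : p + n = q') (h₂ : q' + 1 = q) (h₃ : p + 1 = p') (h₄ : p' + n = q)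
    (m : M.X x p) :
    (dMor M N n n' hn f).app x p q h m =
      N.d q' q h₂ (f.app x p q' h₁ m) - n.negOnePow • f.app x p' q h₄ (M.d p p' h₃ m) := by
  subst h₁ h₃; rfl

/-- Composition of morphisms of dg modules. -/
def compMor (M N L : DGMod k A) {a b c : ℤ} (h : a + b = c) :
    Mor N L a →ₗ[k] Mor M N b →ₗ[k] Mor M L c :=
  LinearMap.mk₂ k (fun g f => Mor.mk (fun x p q e =>
      g.app x (p + b) q (by omega) ∘ₗ f.app x p (p + b) rfl) (by
    intro x y p q r p' r' h hp hr h' m a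
    simp only [LinearMap.comp_apply]
    rw [f.comm h rfl rfl (by omega), g.comm _ _ _ (by omega)]))
    (fun _ _ _ => Mor.ext fun x p q e m => by simp)
    (fun _ _ _ => Mor.ext fun x p q e m => by simp)
    (fun _ _ _ => Mor.ext fun x p q e m => by simp)
    (fun _ _ _ => Mor.ext fun x p q e m => by simp)

theorem compMor_app {a b c : ℤ} (h : a + b = c) (g : Mor N L a) (f : Mor M N b) (x : A)
    {p q r : ℤ} (e : p + c = r) (e₁ : p + b = q) (e₂ : q + a = r) (m : M.X x p) :
    (compMor M N L h g f).app x p r e m = g.app x q r e₂ (f.app x p q e₁ m) := by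
  subst e₁; rfl

/-- The identity of a dg module. -/
def oneMor (M : DGMod k A) : Mor M M 0 :=
  Mor.mk (fun x p q h => by
      obtain rfl : p = q := by omega
      exact LinearMap.id) (by
    intro x y p q r p' r' h hp hr h' m a
    obtain rfl : p = p' := by omega
    obtain rfl : r = r' := by omega
    rfl)

theorem oneMor_app (M : DGMod k A) (x : A) (p : ℤ) (h : p + 0 = p) (m : M.X x p) :
    (oneMor M).app x p p h m = m := rfl

/-- The dg category of right dg `A`-modules. -/
instance : DGCategory k (DGMod k A) where
  Hom M N n := Mor M N n
  d {M N} n n' h := dMor M N n n' h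
  comp {M N L} _ _ _ h := compMor M N L h
  one M := oneMor M
  d_d := by
    intro M N p q r h h' f
    subst h h'
    refine Mor.ext fun x s t e m => ?_
    rw [dMor_app rfl (dMor M N p (p + 1) rfl f) x e rfl (by omega) rfl (by omega),
      dMor_app rfl f x rfl rfl (by omega) rfl (by omega),
      dMor_app rfl f x (by omega) (by omega : s + 1 + p = s + (p + 1)) (by omega) rfl (by omega),
      map_sub, N.d_d, map_units_smul_int, M.d_d, map_zero, smul_zero, sub_zero,
      smul_negOnePow_succ]
    simp
  one_comp := by
    intro M N p h f
    refine Mor.ext fun x s t e m => ?_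
    rw [compMor_app h _ _ x e e (by omega), oneMor_app]
  comp_one := by
    intro M N p h f
    refine Mor.ext fun x s t e m => ?_
    rw [compMor_app h _ _ x e (by omega) e, oneMor_app]
  assoc := by
    intro K M N L p q r pq qr n h₁ h₂ h₃ h₄ f g h
    refine Mor.ext fun x s t e m => ?_
    rw [compMor_app h₂ _ _ x e rfl (by omega),
      compMor_app h₁ f g x (by omega) rfl (by omega),
      compMor_app h₄ f _ x e (by omega : s + qr = s + r + q) (by omega),
      compMor_app h₃ g h x (by omega) rfl (by omega)]
  leibniz := by
    intro M N L p q n p' q' n' h hn hp h₁ hq h₂ g f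
    refine Mor.ext fun x s t e m => ?_
    rw [dMor_app hn _ x e rfl (by omega) rfl (by omega),
      compMor_app h g f x rfl rfl (by omega),
      compMor_app h g f x (by omega) (by omega : s + 1 + q = s + q') (by omega),
      Mor.app_add, Mor.app_units_smul, LinearMap.add_apply, LinearMap.smul_apply,
      compMor_app h₁ _ f x e rfl (by omega), compMor_app h₂ g _ x e rfl (by omega),
      dMor_app hp g x _ (by omega : s + q + p = s + n) (by omega) (by omega : s + q + 1 = s + q')
        (by omega),
      dMor_app hq f x _ rfl (by omega) rfl (by omega), map_sub, map_units_smul_int, smul_sub,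
      show n.negOnePow = p.negOnePow * q.negOnePow by rw [← h, Int.negOnePow_add], mul_smul]
    abel

/-- The free module `A(-, y)`. -/
def yonedaObj (k : Type u) [CommRing k] {A : Type u} [DGCategory k A] (y : A) : DGMod k A where
  X x n := Hom k x y n
  d p q h := DGCategory.d p q h
  act h := DGCategory.comp h
  d_d := DGCategory.d_d
  act_one := DGCategory.comp_one
  act_act := DGCategory.assoc
  d_act := DGCategory.leibniz

/-- The Yoneda dg functor `A → DGMod-A`, `y ↦ A(-, y)`. -/
def yoneda (k : Type u) [CommRing k] (A : Type u) [DGCategory k A] :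
    DGFunctor k A (DGMod k A) where
  obj y := yonedaObj k y
  map {y z n} :=
    { toFun := fun f => (Mor.mk (fun x p q h =>
          (DGCategory.comp (by omega : n + p = q) f : Hom k x y p →ₗ[k] Hom k x z q)) (by
            intro x w p q r p' r' h hp hr h' m a
            exact (DGCategory.assoc _ _ _ _ f m a).symm) :
            Mor (yonedaObj k y) (yonedaObj k z) n)
      map_add' := fun f g => Mor.ext fun x p q h m => by
        exact LinearMap.map_add₂ (DGCategory.comp (by omega : n + p = q)) f g m
      map_smul' := fun c f => Mor.ext fun x p q h m => by
        exact LinearMap.map_smul₂ (DGCategory.comp (by omega : n + p = q)) c f m }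
  map_d := by
    intro y z p q h f
    refine Mor.ext fun x s t e m => ?_
    refine Eq.trans ?_ (dMor_app h _ x e rfl (by omega) rfl (by omega) m).symm
    have := DGCategory.leibniz (k := k) (by omega : p + s = s + p) (by omega : s + p + 1 = t) h
      (by omega) (rfl : s + 1 = s + 1) (by omega) f m
    exact (sub_eq_of_eq_add this).symm
  map_one := by
    intro y
    refine Mor.ext fun x p q h m => ?_
    obtain rfl : p = q := by omega
    exact DGCategory.one_comp _ m
  map_comp := by
    intro x y z p q n h g f
    refine Mor.ext fun w s t e m => ?_
    refine Eq.trans ?_ (compMor_app h _ _ w e rfl (by omega) m).symm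
    exact DGCategory.assoc _ _ _ _ g f m

/-- The shifted module `M[n]`, with `M[n]^p = M^(p+n)` and `d_{M[n]} = (-1)^n d_M`. -/
def shift (M : DGMod k A) (n : ℤ) : DGMod k A where
  X x p := M.X x (p + n)
  d p q h := n.negOnePow • M.d (p + n) (q + n) (by omega)
  act h := M.act (by omega)
  d_d := by
    intro x p q r h h' m
    simp only [LinearMap.smul_apply, map_units_smul_int, M.d_d, smul_zero]
  act_one := by
    intro x p h m
    exact M.act_one _ m
  act_act := by
    intro w x y p q r pq qr s h₁ h₂ h₃ h₄ m a b
    exact M.act_act _ _ h₃ _ m a b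
  d_act := by
    intro x y p q s p' q' s' h hs hp h₁ hq h₂ m a
    simp only [LinearMap.smul_apply, map_units_smul_int₂]
    rw [M.d_act (by omega) (by omega) (by omega : p + n + 1 = p' + n) (by omega) hq (by omega),
      smul_add, Int.negOnePow_add p n, mul_comm, mul_smul, smul_smul n.negOnePow n.negOnePow]
    simp

/-- The suspension dg functor `Σ` on right dg modules, given on morphisms by
`Σ(f)_x = (-1)^|f| f_x`. -/
def susp (k : Type u) [CommRing k] (A : Type u) [DGCategory k A] :
    DGFunctor k (DGMod k A) (DGMod k A) where
  obj M := M.shift 1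
  map {M N n} :=
    { toFun := fun f => (Mor.mk (fun x p q h =>
          n.negOnePow • Mor.app f x (p + 1) (q + 1) (by omega)) (by
            intro x w p q r p' r' h hp hr h' m a
            exact (congrArg (n.negOnePow • ·) (Mor.comm f _ _ _ (by omega) m a)).trans
              (map_units_smul_int₂ (N.act _) n _ a).symm) :
            Mor (M.shift 1) (N.shift 1) n)
      map_add' := fun f g => Mor.ext fun x p q h m => by
        exact smul_add n.negOnePow (Mor.app f x (p + 1) (q + 1) (by omega) m)
          (Mor.app g x (p + 1) (q + 1) (by omega) m)
      map_smul' := fun c f => Mor.ext fun x p q h m => by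
        exact smul_comm n.negOnePow c (Mor.app f x (p + 1) (q + 1) (by omega) m) }
  map_d := by
    intro M N p q h f
    refine Mor.ext fun x s t e m => ?_
    refine Eq.trans ?_ (dMor_app h _ x e rfl (by omega) rfl (by omega) m).symm
    refine (congrArg (q.negOnePow • ·) (dMor_app h f x (by omega : s + 1 + q = t + 1)
      (by omega : s + 1 + p = s + p + 1)
      (by omega) (by omega : s + 1 + 1 = s + 1 + 1) (by omega) m)).trans ?_
    revert m
    change ∀ m : M.X x (s + 1), q.negOnePow •
        (N.d (s + p + 1) (t + 1) (by omega) (Mor.app f x (s + 1) (s + p + 1) (by omega) m) -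
          p.negOnePow • Mor.app f x (s + 1 + 1) (t + 1) (by omega)
            (M.d (s + 1) (s + 1 + 1) rfl m)) =
      Int.negOnePow 1 • N.d (s + p + 1) (t + 1) (by omega)
        (p.negOnePow • Mor.app f x (s + 1) (s + p + 1) (by omega) m) -
      p.negOnePow • p.negOnePow • Mor.app f x (s + 1 + 1) (t + 1) (by omega)
        (Int.negOnePow 1 • M.d (s + 1) (s + 1 + 1) rfl m)
    intro m
    subst h
    simp only [map_units_smul_int, smul_negOnePow_succ, smul_sub, Int.negOnePow_one,
      Units.neg_smul, one_smul, map_neg, smul_neg]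
  map_one := by
    intro M
    refine Mor.ext fun x p q h m => ?_
    obtain rfl : p = q := by omega
    change Int.negOnePow 0 • m = m
    simp
  map_comp := by
    intro M N L p q n h g f
    refine Mor.ext fun x s t e m => ?_
    refine Eq.trans ?_ (compMor_app h _ _ x e rfl (by omega) m).symm
    change n.negOnePow • (compMor M N L h g f).app x (s + 1) (t + 1) _ m =
      p.negOnePow • Mor.app g x (s + q + 1) (t + 1) _
        (q.negOnePow • Mor.app f x (s + 1) (s + q + 1) _ m)
    refine Eq.trans ?_ (congrArg (p.negOnePow • ·) (map_units_smul_int _ q _)).symm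
    refine (congrArg (n.negOnePow • ·) (compMor_app h g f x _
      (by omega : s + 1 + q = s + q + 1) (by omega) m)).trans ?_
    subst h
    rw [Int.negOnePow_add, mul_smul]

theorem closed_app {M N : DGMod k A} (f : Z0 k M N) (x : A) {p q p' q' : ℤ} (h₁ : p + 0 = q)
    (h₂ : q + 1 = q') (h₃ : p + 1 = p') (h₄ : p' + 0 = q') (m : M.X x p) :
    N.d q q' h₂ (Mor.app f.1 x p q h₁ m) = Mor.app f.1 x p' q' h₄ (M.d p p' h₃ m) := by
  have hf : dMor M N 0 1 (zero_add 1) f.1 = 0 := f.2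
  have h := dMor_app (zero_add 1) f.1 x (by omega : p + 1 = q') h₁ h₂ h₃ h₄ m
  rw [hf] at h
  rw [Int.negOnePow_zero, one_smul] at h
  exact (sub_eq_zero.1 h.symm)

/-- The cone of a closed morphism `f : M ⟶ N` of degree zero: the graded module `N ⊕ ΣM`, with
differential `(n, m) ↦ (d n + f m, -d m)`. -/
def cone {M N : DGMod k A} (f : Z0 k M N) : DGMod k A where
  X x p := N.X x p × M.X x (p + 1)
  d {x} p q h :=
    LinearMap.prod
      (N.d p q h ∘ₗ LinearMap.fst k _ _ +
        Mor.app f.1 x (p + 1) q (by omega) ∘ₗ LinearMap.snd k _ _)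
      (-(M.d (p + 1) (q + 1) (by omega) ∘ₗ LinearMap.snd k _ _))
  act {x y p q n} h :=
    LinearMap.mk₂ k (fun m a => (N.act h m.1 a, M.act (by omega) m.2 a))
      (fun _ _ _ => by simp) (fun _ _ _ => by simp) (fun _ _ _ => by simp) (fun _ _ _ => by simp)
  d_d := by
    rintro x p q r h h' ⟨n, m⟩
    ext
    · simp [N.d_d, closed_app f x (by omega : p + 1 + 0 = q) h' (by omega : p + 1 + 1 = q + 1)
        (by omega)]
    · simp [M.d_d]
  act_one := by
    rintro x p h ⟨n, m⟩
    simp [N.act_one, M.act_one]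
  act_act := by
    rintro w x y p q r pq qr s h₁ h₂ h₃ h₄ ⟨n, m⟩ a b
    simp only [LinearMap.mk₂_apply]
    rw [N.act_act h₁ h₂ h₃ h₄, M.act_act _ _ h₃ _]
  d_act := by
    rintro x y p q s p' q' s' h hs hp h₁ hq h₂ ⟨n, m⟩ a
    ext
    · simp [N.d_act h hs hp h₁ hq h₂, Mor.comm f.1 _ (by omega : p + 1 + 0 = p') _ h₁]
      abel
    · simp [M.d_act (by omega : p + 1 + q = s + 1) (by omega : s + 1 + 1 = s' + 1)
        (by omega : p + 1 + 1 = p' + 1) (by omega) hq (by omega), smul_negOnePow_succ]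
      abel

/-- The canonical closed morphism `N ⟶ Cone(f)`. -/
def coneInr {M N : DGMod k A} (f : Z0 k M N) : Z0 k N (cone f) :=
  ⟨(Mor.mk (fun x p q h => (LinearMap.inl k (N.X x q) (M.X x (q + 1)) ∘ₗ (oneMor N).app x p q h :
      N.X x p →ₗ[k] N.X x q × M.X x (q + 1))) (by
    intro x y p q r p' r' h hp hr h' m a
    obtain rfl : p = p' := by omega
    obtain rfl : r = r' := by omega
    exact Prod.ext rfl (LinearMap.map_zero₂ (M.act (by omega : p + 1 + q = r + 1)) a).symm) :
      Mor N (cone f) 0), by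
    refine Mor.ext fun x p q h m => ?_
    refine (dMor_app (zero_add 1) _ x h (add_zero p) h h (add_zero q) m).trans ?_
    rw [Int.negOnePow_zero, one_smul]
    refine sub_eq_zero.2 (Prod.ext ?_ ?_)
    · change N.d p q h m + Mor.app f.1 x (p + 1) q (by omega) 0 = N.d p q h m
      rw [map_zero, add_zero]
    · change -(M.d (p + 1) (q + 1) (by omega) 0) = 0
      rw [map_zero, neg_zero]⟩

/-- The canonical closed morphism `Cone(f) ⟶ ΣM`. -/
def coneFst {M N : DGMod k A} (f : Z0 k M N) : Z0 k (cone f) (M.shift 1) :=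
  ⟨(Mor.mk (fun x p q h => ((oneMor M).app x (p + 1) (q + 1) (by omega) ∘ₗ
      LinearMap.snd k (N.X x p) (M.X x (p + 1)) :
        N.X x p × M.X x (p + 1) →ₗ[k] M.X x (q + 1))) (by
    intro x y p q r p' r' h hp hr h' m a
    obtain rfl : p = p' := by omega
    obtain rfl : r = r' := by omega
    rfl) : Mor (cone f) (M.shift 1) 0), by
    refine Mor.ext fun x p q h m => ?_
    refine (dMor_app (zero_add 1) _ x h (add_zero p) h h (add_zero q) m).trans ?_
    rw [Int.negOnePow_zero, one_smul]
    refine sub_eq_zero.2 ?_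
    change Int.negOnePow 1 • M.d (p + 1) (q + 1) (by omega) m.2 =
      -(M.d (p + 1) (q + 1) (by omega) m.2)
    rw [Int.negOnePow_one, Units.neg_smul, one_smul]⟩

/-- The zero module. -/
def zero (k : Type u) [CommRing k] (A : Type u) [DGCategory k A] : DGMod k A where
  X _ _ := PUnit
  d _ _ _ := 0
  act _ := 0
  d_d _ _ _ _ _ _ := rfl
  act_one _ _ := rfl
  act_act _ _ _ _ _ _ _ := rfl
  d_act _ _ _ _ _ _ _ _ := rfl

end DGMod

/-- The full dg subcategory `A^pretr` of `DGMod-A`: the smallest one that contains the zero module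
and the modules `A(-, x)`, and is closed under `Σ`, `Σ⁻¹` and cones.  (If `A` has an object, then
the zero module is a cone of an identity, up to isomorphism; the clause `zero` makes sure that
the pretriangulated hull of an empty `A` has a zero object too.) -/
inductive DGMod.InPretr (k : Type u) [CommRing k] (A : Type u) [DGCategory k A] : DGMod k A → Prop
  | zero : InPretr k A (DGMod.zero k A)
  | yoneda (x : A) : InPretr k A (DGMod.yonedaObj k x)
  | susp {M : DGMod k A} : InPretr k A M → InPretr k A (M.shift 1)
  | desusp {M : DGMod k A} : InPretr k A M → InPretr k A (M.shift (-1))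
  | cone {M N : DGMod k A} (f : DGCategory.Z0 k M N) :
      InPretr k A M → InPretr k A N → InPretr k A (DGMod.cone f)

section Pretriangulated

variable (k : Type u) [CommRing k] (A : Type u) [DGCategory k A]

/-- The pretriangulated hull `A^pretr`. -/
abbrev PretrHull : Type (u + 1) := DGFull (DGMod.InPretr k A)

/-- The canonical embedding `A → A^pretr`. -/
def toPretrHull : DGFunctor k A (PretrHull k A) where
  obj x := ⟨(DGMod.yoneda k A).obj x, DGMod.InPretr.yoneda x⟩
  map := (DGMod.yoneda k A).map
  map_d := (DGMod.yoneda k A).map_d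
  map_one := (DGMod.yoneda k A).map_one
  map_comp := (DGMod.yoneda k A).map_comp

/-- A dg category is pretriangulated if `A → A^pretr` is a quasi-equivalence. -/
def IsPretriangulatedDG : Prop := (toPretrHull k A).IsQuasiEquivalence

/-- A triangulated structure (including the octahedral axiom) on `H⁰(A)` that makes it a
triangulated subcategory of `H⁰(DGMod-A)` through the Yoneda embedding: the shift is identified
with the suspension of dg modules, and the distinguished triangles are exactly those whose image
is isomorphic, in `H⁰(DGMod-A)`, to a standard triangle `M ⟶ N ⟶ Cone(f) ⟶ ΣM` for some closed
morphism `f` of degree zero. -/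
structure CanonicalTriangulation where
  [hasShift : HasShift (H0 k A) ℤ]
  [hasZeroObject : HasZeroObject (H0 k A)]
  [shiftAdditive : ∀ n : ℤ, (shiftFunctor (H0 k A) n).Additive]
  [pretriangulated : Pretriangulated (H0 k A)]
  [isTriangulated : IsTriangulated (H0 k A)]
  shiftIso : shiftFunctor (H0 k A) (1 : ℤ) ⋙ (DGMod.yoneda k A).mapH0 ≅
    (DGMod.yoneda k A).mapH0 ⋙ (DGMod.susp k A).mapH0
  distinguished_iff : ∀ T : Triangle (H0 k A), T ∈ distTriang (H0 k A) ↔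
    ∃ (M N : DGMod k A) (f : DGCategory.Z0 k M N)
      (a : (DGMod.yoneda k A).mapH0.obj T.obj₁ ≅ ⟨M⟩)
      (b : (DGMod.yoneda k A).mapH0.obj T.obj₂ ≅ ⟨N⟩)
      (c : (DGMod.yoneda k A).mapH0.obj T.obj₃ ≅ ⟨DGMod.cone f⟩),
      (DGMod.yoneda k A).mapH0.map T.mor₁ ≫ b.hom = a.hom ≫ H0.homMk f ∧
      (DGMod.yoneda k A).mapH0.map T.mor₂ ≫ c.hom = b.hom ≫ H0.homMk (DGMod.coneInr f) ∧
      (DGMod.yoneda k A).mapH0.map T.mor₃ ≫ shiftIso.hom.app T.obj₁ ≫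
          (DGMod.susp k A).mapH0.map a.hom = c.hom ≫ H0.homMk (DGMod.coneFst f)

end Pretriangulated

/-- A complex `F` of `k`-modules is homotopically flat if `C ⊗ F` is acyclic for every acyclic
complex `C`. -/
def HomotopicallyFlat {k : Type u} [CommRing k] (F : CochainComplex (ModuleCat.{u} k) ℤ) : Prop :=
  ∀ C : CochainComplex (ModuleCat.{u} k) ℤ, C.Acyclic →
    (HomologicalComplex.tensorObj C F).Acyclic

/-- The objects of the dg quotient of `A` by the full dg subcategory on the objects
satisfying `P`: they are the objects of `A`. -/
structure DGQuot (k : Type u) [CommRing k] {A : Type u} [DGCategory k A] (P : A → Prop) where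
  obj : A

namespace DGQuot

open DGCategory

variable {k : Type u} [CommRing k] {A : Type u} [DGCategory k A]

/-- Indices `(U, p, q)` with `U` in the subcategory and `p - 1 + q = m`. -/
structure Idx (P : A → Prop) (m : ℤ) where
  U : A
  hU : P U
  p : ℤ
  q : ℤ
  h : p + q = m + 1

noncomputable instance (P : A → Prop) (m : ℤ) : DecidableEq (Idx P m) := Classical.decEq _

/-- `Word k P y n x m` is the degree `m` part of the sum, over `U₁, …, U_n` satisfying `P`, of
`A(U_n, y) ⊗ kε_{U_n} ⊗ A(U_{n-1}, U_n) ⊗ ⋯ ⊗ kε_{U₁} ⊗ A(x, U₁)`, where each `ε` has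
degree `-1`. -/
noncomputable def Word (k : Type u) [CommRing k] {A : Type u} [DGCategory k A] (P : A → Prop)
    (y : A) : ℕ → A → ℤ → ModuleCat.{u} k
  | 0, x, m => ModuleCat.of k (DGCategory.Hom k x y m)
  | n + 1, x, m => ModuleCat.of k
      (⨁ i : Idx P m, (Word k P y n i.U i.p ⊗[k] DGCategory.Hom k x i.U i.q))

/-- The homogeneous morphisms of degree `m` from `x` to `y` in the dg quotient. -/
abbrev QHom (k : Type u) [CommRing k] {A : Type u} [DGCategory k A] (P : A → Prop)
    (x y : A) (m : ℤ) : Type u := ⨁ n : ℕ, Word k P y n x m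

variable {P : A → Prop}

/-- Morphisms of `A`, in the dg quotient. -/
noncomputable def base {x y : A} {m : ℤ} : Hom k x y m →ₗ[k] QHom k P x y m :=
  DirectSum.lof k ℕ (fun n => Word k P y n x m) 0

/-- `snoc hU h w a` is the word `w ε_U a`, where `U` satisfies `P`. -/
noncomputable def snoc {x y U : A} (hU : P U) {p q m : ℤ} (h : p + q = m + 1) :
    QHom k P U y p →ₗ[k] Hom k x U q →ₗ[k] QHom k P x y m :=
  DirectSum.toModule k ℕ _ fun n =>
    (TensorProduct.mk k (Word k P y n U p) (Hom k x U q)).compr₂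
      (DirectSum.lof k ℕ (fun n => Word k P y n x m) (n + 1) ∘ₗ
        DirectSum.lof k (Idx P m)
          (fun i => Word k P y n i.U i.p ⊗[k] Hom k x i.U i.q) ⟨U, hU, p, q, h⟩)

section Rec

variable {y : A} {X : A → ℤ → Type u} [∀ x m, AddCommGroup (X x m)] [∀ x m, Module k (X x m)]
  (b : ∀ (x : A) (m : ℤ), Hom k x y m →ₗ[k] X x m)
  (s : ∀ (x U : A) (_ : P U) (p q m : ℤ) (_ : p + q = m + 1),
    (QHom k P U y p × X U p) →ₗ[k] Hom k x U q →ₗ[k] X x m)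

/-- Recursion on words. -/
noncomputable def recWord : ∀ (n : ℕ) (x : A) (m : ℤ), Word k P y n x m →ₗ[k] X x m
  | 0, x, m => b x m
  | n + 1, x, m => DirectSum.toModule k (Idx P m) (X x m) fun i =>
      TensorProduct.lift (s x i.U i.hU i.p i.q m i.h ∘ₗ
        LinearMap.prod (DirectSum.lof k ℕ (fun n => Word k P y n i.U i.p) n)
          (recWord n i.U i.p))

/-- Recursion on morphisms of the dg quotient: a family of linear maps is determined by its values
on morphisms of `A` and on words `w ε_U a`, the latter in terms of `w` and the value on `w`. -/
noncomputable def recHom (x : A) (m : ℤ) : QHom k P x y m →ₗ[k] X x m :=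
  DirectSum.toModule k ℕ (X x m) fun n => recWord b s n x m

theorem recHom_base {x : A} {m : ℤ} (a : Hom k x y m) :
    recHom b s x m (base a) = b x m a := by
  unfold recHom base
  exact DirectSum.toModule_lof k _ _

theorem induction {motive : ∀ (x : A) (m : ℤ), QHom k P x y m → Prop}
    (hadd : ∀ x m (v w : QHom k P x y m), motive x m v → motive x m w → motive x m (v + w))
    (hbase : ∀ x m (a : Hom k x y m), motive x m (base a))
    (hsnoc : ∀ x U (hU : P U) p q m (h : p + q = m + 1) (w : QHom k P U y p) (a : Hom k x U q),
      motive U p w → motive x m (snoc hU h w a)) {x : A} {m : ℤ} (w : QHom k P x y m) :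
    motive x m w := by
  have hzero : ∀ x m, motive x m 0 := fun x m => by
    have := hbase x m 0
    rwa [map_zero] at this
  have key : ∀ (n : ℕ) (x : A) (m : ℤ) (w : Word k P y n x m),
      motive x m (DirectSum.lof k ℕ (fun n => Word k P y n x m) n w) := by
    intro n
    induction n with
    | zero => exact fun x m w => hbase x m w
    | succ n ih =>
      intro x m w
      change (⨁ i : Idx P m, (Word k P y n i.U i.p ⊗[k] Hom k x i.U i.q)) at w
      induction w using DirectSum.induction_on with
      | zero => exact (map_zero (DirectSum.lof k ℕ (fun n => Word k P y n x m) (n + 1))) ▸ hzero x m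
      | add v w hv hw =>
        have e := map_add (DirectSum.lof k ℕ (fun n => Word k P y n x m) (n + 1)) v w
        exact e ▸ hadd _ _ _ _ hv hw
      | of i t =>
        induction t using TensorProduct.induction_on with
        | zero =>
          have e := map_zero (DirectSum.lof k ℕ (fun n => Word k P y n x m) (n + 1) ∘ₗ
            DirectSum.lof k (Idx P m) (fun i => Word k P y n i.U i.p ⊗[k] Hom k x i.U i.q) i)
          exact e ▸ hzero x m
        | add v w hv hw =>
          have e := map_add (DirectSum.lof k ℕ (fun n => Word k P y n x m) (n + 1) ∘ₗ
            DirectSum.lof k (Idx P m) (fun i => Word k P y n i.U i.p ⊗[k] Hom k x i.U i.q) i) v w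
          exact e ▸ hadd _ _ _ _ hv hw
        | tmul w a =>
          have e := hsnoc x i.U i.hU i.p i.q m i.h _ a (ih i.U i.p w)
          unfold snoc at e
          rw [DirectSum.toModule_lof] at e
          exact e
  induction w using DirectSum.induction_on with
  | zero => exact hzero x m
  | add v w hv hw => exact hadd _ _ _ _ hv hw
  | of n w => exact key n x m w

theorem recHom_snoc {x U : A} (hU : P U) {p q m : ℤ} (h : p + q = m + 1) (w : QHom k P U y p)
    (a : Hom k x U q) :
    recHom b s x m (snoc hU h w a) = s x U hU p q m h (w, recHom b s U p w) a := by
  induction w using DirectSum.induction_on with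
  | zero =>
    have e : ((0, 0) : QHom k P U y p × X U p) = 0 := rfl
    simp [e]
  | add v w hv hw =>
    have e : ((v + w, recHom b s U p (v + w)) : QHom k P U y p × X U p) =
      (v, recHom b s U p v) + (w, recHom b s U p w) := by simp
    rw [e, map_add, map_add, LinearMap.add_apply, LinearMap.add_apply, map_add, hv, hw]
  | of n w =>
    change recHom b s x m (snoc hU h (DirectSum.lof k ℕ (fun n => Word k P y n U p) n w) a) =
      s x U hU p q m h (DirectSum.lof k ℕ (fun n => Word k P y n U p) n w,
        recHom b s U p (DirectSum.lof k ℕ (fun n => Word k P y n U p) n w)) a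
    unfold snoc recHom
    rw [DirectSum.toModule_lof, DirectSum.toModule_lof]
    refine (DirectSum.toModule_lof k (M := fun n => Word k P y n x m) (n + 1) _).trans ?_
    refine (DirectSum.toModule_lof k (M := fun i : Idx P m =>
      Word k P y n i.U i.p ⊗[k] Hom k x i.U i.q) ⟨U, hU, p, q, h⟩ _).trans ?_
    exact TensorProduct.lift.tmul _ _

end Rec

/-- Composition `w ∘ a` in the dg quotient, with `a` a morphism of `A`:
`(w ε_U b) ∘ a = w ε_U (b ∘ a)`. -/
noncomputable def ract {x x' y : A} {p q n : ℤ} (h : p + q = n) :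
    QHom k P x y p →ₗ[k] Hom k x' x q →ₗ[k] QHom k P x' y n :=
  LinearMap.proj (R := k) (φ := fun n : {n : ℤ // p + q = n} =>
      Hom k x' x q →ₗ[k] QHom k P x' y n.1) ⟨n, h⟩ ∘ₗ
  recHom (P := P) (y := y) (X := fun x p => ∀ n : {n : ℤ // p + q = n},
      Hom k x' x q →ₗ[k] QHom k P x' y n.1)
    (fun x p => LinearMap.pi fun n =>
      (DGCategory.comp (k := k) (x := x') n.2).compr₂ base)
    (fun x U hU p' q' m e =>
      LinearMap.mk₂ k (fun w b n => snoc (P := P) (k := k) (m := n.1) hU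
          (by have := n.2; omega : p' + (q' + q) = n.1 + 1) w.1 ∘ₗ
            DGCategory.comp (k := k) (x := x') rfl b)
        (fun w w' b => by ext; simp) (fun c w b => by ext; simp) (fun w b b' => by ext; simp)
        (fun c w b => by ext; simp))
    x p

theorem ract_base {x x' y : A} {p q n : ℤ} (h : p + q = n) (b : Hom k x y p) (a : Hom k x' x q) :
    ract h (base b : QHom k P x y p) a = base (DGCategory.comp h b a) := by
  unfold ract
  rw [LinearMap.comp_apply, recHom_base]
  rfl

theorem ract_snoc {x x' y U : A} (hU : P U) {p q m s t n : ℤ} (e : p + q = m + 1) (h : m + s = n)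
    (ht : q + s = t) (e' : p + t = n + 1) (w : QHom k P U y p) (b : Hom k x U q)
    (a : Hom k x' x s) :
    ract h (snoc hU e w b : QHom k P x y m) a = snoc hU e' w (DGCategory.comp ht b a) := by
  subst ht
  unfold ract
  rw [LinearMap.comp_apply, recHom_snoc]
  rfl

/-- Composition in the dg quotient: `v ∘ (w ε_U a) = (v ∘ w) ε_U a`. -/
noncomputable def qcomp {x y z : A} {p q n : ℤ} (h : p + q = n) :
    QHom k P y z p →ₗ[k] QHom k P x y q →ₗ[k] QHom k P x z n :=
  (LinearMap.proj (R := k) (φ := fun n : {n : ℤ // p + q = n} =>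
      QHom k P y z p →ₗ[k] QHom k P x z n.1) ⟨n, h⟩ ∘ₗ
  recHom (P := P) (y := y) (X := fun x q => ∀ n : {n : ℤ // p + q = n},
      QHom k P y z p →ₗ[k] QHom k P x z n.1)
    (fun x q => LinearMap.pi fun n => (ract n.2).flip)
    (fun x U hU p' q' m e =>
      LinearMap.mk₂ k (fun w b n => (snoc (P := P) (k := k) (m := n.1) hU
          (by have := n.2; omega : p + p' + q' = n.1 + 1)).flip b ∘ₗ w.2 ⟨p + p', rfl⟩)
        (fun w w' b => by ext; simp) (fun c w b => by ext; simp) (fun w b b' => by ext; simp)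
        (fun c w b => by ext; simp))
    x q).flip

theorem qcomp_base {x y z : A} {p q n : ℤ} (h : p + q = n) (v : QHom k P y z p)
    (a : Hom k x y q) : qcomp h v (base a : QHom k P x y q) = ract h v a := by
  unfold qcomp
  rw [LinearMap.flip_apply, LinearMap.comp_apply, recHom_base]
  rfl

theorem qcomp_snoc {x y z U : A} (hU : P U) {p q m s t n : ℤ} (e : p + q = m + 1) (h : s + m = n)
    (ht : s + p = t) (e' : t + q = n + 1) (v : QHom k P y z s) (w : QHom k P U y p)
    (a : Hom k x U q) :
    qcomp h v (snoc hU e w a : QHom k P x y m) = snoc hU e' (qcomp ht v w) a := by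
  subst ht
  unfold qcomp
  rw [LinearMap.flip_apply, LinearMap.comp_apply, recHom_snoc]
  rfl

/-- The differential of the dg quotient:
`d(w ε_U a) = d(w) ε_U a + (-1)^|w| (w ∘ a - w ε_U d(a))`. -/
noncomputable def qd {x y : A} (p q : ℤ) (h : p + 1 = q) :
    QHom k P x y p →ₗ[k] QHom k P x y q :=
  LinearMap.proj (R := k) (φ := fun n : {n : ℤ // p + 1 = n} => QHom k P x y n.1) ⟨q, h⟩ ∘ₗ
  recHom (P := P) (y := y) (X := fun x p => ∀ n : {n : ℤ // p + 1 = n}, QHom k P x y n.1)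
    (fun x p => LinearMap.pi fun n => base ∘ₗ DGCategory.d p n.1 n.2)
    (fun x U hU p q m e =>
      LinearMap.mk₂ k (fun w a n =>
          snoc (P := P) (k := k) (m := n.1) hU
            (by have := n.2; omega : p + 1 + q = n.1 + 1) (w.2 ⟨p + 1, rfl⟩) a +
          p.negOnePow • (ract (by have := n.2; omega : p + q = n.1) w.1 a -
            snoc hU (by have := n.2; omega : p + (q + 1) = n.1 + 1) w.1
              (DGCategory.d q (q + 1) rfl a)))
        (fun w w' b => by
          funext n
          simp only [Prod.fst_add, Prod.snd_add, Pi.add_apply, map_add, LinearMap.add_apply,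
            smul_add, smul_sub]
          abel)
        (fun c w b => by
          funext n
          simp only [Prod.smul_fst, Prod.smul_snd, Pi.smul_apply, map_smul, LinearMap.smul_apply,
            smul_add, smul_sub, smul_comm c])
        (fun w b b' => by
          funext n
          simp only [Pi.add_apply, map_add, smul_add, smul_sub]
          abel)
        (fun c w b => by
          funext n
          simp only [Pi.smul_apply, map_smul, smul_add, smul_sub, smul_comm c]))
    x p

theorem qd_base {x y : A} (p q : ℤ) (h : p + 1 = q) (a : Hom k x y p) :
    qd p q h (base a : QHom k P x y p) = base (DGCategory.d p q h a) := by
  unfold qd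
  rw [LinearMap.comp_apply, recHom_base]
  rfl

theorem qd_snoc {x y U : A} (hU : P U) {p q m p' q' n : ℤ} (e : p + q = m + 1) (h : m + 1 = n)
    (hp : p + 1 = p') (hq : q + 1 = q') (e₁ : p' + q = n + 1) (e₂ : p + q = n)
    (e₃ : p + q' = n + 1) (w : QHom k P U y p) (a : Hom k x U q) :
    qd m n h (snoc hU e w a : QHom k P x y m) =
      snoc hU e₁ (qd p p' hp w) a + p.negOnePow • (ract e₂ w a -
        snoc hU e₃ w (DGCategory.d q q' hq a)) := by
  subst hp hq
  unfold qd
  rw [LinearMap.comp_apply, recHom_snoc]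
  rfl

theorem ract_one {x y : A} {p : ℤ} (h : p + 0 = p) (w : QHom k P x y p) :
    ract h w (DGCategory.one x) = w := by
  induction w using induction with
  | hadd x m v w hv hw => rw [map_add, LinearMap.add_apply, hv, hw]
  | hbase x m a => rw [ract_base, DGCategory.comp_one]
  | hsnoc x U hU p q m e w a _ => rw [ract_snoc hU e h (add_zero q) e, DGCategory.comp_one]

theorem ract_ract {x x' x'' y : A} {p q r pq qr n : ℤ} (h₁ : p + q = pq) (h₂ : pq + r = n)
    (h₃ : q + r = qr) (h₄ : p + qr = n) (w : QHom k P x y p) (a : Hom k x' x q)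
    (b : Hom k x'' x' r) :
    ract h₂ (ract h₁ w a) b = ract h₄ w (DGCategory.comp h₃ a b) := by
  induction w using induction generalizing pq n with
  | hadd x m v w hv hw =>
    simp only [map_add, LinearMap.add_apply, hv h₁ h₂ h₄, hw h₁ h₂ h₄]
  | hbase x m c => rw [ract_base, ract_base, ract_base, DGCategory.assoc h₁ h₂ h₃ h₄]
  | hsnoc x U hU s t m e w c _ =>
    rw [ract_snoc hU e h₁ rfl (by omega), ract_snoc hU _ h₂ rfl (by omega),
      ract_snoc hU e h₄ (by omega : t + qr = t + q + r) (by omega),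
      DGCategory.assoc rfl rfl h₃ (by omega)]

theorem qcomp_ract {x x' y z : A} {p q r pq qr n : ℤ} (h₁ : p + q = pq) (h₂ : pq + r = n)
    (h₃ : q + r = qr) (h₄ : p + qr = n) (v : QHom k P y z p) (w : QHom k P x y q)
    (a : Hom k x' x r) :
    ract h₂ (qcomp h₁ v w) a = qcomp h₄ v (ract h₃ w a) := by
  induction w using induction generalizing pq qr n with
  | hadd x m w w' hw hw' =>
    simp only [map_add, LinearMap.add_apply, hw h₁ h₂ h₃ h₄, hw' h₁ h₂ h₃ h₄]
  | hbase x m c => rw [qcomp_base, ract_base, qcomp_base, ract_ract h₁ h₂ h₃ h₄]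
  | hsnoc x U hU s t m e w c _ =>
    rw [qcomp_snoc hU e h₁ rfl (by omega), ract_snoc hU _ h₂ rfl (by omega),
      ract_snoc hU e h₃ rfl (by omega), qcomp_snoc hU _ h₄ rfl (by omega)]

theorem qcomp_assoc {w x y z : A} {p q r pq qr n : ℤ} (h₁ : p + q = pq) (h₂ : pq + r = n)
    (h₃ : q + r = qr) (h₄ : p + qr = n) (f : QHom k P y z p) (g : QHom k P x y q)
    (h : QHom k P w x r) :
    qcomp h₂ (qcomp h₁ f g) h = qcomp h₄ f (qcomp h₃ g h) := by
  induction h using induction generalizing qr n with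
  | hadd x m v v' hv hv' =>
    simp only [map_add, hv h₂ h₃ h₄, hv' h₂ h₃ h₄]
  | hbase x m c => rw [qcomp_base, qcomp_base, qcomp_ract h₁ h₂ h₃ h₄]
  | hsnoc x U hU s t m e v c ih =>
    rw [qcomp_snoc hU e h₂ rfl (by omega), qcomp_snoc hU e h₃ rfl (by omega),
      qcomp_snoc hU _ h₄ (by omega : p + (q + s) = pq + s) (by omega), ih rfl rfl (by omega)]

theorem one_qcomp {x y : A} {p : ℤ} (h : 0 + p = p) (f : QHom k P x y p) :
    qcomp h (base (DGCategory.one y)) f = f := by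
  induction f using induction with
  | hadd x m v w hv hw => rw [map_add, hv, hw]
  | hbase x m a => rw [qcomp_base, ract_base, DGCategory.one_comp]
  | hsnoc x U hU p q m e w a ih => rw [qcomp_snoc hU e h (zero_add p) e, ih]

theorem smul_negOnePow_of_add {V : Type*} [AddCommGroup V] {s t m : ℤ} (e : s + t = m + 1)
    (v : V) : s.negOnePow • t.negOnePow • v = -(m.negOnePow • v) := by
  rw [smul_smul, ← Int.negOnePow_add, e, DGMod.smul_negOnePow_succ]

theorem qd_ract {x x' y : A} {p q n p' q' n' : ℤ} (h : p + q = n) (hn : n + 1 = n')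
    (hp : p + 1 = p') (h₁ : p' + q = n') (hq : q + 1 = q') (h₂ : p + q' = n')
    (w : QHom k P x y p) (a : Hom k x' x q) :
    qd n n' hn (ract h w a) =
      ract h₁ (qd p p' hp w) a + p.negOnePow • ract h₂ w (DGCategory.d q q' hq a) := by
  induction w using induction generalizing n p' n' with
  | hadd x m v w hv hw =>
    simp only [map_add, LinearMap.add_apply, hv h hn hp h₁ h₂, hw h hn hp h₁ h₂, smul_add]
    abel
  | hbase x m c =>
    rw [ract_base, qd_base, qd_base, ract_base, ract_base, DGCategory.leibniz h hn hp h₁ hq h₂,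
      map_add, DGMod.map_units_smul_int]
  | hsnoc x U hU s t m e w c _ =>
    rw [ract_snoc hU e h rfl (by omega), ract_snoc hU e h₂ (by omega : t + q' = t + q + 1) (by omega),
      qd_snoc hU _ hn rfl rfl (by omega) (by omega) (by omega),
      qd_snoc hU e hp rfl rfl (by omega) (by omega) (by omega), map_add, LinearMap.add_apply,
      DGMod.map_units_smul_int₂, map_sub, LinearMap.sub_apply,
      ract_snoc hU _ h₁ rfl (by omega), ract_ract _ _ rfl (by omega),
      ract_snoc hU _ h₁ (by omega : t + 1 + q = t + q + 1) (by omega),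
      DGCategory.leibniz (rfl : t + q = t + q) rfl rfl (by omega) hq (by omega),
      map_add, DGMod.map_units_smul_int]
    have key := smul_negOnePow_of_add e (snoc hU (by omega : s + (t + q + 1) = n' + 1) w
      (DGCategory.comp (by omega) c (DGCategory.d q q' hq a)) : QHom k P x' _ n')
    simp only [smul_add, smul_sub, key]
    abel

theorem qd_qd {x y : A} (p q r : ℤ) (h : p + 1 = q) (h' : q + 1 = r) (f : QHom k P x y p) :
    qd q r h' (qd p q h f) = 0 := by
  induction f using induction generalizing q r with
  | hadd x m v w hv hw => rw [map_add, map_add, hv, hw, add_zero]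
  | hbase x m a => rw [qd_base, qd_base, DGCategory.d_d, map_zero]
  | hsnoc x U hU s t m e w a ih =>
    rw [qd_snoc hU e h rfl rfl (by omega) (by omega) (by omega), map_add,
      qd_snoc hU _ h' rfl rfl (by omega) (by omega) (by omega), ih _ _ rfl rfl, map_zero,
      DGMod.map_units_smul_int, map_sub,
      qd_ract _ h' rfl (by omega) rfl (by omega),
      qd_snoc hU _ h' rfl rfl (by omega) (by omega) (by omega), DGCategory.d_d, map_zero,
      DGMod.smul_negOnePow_succ]
    simp only [LinearMap.zero_apply, zero_add, sub_zero, smul_add, smul_sub]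
    abel

theorem qd_qcomp {x y z : A} {p q n p' q' n' : ℤ} (h : p + q = n) (hn : n + 1 = n')
    (hp : p + 1 = p') (h₁ : p' + q = n') (hq : q + 1 = q') (h₂ : p + q' = n')
    (g : QHom k P y z p) (f : QHom k P x y q) :
    qd n n' hn (qcomp h g f) =
      qcomp h₁ (qd p p' hp g) f + p.negOnePow • qcomp h₂ g (qd q q' hq f) := by
  induction f using induction generalizing n q' n' with
  | hadd x m v w hv hw =>
    simp only [map_add, hv h hn h₁ hq h₂, hw h hn h₁ hq h₂, smul_add]
    abel
  | hbase x m c =>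
    rw [qcomp_base, qcomp_base, qd_base, qcomp_base, qd_ract h hn hp h₁ hq h₂]
  | hsnoc x U hU s t m e w a ih =>
    rw [qcomp_snoc hU e h rfl (by omega), qd_snoc hU _ hn rfl rfl (by omega) (by omega) (by omega),
      ih rfl rfl (by omega : p' + s = p + s + 1) rfl (by omega),
      qcomp_snoc hU e h₁ (by omega : p' + s = p + s + 1) (by omega),
      qd_snoc hU e hq rfl rfl (by omega) (by omega) (by omega), map_add (qcomp h₂ g),
      qcomp_snoc hU _ h₂ (by omega : p + (s + 1) = p + s + 1) (by omega),
      DGMod.map_units_smul_int, map_sub (qcomp h₂ g), qcomp_snoc hU _ h₂ rfl (by omega),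
      ← qcomp_ract rfl (by omega) _ h₂, map_add, LinearMap.add_apply,
      DGMod.map_units_smul_int₂, Int.negOnePow_add, mul_smul, smul_add]
    abel

/-- The dg quotient category `A/B`, for the full dg subcategory `B` of `A` on the objects
satisfying `P`: it is obtained from `A` by freely adding, for each object `U` of `B`, a morphism
`ε_U : U → U` of degree `-1` with `d(ε_U) = 1_U`. -/
noncomputable instance (P : A → Prop) : DGCategory k (DGQuot k P) where
  Hom x y n := QHom k P x.obj y.obj n
  d p q h := qd p q h
  comp h := qcomp h
  one x := base (DGCategory.one x.obj)
  d_d := qd_qd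
  one_comp := one_qcomp
  comp_one h f := by rw [qcomp_base, ract_one]
  assoc := qcomp_assoc
  leibniz := qd_qcomp

/-- The canonical dg functor `A → A/B`. -/
noncomputable def proj (k : Type u) [CommRing k] {A : Type u} [DGCategory k A] (P : A → Prop) :
    DGFunctor k A (DGQuot k P) where
  obj x := ⟨x⟩
  map := base
  map_d p q h f := (qd_base p q h f).symm
  map_one _ := rfl
  map_comp h g f := ((qcomp_base h (base g) f).trans (ract_base h g f)).symm

/-- The morphism `ε_U` of degree `-1`. -/
noncomputable def eps {U : A} (hU : P U) :
    Hom k (⟨U⟩ : DGQuot k P) ⟨U⟩ (-1) :=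
  snoc (P := P) (k := k) hU (by norm_num : (0 : ℤ) + 0 = -1 + 1) (base (DGCategory.one U))
    (DGCategory.one U)

theorem snoc_eq_comp {x y U : A} (hU : P U) {p q m n : ℤ} (h : p + q = m + 1) (h₁ : p + -1 = n)
    (h₂ : n + q = m) (w : QHom k P U y p) (a : Hom k x U q) :
    (snoc hU h w a : QHom k P x y m) = qcomp h₂ (qcomp h₁ w (eps (k := k) hU)) (base a) := by
  unfold eps
  rw [qcomp_base, qcomp_snoc hU _ h₁ (add_zero p) (by omega), qcomp_base, ract_one,
    ract_snoc hU _ h₂ (zero_add q) h, DGCategory.one_comp]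

theorem d_eps {U : A} (hU : P U) :
    DGCategory.d (k := k) (-1) 0 (neg_add_cancel 1) (eps (k := k) hU) =
      DGCategory.one (⟨U⟩ : DGQuot k P) := by
  refine (qd_snoc hU _ _ (zero_add 1) (zero_add 1) (add_zero 1) (add_zero 0) (zero_add 1)
    _ _).trans ?_
  rw [qd_base, DGCategory.d_one, map_zero, map_zero, map_zero, LinearMap.zero_apply, ract_one]
  simp
  rfl

end DGQuot

/-- An isomorphism of categories. -/
def CategoryTheory.Functor.IsCatIso {C : Type*} [Category* C] {D : Type*} [Category* D]
    (F : C ⥤ D) : Prop :=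
  ∃ G : D ⥤ C, F ⋙ G = 𝟭 C ∧ G ⋙ F = 𝟭 D

/-- A functor between pretriangulated categories is an isomorphism of triangulated categories if
it is an isomorphism of categories and, for some natural isomorphisms commuting it with the shifts,
it preserves and reflects distinguished triangles. -/
def IsTriangulatedIso {C : Type*} [Category* C] [HasShift C ℤ] [HasZeroObject C] [Preadditive C]
    [∀ n : ℤ, (shiftFunctor C n).Additive] [Pretriangulated C]
    {D : Type*} [Category* D] [HasShift D ℤ] [HasZeroObject D] [Preadditive D]
    [∀ n : ℤ, (shiftFunctor D n).Additive] [Pretriangulated D] (F : C ⥤ D) : Prop :=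
  F.IsCatIso ∧ ∃ _ : F.CommShift ℤ, F.IsTriangulated ∧
    ∀ T : Triangle C, F.mapTriangle.obj T ∈ distTriang D → T ∈ distTriang C

/-- The objects of `H⁰(A)` isomorphic to an object of the full subcategory `H⁰(B)`, where `B` is
the full dg subcategory on the objects satisfying `P`. -/
def H0.sub (k : Type u) [CommRing k] {A : Type v} [DGCategory k A] (P : A → Prop) :
    ObjectProperty (H0 k A) :=
  ObjectProperty.isoClosure fun X => P X.obj

/-!
# Dg quotients of pretriangulated dg categories

The homotopy category of a dg category with strict shifts and cones (`StrictPretr`) is triangulated,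
and the dg modules over `A` form such a dg category.  If `A` is pretriangulated, the representable
modules are closed under shifts and cones up to homotopy equivalence, so `H⁰(A)` inherits a canonical
triangulated structure along the fully faithful Yoneda embedding (`nonempty_canonicalTriangulation`).
A dg functor `F : A → A'` is exact for canonical structures (`DGFunctor.exists_isTriangulated`): on
modules it is extension along `F`, of which only the partial left adjoint of restriction is needed,
defined where it exists (`DGFunctor.Ext`).  In particular `H⁰(B)` generates a triangulated
subcategory of `H⁰(A)` by adding isomorphic objects (`H0.isTriangulated_sub`), and a morphism of
`H⁰(A)` with cone in `H⁰(B)` becomes invertible in `H⁰(A/B)`, where the objects of `B` are zero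
(`DGFunctor.isIso_map_of_trW`).

The heart of the proof is that the morphisms of `H⁰(A/B)` are right fractions of morphisms of `H⁰(A)`
with denominators in the class `W` of morphisms with cone in `H⁰(B)` (`H0.exists_fraction`), and that
a morphism of `H⁰(A)` which vanishes in `H⁰(A/B)` is annihilated by an element of `W`
(`H0.exists_comp_eq_zero`).  Both are instances of `DGQuot.exists_ract_eq_base_add_qd`: an element
`t` of a Hom-complex of `A/B` whose boundary lies in `A` is, after composition with some `s ∈ W`,
homologous to an element of `A`.  The morphisms `x → y` of `A/B` are spanned by words
`a₀ ε a₁ ε ⋯ ε aₙ`; modulo shorter words, those with `n + 1` letters `ε` form the bar complex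
`⨁_U C(U) ⊗ kε_U ⊗ A(x, U)`, where `C(U)` is the complex of words `U → y` with `n` letters.  The top
part of `t` is a cycle there, and it has to be shown that a cycle of the bar complex becomes a
boundary after the action of some `s ∈ W` (`CxFam.exists_barD_eq_barAct_of_closed`).

* A closed morphism `a : x → U` with `U` in `B` becomes a coboundary after composition with the
  element of `W` that completes the class of `a` to a distinguished triangle
  (`DGCategory.IsKilling`, `H0.isKilling`).
* The complexes `C(U)` embed into acyclic complexes obtained by attaching free cells
  (`CxFam.cellular`).  Since `A(x, U)` is homotopically flat, the bar complex with these coefficients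
  is acyclic (`CxFam.exists_barD_eq`), so the cycle bounds an element there.
* That element involves finitely many cells.  Its components at the cells of highest rank are closed
  morphisms `x → U` of `A`, which some `s ∈ W` makes into coboundaries, so that these cells can be
  removed; descending induction on the rank leaves an element without cells
  (`CxFam.exists_barD_eq_barAct`).

By the statement on fractions, every morphism of `H⁰(A/B)` is isomorphic to the image of a morphism of
`H⁰(A)`, so the modules represented by objects of `A/B` are closed under cones up to homotopy
equivalence and `A/B` is pretriangulated (`DGQuot.isPretriangulatedDG`).  The functor from the Verdier
quotient is exact because `H⁰(π)` is; it is full and faithful by the two statements on fractions, and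
bijective on objects (`CategoryTheory.Functor.exists_isTriangulatedIso`).
-/

/-! ### Homogeneous morphisms without proofs about degrees -/

namespace DGCategory

/-- The category with the objects of a dg category `D`, in which a morphism is a finite sum of
homogeneous morphisms of `D`.  Composition is in diagrammatic order, so that `comp h g f` becomes
`tot f ≫ tot g`.  Identities between homogeneous morphisms are verified here, where composition
carries no proof about degrees. -/
structure Tot (k : Type u) [CommRing k] (D : Type v) [DGCategory k D] where
  obj : D

variable {k : Type u} [CommRing k] {D : Type v} [DGCategory k D]

namespace Tot

/-- Composition of sums of homogeneous morphisms. -/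
noncomputable def compL (x y z : D) : (⨁ n, Hom k y z n) →ₗ[k] (⨁ n, Hom k x y n) →ₗ[k]
    (⨁ n, Hom k x z n) :=
  DirectSum.toModule k ℤ _ fun p => LinearMap.flip (DirectSum.toModule k ℤ _ fun q =>
    LinearMap.flip ((comp (k := k) (x := x) (y := y) (z := z) (rfl : p + q = p + q)).compr₂
      (DirectSum.lof k ℤ (fun n => Hom k x z n) (p + q))))

theorem compL_lof {x y z : D} {p q n : ℤ} (h : p + q = n) (g : Hom k y z p) (f : Hom k x y q) :
    compL x y z (DirectSum.lof k ℤ (fun n => Hom k y z n) p g)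
      (DirectSum.lof k ℤ (fun n => Hom k x y n) q f) =
    DirectSum.lof k ℤ (fun n => Hom k x z n) n (comp h g f) := by
  subst h
  unfold compL
  rw [DirectSum.toModule_lof, LinearMap.flip_apply, DirectSum.toModule_lof]
  rfl

theorem hom_induction {x y : D} {motive : (⨁ n, Hom k x y n) → Prop} (f : ⨁ n, Hom k x y n)
    (h0 : motive 0) (hadd : ∀ f g, motive f → motive g → motive (f + g))
    (hof : ∀ n (f : Hom k x y n), motive (DirectSum.lof k ℤ (fun n => Hom k x y n) n f)) :
    motive f := by
  induction f using DirectSum.induction_on with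
  | zero => exact h0
  | add f g hf hg => exact hadd f g hf hg
  | of n f => exact hof n f

noncomputable instance : Category.{u} (Tot k D) where
  Hom X Y := ⨁ n, Hom k X.obj Y.obj n
  id X := DirectSum.lof k ℤ (fun n => Hom k X.obj X.obj n) 0 (one X.obj)
  comp f g := compL _ _ _ g f
  id_comp f := by
    induction f using hom_induction with
    | h0 => rw [map_zero, LinearMap.zero_apply]
    | hadd f g hf hg => rw [map_add, LinearMap.add_apply, hf, hg]
    | hof n f => rw [compL_lof (add_zero n), comp_one]
  comp_id f := by
    induction f using hom_induction with
    | h0 => rw [map_zero]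
    | hadd f g hf hg => rw [map_add, hf, hg]
    | hof n f => rw [compL_lof (zero_add n), one_comp]
  assoc f g h := by
    induction f using hom_induction with
    | h0 => simp only [map_zero]
    | hadd f f' hf hf' => simp only [map_add, hf, hf']
    | hof n f =>
      induction g using hom_induction with
      | h0 => simp only [map_zero, LinearMap.zero_apply]
      | hadd f f' hf hf' => simp only [map_add, LinearMap.add_apply, hf, hf']
      | hof m g =>
        induction h using hom_induction with
        | h0 => simp only [map_zero, LinearMap.zero_apply]
        | hadd f f' hf hf' => simp only [map_add, LinearMap.add_apply, hf, hf']
        | hof l h =>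
          rw [compL_lof rfl, compL_lof (by omega : l + (m + n) = l + m + n), compL_lof rfl,
            compL_lof rfl, assoc rfl rfl rfl]

noncomputable instance : Preadditive (Tot k D) where
  homGroup X Y := inferInstanceAs (AddCommGroup (⨁ n, Hom k X.obj Y.obj n))
  add_comp X Y Z f f' g := (compL _ _ _ g).map_add f f'
  comp_add X Y Z f g g' := by
    exact LinearMap.congr_fun ((compL X.obj Y.obj Z.obj).map_add g g') f

end Tot

/-- A homogeneous morphism, as a morphism of `Tot k D`. -/
noncomputable def tot {x y : D} {n : ℤ} (f : Hom k x y n) : (⟨x⟩ : Tot k D) ⟶ ⟨y⟩ :=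
  (DirectSum.lof k ℤ (fun n => Hom k x y n) n f : ⨁ n, Hom k x y n)

section

variable {x y z : D} {n : ℤ}

theorem tot_injective : Function.Injective (tot : Hom k x y n → _) :=
  DirectSum.of_injective (β := fun n => Hom k x y n) n

theorem tot_inj {f g : Hom k x y n} : tot f = tot g ↔ f = g := tot_injective.eq_iff

@[simp] theorem tot_comp {p q : ℤ} (h : p + q = n) (g : Hom k y z p) (f : Hom k x y q) :
    tot (comp h g f) = tot f ≫ tot g := (Tot.compL_lof h g f).symm

@[simp] theorem tot_one : tot (one x : Hom k x x 0) = 𝟙 _ := rfl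

@[simp] theorem tot_zero : tot (0 : Hom k x y n) = 0 :=
  map_zero (DirectSum.lof k ℤ (fun n => Hom k x y n) n)

@[simp] theorem tot_add (f g : Hom k x y n) : tot (f + g) = tot f + tot g :=
  map_add (DirectSum.lof k ℤ (fun n => Hom k x y n) n) f g

@[simp] theorem tot_sub (f g : Hom k x y n) : tot (f - g) = tot f - tot g :=
  map_sub (DirectSum.lof k ℤ (fun n => Hom k x y n) n) f g

@[simp] theorem tot_neg (f : Hom k x y n) : tot (-f) = -tot f :=
  map_neg (DirectSum.lof k ℤ (fun n => Hom k x y n) n) f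

@[simp] theorem tot_units_smul (c : ℤˣ) (f : Hom k x y n) : tot (c • f) = c • tot f := by
  rcases Int.units_eq_one_or c with rfl | rfl <;> simp

theorem tot_eq_zero {f : Hom k x y n} : tot f = 0 ↔ f = 0 := by
  rw [← tot_zero (n := n), tot_inj]

end

section

variable {X Y Z : Tot k D}

/-- The differential of `Tot k D`. -/
noncomputable def δ : (X ⟶ Y) →+ (X ⟶ Y) :=
  (DirectSum.toModule k ℤ (⨁ n, Hom k X.obj Y.obj n) fun n =>
    DirectSum.lof k ℤ (fun n => Hom k X.obj Y.obj n) (n + 1) ∘ₗ d n (n + 1) rfl).toAddMonoidHom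

/-- The sign `(-1)^|f| f` of a morphism of `Tot k D`. -/
noncomputable def ε : (X ⟶ Y) →+ (X ⟶ Y) :=
  (DirectSum.toModule k ℤ (⨁ n, Hom k X.obj Y.obj n) fun n =>
    n.negOnePow • DirectSum.lof k ℤ (fun n => Hom k X.obj Y.obj n) n).toAddMonoidHom

theorem δ_tot {x y : D} {p q : ℤ} (h : p + 1 = q) (f : Hom k x y p) :
    δ (tot f) = tot (d p q h f) := by
  subst h
  exact DirectSum.toModule_lof k (M := fun n => Hom k x y n)
    (φ := fun n => DirectSum.lof k ℤ (fun n => Hom k x y n) (n + 1) ∘ₗ d n (n + 1) rfl) p f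

theorem ε_tot {x y : D} {p : ℤ} (f : Hom k x y p) : ε (tot f) = p.negOnePow • tot f :=
  DirectSum.toModule_lof k (M := fun n => Hom k x y n)
    (φ := fun n => n.negOnePow • DirectSum.lof k ℤ (fun n => Hom k x y n) n) p f

theorem Tot.induction {motive : (X ⟶ Y) → Prop} (f : X ⟶ Y)
    (h0 : motive 0) (hadd : ∀ f g, motive f → motive g → motive (f + g))
    (hof : ∀ n (f : Hom k X.obj Y.obj n), motive (tot f)) : motive f :=
  Tot.hom_induction f h0 hadd hof

@[simp] theorem δ_comp (f : X ⟶ Y) (g : Y ⟶ Z) : δ (f ≫ g) = f ≫ δ g + δ f ≫ ε g := by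
  induction f using Tot.induction with
  | h0 => simp
  | hadd f f' hf hf' => simp only [Preadditive.add_comp, map_add, hf, hf']; abel
  | hof n f =>
    induction g using Tot.induction with
    | h0 => simp
    | hadd f f' hf hf' => simp only [Preadditive.comp_add, map_add, hf, hf']; abel
    | hof m g =>
      rw [← tot_comp rfl, δ_tot rfl, δ_tot rfl, δ_tot rfl, ε_tot,
        leibniz rfl rfl rfl (by omega) rfl (by omega)]
      simp

@[simp] theorem ε_comp (f : X ⟶ Y) (g : Y ⟶ Z) : ε (f ≫ g) = ε f ≫ ε g := by
  induction f using Tot.induction with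
  | h0 => simp
  | hadd f f' hf hf' => simp only [Preadditive.add_comp, map_add, hf, hf']
  | hof n f =>
    induction g using Tot.induction with
    | h0 => simp
    | hadd f f' hf hf' => simp only [Preadditive.comp_add, map_add, hf, hf']
    | hof m g =>
      rw [← tot_comp rfl, ε_tot, ε_tot, ε_tot, Int.negOnePow_add, mul_smul]
      simp

theorem closed_iff {x y : D} {p q : ℤ} (h : p + 1 = q) (f : Hom k x y p) :
    d p q h f = 0 ↔ δ (tot f) = 0 := by
  rw [δ_tot h, tot_eq_zero]

theorem ε_tot_zero {x y : D} (f : Hom k x y 0) : ε (tot f) = tot f := by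
  rw [ε_tot, Int.negOnePow_zero, one_smul]

theorem ε_tot_one {x y : D} (f : Hom k x y 1) : ε (tot f) = -tot f := by
  rw [ε_tot, Int.negOnePow_one, Units.neg_smul, one_smul]

theorem ε_tot_neg_one {x y : D} (f : Hom k x y (-1)) : ε (tot f) = -tot f := by
  rw [ε_tot, Int.negOnePow_neg, Int.negOnePow_one, Units.neg_smul, one_smul]

end

section

variable {x y z : D}

@[simp] theorem Z0.δ_tot (f : Z0 k x y) : δ (tot f.1) = 0 := (closed_iff (zero_add 1) _).1 f.2

@[simp] theorem Z0.ε_tot (f : Z0 k x y) : ε (tot f.1) = tot f.1 := ε_tot_zero _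

@[simp] theorem tot_Z0one (x : D) : tot (Z0one x : Z0 k x x).1 = 𝟙 _ := rfl

@[simp] theorem tot_Z0comp (g : Z0 k y z) (f : Z0 k x y) :
    tot (Z0comp g f).1 = tot f.1 ≫ tot g.1 := tot_comp _ _ _

/-- A morphism of degree zero with vanishing differential, as an element of `Z0`. -/
def Z0.mk (f : Hom k x y 0) (h : δ (tot f) = 0) : Z0 k x y := ⟨f, (closed_iff (zero_add 1) f).2 h⟩

end

end DGCategory

open DGCategory

namespace H0

variable {k : Type u} [CommRing k] {A : Type v} [DGCategory k A] {x y z : A}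

theorem homMk_surjective {X Y : H0 k A} (f : X ⟶ Y) : ∃ f' : Z0 k X.obj Y.obj, homMk f' = f :=
  Submodule.Quotient.mk_surjective _ f

theorem homMk_comp (f : Z0 k x y) (g : Z0 k y z) : homMk f ≫ homMk g = homMk (Z0comp g f) := rfl

theorem homMk_zero : homMk (0 : Z0 k x y) = 0 := rfl

theorem homMk_eq_iff {f g : Z0 k x y} :
    homMk f = homMk g ↔ ∃ t : Hom k x y (-1), tot f.1 - tot g.1 = δ (tot t) := by
  refine (Submodule.Quotient.eq _).trans ?_
  change (f - g).1 ∈ LinearMap.range _ ↔ _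
  simp only [LinearMap.mem_range, δ_tot (neg_add_cancel 1), ← tot_sub, tot_inj]
  exact exists_congr fun t => eq_comm

theorem homMk_eq {f g : Z0 k x y} (t : Hom k x y (-1)) (h : tot f.1 - tot g.1 = δ (tot t)) :
    homMk f = homMk g := homMk_eq_iff.2 ⟨t, h⟩

theorem homMk_eq_zero_iff {f : Z0 k x y} :
    homMk f = 0 ↔ ∃ t : Hom k x y (-1), tot f.1 = δ (tot t) := by
  rw [← homMk_zero, homMk_eq_iff]
  simp

theorem homMk_congr {f g : Z0 k x y} (h : tot f.1 = tot g.1) : homMk f = homMk g :=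
  congrArg homMk (Subtype.ext (tot_injective h))

/-- Mutually inverse homotopy equivalences give an isomorphism in the homotopy category. -/
def isoMk (f : Z0 k x y) (g : Z0 k y x) (s : Hom k x x (-1)) (t : Hom k y y (-1))
    (hs : tot f.1 ≫ tot g.1 - 𝟙 _ = δ (tot s)) (ht : tot g.1 ≫ tot f.1 - 𝟙 _ = δ (tot t)) :
    (⟨x⟩ : H0 k A) ≅ ⟨y⟩ where
  hom := homMk f
  inv := homMk g
  hom_inv_id := homMk_eq (f := Z0comp g f) (g := Z0one x) s (by simpa using hs)
  inv_hom_id := homMk_eq (f := Z0comp f g) (g := Z0one y) t (by simpa using ht)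

/-- An isomorphism in the homotopy category coming from an isomorphism of the dg category. -/
def isoMk' (f : Z0 k x y) (g : Z0 k y x)
    (hs : tot f.1 ≫ tot g.1 = 𝟙 _) (ht : tot g.1 ≫ tot f.1 = 𝟙 _) :
    (⟨x⟩ : H0 k A) ≅ ⟨y⟩ :=
  isoMk f g 0 0 (by simp [hs]) (by simp [ht])

theorem isZero_of_eq_δ (x : A) (t : Hom k x x (-1)) (h : 𝟙 _ = δ (tot t)) :
    IsZero (⟨x⟩ : H0 k A) := by
  rw [IsZero.iff_id_eq_zero]
  exact homMk_eq (f := Z0one x) (g := 0) t (by simpa using h)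

end H0

/-! ### Dg categories with strict shifts and cones -/

/-- A dg category with a zero object, shifts and cones in the strict sense: they are given by
homogeneous morphisms satisfying the usual equations on the nose.  The shift `x[n]` comes with a
closed isomorphism `σ : x → x[n]` of degree `-n`, and the cone of `f : x → y` is `y ⊕ x[1]` with
structure morphisms `inl : x → c`, `inr : y → c`, `fst : c → x`, `snd : c → y` of degrees
`-1`, `0`, `1`, `0`. -/
class StrictPretr (k : Type u) [CommRing k] (D : Type v) [DGCategory k D] where
  zero : D
  one_zero : (one zero : Hom k zero zero 0) = 0
  sh : D → ℤ → D
  σ : ∀ (x : D) (n : ℤ), Hom k x (sh x n) (-n)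
  τ : ∀ (x : D) (n : ℤ), Hom k (sh x n) x n
  d_σ : ∀ (x : D) (n : ℤ), d (-n) (-n + 1) rfl (σ x n) = 0
  d_τ : ∀ (x : D) (n : ℤ), d n (n + 1) rfl (τ x n) = 0
  τ_σ : ∀ (x : D) (n : ℤ), comp (add_neg_cancel n) (τ x n) (σ x n) = one x
  σ_τ : ∀ (x : D) (n : ℤ), comp (neg_add_cancel n) (σ x n) (τ x n) = one (sh x n)
  cone : ∀ {x y : D}, Z0 k x y → D
  inl : ∀ {x y : D} (f : Z0 k x y), Hom k x (cone f) (-1)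
  inr : ∀ {x y : D} (f : Z0 k x y), Hom k y (cone f) 0
  fst : ∀ {x y : D} (f : Z0 k x y), Hom k (cone f) x 1
  snd : ∀ {x y : D} (f : Z0 k x y), Hom k (cone f) y 0
  d_inl : ∀ {x y : D} (f : Z0 k x y),
    d (-1) 0 (neg_add_cancel 1) (inl f) = comp (zero_add 0) (inr f) f.1
  d_inr : ∀ {x y : D} (f : Z0 k x y), d 0 1 (zero_add 1) (inr f) = 0
  d_fst : ∀ {x y : D} (f : Z0 k x y), d 1 2 (by norm_num) (fst f) = 0
  d_snd : ∀ {x y : D} (f : Z0 k x y),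
    d 0 1 (zero_add 1) (snd f) = -comp (zero_add 1) f.1 (fst f)
  fst_inl : ∀ {x y : D} (f : Z0 k x y), comp (add_neg_cancel 1) (fst f) (inl f) = one x
  fst_inr : ∀ {x y : D} (f : Z0 k x y), comp (add_zero 1) (fst f) (inr f) = 0
  snd_inl : ∀ {x y : D} (f : Z0 k x y), comp (zero_add (-1)) (snd f) (inl f) = 0
  snd_inr : ∀ {x y : D} (f : Z0 k x y), comp (zero_add 0) (snd f) (inr f) = one y
  total : ∀ {x y : D} (f : Z0 k x y), comp (zero_add 0) (inr f) (snd f) +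
    comp (neg_add_cancel 1) (inl f) (fst f) = one (cone f)

namespace StrictPretr

variable {k : Type u} [CommRing k] {D : Type v} [DGCategory k D] [StrictPretr k D]

section tot

variable (x : D) (n : ℤ)

theorem tot_one_zero : 𝟙 (⟨zero k⟩ : Tot k D) = 0 := by
  rw [← tot_one, one_zero, tot_zero]

@[simp] theorem tot_σ_τ : tot (σ (k := k) x n) ≫ tot (τ x n) = 𝟙 _ := by
  rw [← tot_comp (add_neg_cancel n), τ_σ, tot_one]

@[simp] theorem tot_σ_τ_assoc {W : Tot k D} (h : (⟨x⟩ : Tot k D) ⟶ W) :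
    tot (σ (k := k) x n) ≫ tot (τ x n) ≫ h = h := by
  rw [← Category.assoc, tot_σ_τ, Category.id_comp]

@[simp] theorem tot_τ_σ : tot (τ (k := k) x n) ≫ tot (σ x n) = 𝟙 _ := by
  rw [← tot_comp (neg_add_cancel n), σ_τ, tot_one]

@[simp] theorem tot_τ_σ_assoc {W : Tot k D} (h : (⟨sh k x n⟩ : Tot k D) ⟶ W) :
    tot (τ (k := k) x n) ≫ tot (σ x n) ≫ h = h := by
  rw [← Category.assoc, tot_τ_σ, Category.id_comp]

@[simp] theorem δ_σ : δ (tot (σ (k := k) x n)) = 0 := by rw [δ_tot rfl, d_σ, tot_zero]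

@[simp] theorem δ_τ : δ (tot (τ (k := k) x n)) = 0 := by rw [δ_tot rfl, d_τ, tot_zero]

@[simp] theorem ε_σ : ε (tot (σ (k := k) x n)) = n.negOnePow • tot (σ x n) := by
  rw [ε_tot, Int.negOnePow_neg]

@[simp] theorem ε_τ : ε (tot (τ (k := k) x n)) = n.negOnePow • tot (τ x n) := ε_tot _

end tot

section totCone

variable {x y : D} (f : Z0 k x y)

@[simp] theorem δ_inl : δ (tot (inl f)) = tot f.1 ≫ tot (inr f) := by
  rw [δ_tot (neg_add_cancel 1), d_inl, tot_comp]

@[simp] theorem δ_inr : δ (tot (inr f)) = 0 := by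
  rw [δ_tot (zero_add 1), d_inr, tot_zero]

@[simp] theorem δ_fst : δ (tot (fst f)) = 0 := by
  rw [δ_tot (by norm_num : (1 : ℤ) + 1 = 2), d_fst, tot_zero]

@[simp] theorem δ_snd : δ (tot (snd f)) = -(tot (fst f) ≫ tot f.1) := by
  rw [δ_tot (zero_add 1), d_snd, tot_neg, tot_comp]

@[simp] theorem ε_inl : ε (tot (inl f)) = -tot (inl f) := ε_tot_neg_one _
@[simp] theorem ε_inr : ε (tot (inr f)) = tot (inr f) := ε_tot_zero _
@[simp] theorem ε_fst : ε (tot (fst f)) = -tot (fst f) := ε_tot_one _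
@[simp] theorem ε_snd : ε (tot (snd f)) = tot (snd f) := ε_tot_zero _

@[simp] theorem inl_fst : tot (inl f) ≫ tot (fst f) = 𝟙 _ := by
  rw [← tot_comp (add_neg_cancel 1), fst_inl, tot_one]

@[simp] theorem inl_fst_assoc {W : Tot k D} (h : (⟨x⟩ : Tot k D) ⟶ W) :
    tot (inl f) ≫ tot (fst f) ≫ h = h := by
  rw [← Category.assoc, inl_fst, Category.id_comp]

@[simp] theorem inr_fst : tot (inr f) ≫ tot (fst f) = 0 := by
  rw [← tot_comp (add_zero 1), fst_inr, tot_zero]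

@[simp] theorem inr_fst_assoc {W : Tot k D} (h : (⟨x⟩ : Tot k D) ⟶ W) :
    tot (inr f) ≫ tot (fst f) ≫ h = 0 := by
  rw [← Category.assoc, inr_fst, zero_comp]

@[simp] theorem inl_snd : tot (inl f) ≫ tot (snd f) = 0 := by
  rw [← tot_comp (zero_add (-1)), snd_inl, tot_zero]

@[simp] theorem inl_snd_assoc {W : Tot k D} (h : (⟨y⟩ : Tot k D) ⟶ W) :
    tot (inl f) ≫ tot (snd f) ≫ h = 0 := by
  rw [← Category.assoc, inl_snd, zero_comp]

@[simp] theorem inr_snd : tot (inr f) ≫ tot (snd f) = 𝟙 _ := by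
  rw [← tot_comp (zero_add 0), snd_inr, tot_one]

@[simp] theorem inr_snd_assoc {W : Tot k D} (h : (⟨y⟩ : Tot k D) ⟶ W) :
    tot (inr f) ≫ tot (snd f) ≫ h = h := by
  rw [← Category.assoc, inr_snd, Category.id_comp]

theorem tot_total : tot (snd f) ≫ tot (inr f) + tot (fst f) ≫ tot (inl f) = 𝟙 _ := by
  rw [← tot_comp (zero_add 0), ← tot_comp (neg_add_cancel 1), ← tot_add, total, tot_one]

theorem from_cone_ext {W : Tot k D} {a b : (⟨cone f⟩ : Tot k D) ⟶ W}
    (h₁ : tot (inl f) ≫ a = tot (inl f) ≫ b) (h₂ : tot (inr f) ≫ a = tot (inr f) ≫ b) :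
    a = b := by
  rw [← Category.id_comp a, ← Category.id_comp b, ← tot_total]
  simp only [Preadditive.add_comp, Category.assoc, h₁, h₂]

end totCone

section shift

/-- The action of the shift on morphisms. -/
def shMor (n : ℤ) (x y : D) : Hom k x y 0 →ₗ[k] Hom k (sh k x n) (sh k y n) 0 :=
  comp (neg_add_cancel n) (σ y n) ∘ₗ (comp (zero_add n)).flip (τ x n)

theorem tot_shMor {n : ℤ} {x y : D} (f : Hom k x y 0) :
    tot (shMor n x y f) = tot (τ x n) ≫ tot f ≫ tot (σ y n) := by
  simp [shMor]

/-- The action of the shift on closed morphisms. -/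
def shZ0 (n : ℤ) (x y : D) : Z0 k x y →ₗ[k] Z0 k (sh k x n) (sh k y n) :=
  (shMor n x y ∘ₗ (Z0 k x y).subtype).codRestrict _ fun f => by
    rw [LinearMap.mem_ker, closed_iff]
    simp [tot_shMor]

@[simp] theorem tot_shZ0 {n : ℤ} {x y : D} (f : Z0 k x y) :
    tot (shZ0 n x y f).1 = tot (τ x n) ≫ tot f.1 ≫ tot (σ y n) := tot_shMor f.1

theorem shZ0_mem {n : ℤ} {x y : D} (f : Z0 k x y) (hf : f ∈ B0 k x y) :
    shZ0 n x y f ∈ B0 k (sh k x n) (sh k y n) := by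
  have h : H0.homMk f = 0 := (Submodule.Quotient.mk_eq_zero _).2 hf
  obtain ⟨t, ht⟩ := H0.homMk_eq_zero_iff.1 h
  refine (Submodule.Quotient.mk_eq_zero _).1 (H0.homMk_eq_zero_iff.2
    ⟨n.negOnePow • comp (by omega : -n + (n - 1) = -1) (σ y n)
      (comp (by omega : -1 + n = n - 1) t (τ x n)), ?_⟩)
  simp [ht, smul_smul]

/-- The shift functor on the homotopy category. -/
def shFunctor (n : ℤ) : H0 k D ⥤ H0 k D where
  obj X := ⟨sh k X.obj n⟩
  map {X Y} f := (B0 k X.obj Y.obj).mapQ (B0 k (sh k X.obj n) (sh k Y.obj n))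
    (shZ0 n X.obj Y.obj) (fun f hf => shZ0_mem f hf) f
  map_id X := by
    refine H0.homMk_congr (f := shZ0 n X.obj X.obj (Z0one X.obj)) (g := Z0one _) ?_
    simp [Z0one]
  map_comp f g := by
    obtain ⟨f, rfl⟩ := H0.homMk_surjective f
    obtain ⟨g, rfl⟩ := H0.homMk_surjective g
    refine H0.homMk_congr (f := shZ0 n _ _ (Z0comp g f))
      (g := Z0comp (shZ0 n _ _ g) (shZ0 n _ _ f)) ?_
    simp

/-- The canonical isomorphism `x[m] ≅ x[n]` for `m = n`. -/
def shCongr (x : D) {m n : ℤ} (h : m = n) : Z0 k (sh k x m) (sh k x n) :=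
  Z0.mk (comp (by omega : -n + m = 0) (σ x n) (τ x m)) (by simp)

@[simp] theorem tot_shCongr (x : D) {m n : ℤ} (h : m = n) :
    tot (shCongr (k := k) x h).1 = tot (τ x m) ≫ tot (σ x n) := tot_comp _ _ _

theorem eqToHom_eq (X : H0 k D) {m n : ℤ} (h : m = n)
    (h' : (shFunctor m).obj X = (shFunctor n).obj X) :
    eqToHom h' = H0.homMk (shCongr X.obj h) := by
  subst h
  refine (eqToHom_refl _ _).trans (H0.homMk_congr (f := Z0one _) ?_)
  change 𝟙 _ = tot (shCongr (k := k) X.obj (rfl : m = m)).1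
  rw [tot_shCongr, tot_τ_σ]

/-- The isomorphism `x[m + n] → x[m][n]`, as a closed morphism. -/
def shAdd (x : D) (m n : ℤ) : Z0 k (sh k x (m + n)) (sh k (sh k x m) n) :=
  Z0.mk (comp (by omega : -n + n = 0) (σ (sh k x m) n)
    (comp (by omega : -m + (m + n) = n) (σ x m) (τ x (m + n)))) (by simp)

@[simp] theorem tot_shAdd (x : D) (m n : ℤ) :
    tot (shAdd (k := k) x m n).1 = tot (τ x (m + n)) ≫ tot (σ x m) ≫ tot (σ (sh k x m) n) := by
  simp [shAdd, Z0.mk]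

/-- The inverse of `shAdd`. -/
def shAddInv (x : D) (m n : ℤ) : Z0 k (sh k (sh k x m) n) (sh k x (m + n)) :=
  Z0.mk (comp (by omega : -(m + n) + (m + n) = 0) (σ x (m + n))
    (comp (by omega : m + n = m + n) (τ x m) (τ (sh k x m) n))) (by simp)

@[simp] theorem tot_shAddInv (x : D) (m n : ℤ) :
    tot (shAddInv (k := k) x m n).1 =
      tot (τ (sh k x m) n) ≫ tot (τ x m) ≫ tot (σ x (m + n)) := by
  simp [shAddInv, Z0.mk]

/-- The isomorphism `x[0] → x`, as a closed morphism. -/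
def shZero (x : D) : Z0 k (sh k x 0) x := Z0.mk (τ x 0) (by simp)

/-- The inverse of `shZero`. -/
def shZeroInv (x : D) : Z0 k x (sh k x 0) := Z0.mk (σ x 0) (by simp)

@[simp] theorem tot_shZero (x : D) : tot (shZero (k := k) x).1 = tot (τ x 0) := rfl

@[simp] theorem tot_shZeroInv (x : D) : tot (shZeroInv (k := k) x).1 = tot (σ (k := k) x 0) := rfl

/-- The isomorphism `x[m + n] ≅ x[m][n]` in the homotopy category. -/
def shAddIso (x : D) (m n : ℤ) : (⟨sh k x (m + n)⟩ : H0 k D) ≅ ⟨sh k (sh k x m) n⟩ :=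
  H0.isoMk' (shAdd x m n) (shAddInv x m n) (by simp) (by simp)

variable (k D) in
/-- The shift functors on `H⁰(D)` form an action of `ℤ`. -/
def shiftCore : ShiftMkCore (H0 k D) ℤ where
  F n := shFunctor n
  zero := NatIso.ofComponents
    (fun X => H0.isoMk' (shZero X.obj) (shZeroInv X.obj) (by simp) (by simp)) (fun {X Y} f => by
      obtain ⟨f, rfl⟩ := H0.homMk_surjective f
      refine H0.homMk_congr (f := Z0comp (shZero Y.obj) (shZ0 0 _ _ f))
        (g := Z0comp f (shZero X.obj)) ?_
      simp)
  add m n := NatIso.ofComponents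
    (fun X => shAddIso X.obj m n)
    (fun {X Y} f => by
      obtain ⟨f, rfl⟩ := H0.homMk_surjective f
      refine H0.homMk_congr (f := Z0comp (shAdd Y.obj m n) (shZ0 (m + n) _ _ f))
        (g := Z0comp (shZ0 n _ _ (shZ0 m _ _ f)) (shAdd X.obj m n)) ?_
      simp)
  assoc_hom_app a b c X := by
    rw [eqToHom_eq X (add_assoc a b c)]
    refine H0.homMk_congr (f := Z0comp (shZ0 c _ _ (shAdd X.obj a b)) (shAdd X.obj (a + b) c))
      (g := Z0comp (Z0comp (shAdd (sh k X.obj a) b c) (shAdd X.obj a (b + c)))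
        (shCongr X.obj (add_assoc a b c))) ?_
    simp
  zero_add_hom_app n X := by
    rw [eqToHom_eq X (zero_add n)]
    refine H0.homMk_congr (f := shAdd X.obj 0 n)
      (g := Z0comp (shZ0 n _ _ (shZeroInv X.obj)) (shCongr X.obj (zero_add n))) ?_
    simp
  add_zero_hom_app n X := by
    rw [eqToHom_eq X (add_zero n)]
    refine H0.homMk_congr (f := shAdd X.obj n 0)
      (g := Z0comp (shZeroInv (sh k X.obj n)) (shCongr X.obj (add_zero n))) ?_
    simp

noncomputable instance : HasShift (H0 k D) ℤ := hasShiftMk _ _ (shiftCore k D)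

instance (n : ℤ) : (shiftFunctor (H0 k D) n).Additive where
  map_add {X Y f g} := by
    obtain ⟨f, rfl⟩ := H0.homMk_surjective f
    obtain ⟨g, rfl⟩ := H0.homMk_surjective g
    refine H0.homMk_congr (f := shZ0 n _ _ (f + g)) (g := shZ0 n _ _ f + shZ0 n _ _ g) ?_
    rw [map_add]

theorem isZero_zero : IsZero (⟨zero k⟩ : H0 k D) :=
  H0.isZero_of_eq_δ _ 0 (by rw [tot_one_zero, tot_zero, map_zero])

instance : HasZeroObject (H0 k D) := ⟨_, isZero_zero⟩

end shift

end StrictPretr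

namespace StrictPretr

variable {k : Type u} [CommRing k] {D : Type v} [DGCategory k D] [StrictPretr k D]

/-! ### The triangulated structure on the homotopy category -/

section triangles

variable {x y z : D}

/-- `inr`, as a closed morphism. -/
def inrZ (f : Z0 k x y) : Z0 k y (cone f) := Z0.mk (inr f) (by simp)

@[simp] theorem tot_inrZ (f : Z0 k x y) : tot (inrZ f).1 = tot (inr f) := rfl

/-- The connecting morphism `cone f ⟶ x[1]`. -/
def connZ (f : Z0 k x y) : Z0 k (cone f) (sh k x 1) :=
  Z0.mk (comp (neg_add_cancel 1) (σ x 1) (fst f)) (by simp)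

@[simp] theorem tot_connZ (f : Z0 k x y) : tot (connZ f).1 = tot (fst f) ≫ tot (σ x 1) :=
  tot_comp _ _ _

/-- The standard triangle `x ⟶ y ⟶ cone f ⟶ x[1]`. -/
noncomputable def stdTriangle (f : Z0 k x y) : Triangle (H0 k D) :=
  Triangle.mk (X := ⟨x⟩) (Y := ⟨y⟩) (Z := ⟨cone f⟩) (H0.homMk f) (H0.homMk (inrZ f))
    (H0.homMk (connZ f))

variable (k D) in
/-- The triangles isomorphic to a standard triangle. -/
def distinguished : Set (Triangle (H0 k D)) :=
  fun T => ∃ (x y : D) (f : Z0 k x y), Nonempty (T ≅ stdTriangle f)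

theorem std_distinguished (f : Z0 k x y) : stdTriangle f ∈ distinguished k D :=
  ⟨x, y, f, ⟨Iso.refl _⟩⟩

theorem mem_of_iso_cone (f : Z0 k x y) {z : D} (v : (⟨y⟩ : H0 k D) ⟶ ⟨z⟩)
    (w : (⟨z⟩ : H0 k D) ⟶ (⟨x⟩ : H0 k D)⟦(1 : ℤ)⟧) (e : (⟨z⟩ : H0 k D) ≅ ⟨cone f⟩)
    (hv : H0.homMk (inrZ f) ≫ e.inv = v) (hw : e.hom ≫ H0.homMk (connZ f) = w) :
    Triangle.mk (X := ⟨x⟩) (H0.homMk f) v w ∈ distinguished k D := by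
  refine ⟨x, y, f, ⟨Triangle.isoMk _ _ (Iso.refl _) (Iso.refl _) e ?_ ?_ ?_⟩⟩
  · exact (Category.comp_id _).trans (Category.id_comp _).symm
  · exact ((Iso.comp_inv_eq e).1 hv).symm.trans (Category.id_comp _).symm
  · exact (congrArg (w ≫ ·) ((shiftFunctor (H0 k D) (1 : ℤ)).map_id _)).trans
      ((Category.comp_id w).trans hw.symm)

theorem triangle_ext {C : Type*} [Category* C] [HasShift C ℤ] {X Y Z : C} {f f' : X ⟶ Y}
    {g g' : Y ⟶ Z} {h h' : Z ⟶ X⟦(1 : ℤ)⟧} (hf : f = f') (hg : g = g') (hh : h = h') :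
    Triangle.mk f g h = Triangle.mk f' g' h' := by
  subst hf hg hh; rfl

theorem isZero_cone_one (x : D) : IsZero (⟨cone (Z0one x : Z0 k x x)⟩ : H0 k D) :=
  H0.isZero_of_eq_δ _ (comp (add_zero (-1)) (inl _) (snd _)) (by
    rw [tot_comp, ← tot_total]
    simp)

theorem contractible_distinguished (X : H0 k D) :
    contractibleTriangle X ∈ distinguished k D := by
  refine ⟨X.obj, X.obj, Z0one X.obj, ⟨Triangle.isoMk _ _ (Iso.refl _) (Iso.refl _)
    (IsZero.iso (Limits.isZero_zero _) (isZero_cone_one X.obj)) ?_ ?_ ?_⟩⟩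
  · exact (Category.comp_id _).trans (Category.id_comp _).symm
  · exact (isZero_cone_one X.obj).eq_of_tgt _ _
  · exact (Limits.isZero_zero _).eq_of_src _ _

/-- The cone of `y ⟶ cone f` is homotopy equivalent to `x[1]`. -/
def rotateIso (f : Z0 k x y) : (⟨sh k x 1⟩ : H0 k D) ≅ ⟨cone (inrZ f)⟩ :=
  H0.isoMk
    (Z0.mk (comp (zero_add 0) (inr (inrZ f)) (comp (neg_add_cancel 1) (inl f) (τ x 1)) -
      comp (neg_add_cancel 1) (inl (inrZ f)) (comp (zero_add 1) f.1 (τ x 1))) (by simp))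
    (Z0.mk (comp (neg_add_cancel 1) (σ x 1) (comp (add_zero 1) (fst f) (snd (inrZ f))))
      (by simp))
    0 (-comp (add_zero (-1)) (inl (inrZ f)) (comp (zero_add 0) (snd f) (snd (inrZ f))))
    (by simp [Z0.mk])
    (by
      apply from_cone_ext
      · simp [Z0.mk]
      · apply from_cone_ext <;> simp [Z0.mk])

theorem rotate_std (f : Z0 k x y) : (stdTriangle f).rotate ∈ distinguished k D := by
  refine mem_of_iso_cone (inrZ f) _ _ (rotateIso f) ?_ ?_
  · refine H0.homMk_congr (f := Z0comp (Z0.mk _ _) (inrZ (inrZ f))) (g := connZ f) ?_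
    simp [Z0.mk]
  · refine H0.homMk_congr (f := Z0comp (connZ (inrZ f)) (Z0.mk _ _)) (g := -shZ0 1 x y f) ?_
    simp [Z0.mk]

/-! The inverse rotation of a standard triangle. -/

theorem shiftFunctorAdd'_hom_app (X : H0 k D) (i j n : ℤ) (h : i + j = n) :
    (shiftFunctorAdd' (H0 k D) i j n h).hom.app X =
      H0.homMk (Z0comp (shAdd X.obj i j) (shCongr X.obj h.symm)) := by
  subst h
  rw [shiftFunctorAdd'_eq_shiftFunctorAdd]
  refine (congrArg (fun e : shiftFunctor (H0 k D) (i + j) ≅ _ => e.hom.app X)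
    (ShiftMkCore.shiftFunctorAdd_eq (shiftCore k D) i j)).trans ?_
  refine H0.homMk_congr (f := shAdd X.obj i j) ?_
  simp

/-- The isomorphism `x[i][j] → x` for `i + j = 0`, as a closed morphism. -/
def shCancel (x : D) {i j : ℤ} (h : i + j = 0) : Z0 k (sh k (sh k x i) j) x :=
  Z0.mk (comp h (τ x i) (τ (sh k x i) j)) (by simp)

@[simp] theorem tot_shCancel (x : D) {i j : ℤ} (h : i + j = 0) :
    tot (shCancel (k := k) x h).1 = tot (τ (sh k x i) j) ≫ tot (τ x i) := tot_comp _ _ _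

/-- The inverse of `shCancel`. -/
def shCancelInv (x : D) {i j : ℤ} (h : i + j = 0) : Z0 k x (sh k (sh k x i) j) :=
  Z0.mk (comp (by omega : -j + -i = 0) (σ (sh k x i) j) (σ x i)) (by simp)

@[simp] theorem tot_shCancelInv (x : D) {i j : ℤ} (h : i + j = 0) :
    tot (shCancelInv (k := k) x h).1 = tot (σ x i) ≫ tot (σ (sh k x i) j) := tot_comp _ _ _

theorem shiftFunctorCompIsoId_inv_app (X : H0 k D) (i j : ℤ) (h : i + j = 0) :
    (shiftFunctorCompIsoId (H0 k D) i j h).inv.app X = H0.homMk (shCancelInv X.obj h) := by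
  simp only [shiftFunctorCompIsoId, Iso.trans_inv, Iso.symm_inv, NatTrans.comp_app]
  rw [shiftFunctorAdd'_hom_app]
  refine (congrArg (fun e : shiftFunctor (H0 k D) (0 : ℤ) ≅ _ => e.inv.app X ≫ _)
    (ShiftMkCore.shiftFunctorZero_eq (shiftCore k D))).trans ?_
  refine H0.homMk_congr (f := Z0comp (Z0comp (shAdd X.obj i j) (shCongr X.obj h.symm))
    (shZeroInv X.obj)) ?_
  simp

theorem shiftFunctorCompIsoId_hom_app (X : H0 k D) (i j : ℤ) (h : i + j = 0) :
    (shiftFunctorCompIsoId (H0 k D) i j h).hom.app X = H0.homMk (shCancel X.obj h) := by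
  refine (cancel_epi ((shiftFunctorCompIsoId (H0 k D) i j h).inv.app X)).1
    ((Iso.inv_hom_id_app _ X).trans (Eq.trans ?_
      (congrArg (· ≫ _) (shiftFunctorCompIsoId_inv_app X i j h)).symm))
  refine H0.homMk_congr (f := Z0one X.obj)
    (g := Z0comp (shCancel X.obj h) (shCancelInv X.obj h)) ?_
  simp

theorem fst_inl_comp (f : Z0 k x y) {W : Tot k D} (h : (⟨cone f⟩ : Tot k D) ⟶ W) :
    tot (fst f) ≫ tot (inl f) ≫ h = h - tot (snd f) ≫ tot (inr f) ≫ h := by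
  rw [eq_sub_iff_add_eq', ← Category.assoc, ← Category.assoc, ← Preadditive.add_comp,
    tot_total, Category.id_comp]

/-- The first morphism of the inverse rotation of the standard triangle of `f`. -/
def invRotZ (f : Z0 k x y) : Z0 k (sh k (cone f) (-1)) x :=
  Z0.mk (-comp (add_neg_cancel 1) (fst f) (τ (cone f) (-1))) (by simp)

@[simp] theorem tot_invRotZ (f : Z0 k x y) :
    tot (invRotZ f).1 = -(tot (τ (cone f) (-1)) ≫ tot (fst f)) := by
  simp [invRotZ, Z0.mk]

/-- The cone of `(cone f)[-1] ⟶ x` is homotopy equivalent to `y`. -/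
def invRotateIso (f : Z0 k x y) : (⟨y⟩ : H0 k D) ≅ ⟨cone (invRotZ f)⟩ :=
  H0.isoMk
    (Z0.mk (comp (neg_add_cancel 1) (inl (invRotZ f))
      (comp (add_zero 1) (σ (cone f) (-1)) (inr f))) (by simp))
    (Z0.mk (comp (zero_add 0) f.1 (snd (invRotZ f)) +
      comp (zero_add 0) (snd f) (comp (neg_add_cancel 1) (τ (cone f) (-1)) (fst (invRotZ f))))
      (by simp))
    0 (comp (add_zero (-1)) (inl (invRotZ f)) (comp (add_neg_cancel 1) (σ (cone f) (-1))
        (comp (add_zero (-1)) (inl f) (snd (invRotZ f)))))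
    (by simp [Z0.mk])
    (by
      apply from_cone_ext
      · simp [Z0.mk, fst_inl_comp]
      · simp [Z0.mk, sub_eq_neg_add])

theorem invRotate_std (f : Z0 k x y) : (stdTriangle f).invRotate ∈ distinguished k D := by
  have e : (stdTriangle f).invRotate = Triangle.mk (X := ⟨sh k (cone f) (-1)⟩) (Y := ⟨x⟩)
      (Z := ⟨y⟩) (H0.homMk (invRotZ f)) (H0.homMk f)
      (H0.homMk (Z0comp (shCancelInv (cone f) (neg_add_cancel 1)) (inrZ f))) := by
    refine triangle_ext ?_ rfl ?_
    · refine (congrArg (fun t => -((shiftFunctor (H0 k D) (-1 : ℤ)).map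
        (H0.homMk (connZ f)) ≫ t))
        (shiftFunctorCompIsoId_hom_app (⟨x⟩ : H0 k D) 1 (-1) (add_neg_cancel 1))).trans ?_
      refine H0.homMk_congr (f := -Z0comp (shCancel x (add_neg_cancel 1)) (shZ0 (-1) _ _ (connZ f)))
        (g := invRotZ f) ?_
      simp
    · exact congrArg (H0.homMk (inrZ f) ≫ ·)
        (shiftFunctorCompIsoId_inv_app (⟨cone f⟩ : H0 k D) (-1) 1 (neg_add_cancel 1))
  rw [e]
  refine mem_of_iso_cone (invRotZ f) _ _ (invRotateIso f) ?_ ?_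
  · refine H0.homMk_congr (f := Z0comp (Z0.mk _ _) (inrZ (invRotZ f))) (g := f) ?_
    simp [Z0.mk]
  · refine H0.homMk_congr (f := Z0comp (connZ (invRotZ f)) (Z0.mk _ _))
      (g := Z0comp (shCancelInv (cone f) (neg_add_cancel 1)) (inrZ f)) ?_
    simp [Z0.mk]

theorem distinguished_of_iso {T₁ T₂ : Triangle (H0 k D)} (e : T₂ ≅ T₁)
    (h : T₁ ∈ distinguished k D) : T₂ ∈ distinguished k D := by
  obtain ⟨x, y, f, ⟨e'⟩⟩ := h
  exact ⟨x, y, f, ⟨e ≪≫ e'⟩⟩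

theorem rotate_distinguished_iff (T : Triangle (H0 k D)) :
    T ∈ distinguished k D ↔ T.rotate ∈ distinguished k D := by
  constructor
  · rintro ⟨x, y, f, ⟨e⟩⟩
    exact distinguished_of_iso ((rotate _).mapIso e) (rotate_std f)
  · rintro ⟨x, y, f, ⟨e⟩⟩
    exact distinguished_of_iso ((triangleRotation _).unitIso.app T ≪≫ (invRotate _).mapIso e)
      (invRotate_std f)

theorem complete_std {x' y' : D} (f : Z0 k x y) (f' : Z0 k x' y')
    (a : (⟨x⟩ : H0 k D) ⟶ ⟨x'⟩) (b : (⟨y⟩ : H0 k D) ⟶ ⟨y'⟩)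
    (h : H0.homMk f ≫ b = a ≫ H0.homMk f') :
    ∃ φ : stdTriangle f ⟶ stdTriangle f', φ.hom₁ = a ∧ φ.hom₂ = b := by
  obtain ⟨a, rfl⟩ := H0.homMk_surjective a
  obtain ⟨b, rfl⟩ := H0.homMk_surjective b
  obtain ⟨t, ht⟩ := H0.homMk_eq_iff.1 (h : H0.homMk (Z0comp b f) = H0.homMk (Z0comp f' a))
  simp only [tot_Z0comp] at ht
  let c : Z0 k (cone f) (cone f') := Z0.mk
    (comp (zero_add 0) (inr f') (comp (zero_add 0) b.1 (snd f)) +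
      comp (neg_add_cancel 1) (inl f') (comp (zero_add 1) a.1 (fst f)) +
      comp (zero_add 0) (inr f') (comp (neg_add_cancel 1) t (fst f))) (by
        simp [← ht])
  have hc : tot c.1 = tot (snd f) ≫ tot b.1 ≫ tot (inr f') + tot (fst f) ≫ tot a.1 ≫ tot (inl f') +
      tot (fst f) ≫ tot t ≫ tot (inr f') := by simp [c, Z0.mk]
  refine ⟨Triangle.homMk _ _ (H0.homMk a) (H0.homMk b) (H0.homMk c) h ?_ ?_, rfl, rfl⟩
  · refine H0.homMk_congr (f := Z0comp c (inrZ f)) (g := Z0comp (inrZ f') b) ?_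
    simp [hc]
  · refine H0.homMk_congr (f := Z0comp (shZ0 1 _ _ a) (connZ f)) (g := Z0comp (connZ f') c) ?_
    simp [hc]

theorem conj_cancel {C : Type*} [Category* C] {X X' Y Y' : C} (a : X ⟶ Y) {p : X ⟶ X'}
    {p' : X' ⟶ X} {q : Y ⟶ Y'} {q' : Y' ⟶ Y} (hp : p ≫ p' = 𝟙 X) (hq : q ≫ q' = 𝟙 Y) :
    p ≫ (p' ≫ a ≫ q) ≫ q' = a := by
  simp only [Category.assoc, hq, Category.comp_id]
  rw [← Category.assoc, hp, Category.id_comp]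

theorem complete_distinguished (T₁ T₂ : Triangle (H0 k D)) (hT₁ : T₁ ∈ distinguished k D)
    (hT₂ : T₂ ∈ distinguished k D) (a : T₁.obj₁ ⟶ T₂.obj₁) (b : T₁.obj₂ ⟶ T₂.obj₂)
    (fac : T₁.mor₁ ≫ b = a ≫ T₂.mor₁) :
    ∃ c, T₁.mor₂ ≫ c = b ≫ T₂.mor₂ ∧ T₁.mor₃ ≫ a⟦1⟧' = c ≫ T₂.mor₃ := by
  obtain ⟨x, y, f, ⟨e₁⟩⟩ := hT₁
  obtain ⟨x', y', f', ⟨e₂⟩⟩ := hT₂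
  obtain ⟨φ, h₁, h₂⟩ := complete_std f f' (e₁.inv.hom₁ ≫ a ≫ e₂.hom.hom₁)
    (e₁.inv.hom₂ ≫ b ≫ e₂.hom.hom₂) (by
      have h₁ : (stdTriangle f).mor₁ ≫ e₁.inv.hom₂ = e₁.inv.hom₁ ≫ T₁.mor₁ := e₁.inv.comm₁
      have h₂ : T₂.mor₁ ≫ e₂.hom.hom₂ = e₂.hom.hom₁ ≫ (stdTriangle f').mor₁ := e₂.hom.comm₁
      change (stdTriangle f).mor₁ ≫ e₁.inv.hom₂ ≫ b ≫ e₂.hom.hom₂ =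
        (e₁.inv.hom₁ ≫ a ≫ e₂.hom.hom₁) ≫ (stdTriangle f').mor₁
      simp only [Category.assoc, ← h₂]
      rw [← Category.assoc, h₁, Category.assoc, ← Category.assoc T₁.mor₁, fac, Category.assoc])
  have e : (e₁.hom ≫ φ ≫ e₂.inv).hom₁ = a := by
    exact (congrArg (fun t => e₁.hom.hom₁ ≫ t ≫ e₂.inv.hom₁) h₁).trans
      (conj_cancel _ (Iso.hom_inv_id_triangle_hom₁ e₁) (Iso.hom_inv_id_triangle_hom₁ e₂))
  have e' : (e₁.hom ≫ φ ≫ e₂.inv).hom₂ = b := by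
    exact (congrArg (fun t => e₁.hom.hom₂ ≫ t ≫ e₂.inv.hom₂) h₂).trans
      (conj_cancel _ (Iso.hom_inv_id_triangle_hom₂ e₁) (Iso.hom_inv_id_triangle_hom₂ e₂))
  exact ⟨(e₁.hom ≫ φ ≫ e₂.inv).hom₃, by rw [(e₁.hom ≫ φ ≫ e₂.inv).comm₂, e'],
    by rw [← (e₁.hom ≫ φ ≫ e₂.inv).comm₃, e]⟩

noncomputable instance : Pretriangulated (H0 k D) where
  distinguishedTriangles := distinguished k D
  isomorphic_distinguished _ h _ e := distinguished_of_iso e h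
  contractible_distinguished := contractible_distinguished
  distinguished_cocone_triangle {X Y} f := by
    obtain ⟨f, rfl⟩ := H0.homMk_surjective f
    exact ⟨_, _, _, std_distinguished f⟩
  rotate_distinguished_triangle := rotate_distinguished_iff
  complete_distinguished_triangle_morphism := complete_distinguished

theorem std_mem (f : Z0 k x y) : stdTriangle f ∈ distTriang (H0 k D) := std_distinguished f

theorem mem_distTriang_iff (T : Triangle (H0 k D)) :
    T ∈ distTriang (H0 k D) ↔ ∃ (x y : D) (f : Z0 k x y), Nonempty (T ≅ stdTriangle f) := Iff.rfl

end triangles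

section octahedron

variable {x y z : D} (f : Z0 k x y) (g : Z0 k y z)

/-- The morphism `cone f ⟶ cone (g ∘ f)` induced by `g`. -/
def coneMapRight : Z0 k (cone f) (cone (Z0comp g f)) :=
  Z0.mk (comp (zero_add 0) (inr _) (comp (zero_add 0) g.1 (snd f)) +
    comp (neg_add_cancel 1) (inl _) (fst f)) (by simp)

@[simp] theorem tot_coneMapRight : tot (coneMapRight f g).1 =
    tot (snd f) ≫ tot g.1 ≫ tot (inr _) + tot (fst f) ≫ tot (inl _) := by
  simp [coneMapRight, Z0.mk]

/-- The morphism `cone (g ∘ f) ⟶ cone g` induced by `f`. -/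
def coneMapLeft : Z0 k (cone (Z0comp g f)) (cone g) :=
  Z0.mk (comp (zero_add 0) (inr _) (snd _) +
    comp (neg_add_cancel 1) (inl _) (comp (zero_add 1) f.1 (fst _))) (by simp)

@[simp] theorem tot_coneMapLeft : tot (coneMapLeft f g).1 =
    tot (snd _) ≫ tot (inr _) + tot (fst _) ≫ tot f.1 ≫ tot (inl _) := by
  simp [coneMapLeft, Z0.mk]

/-- The cone of `cone f ⟶ cone (g ∘ f)` is homotopy equivalent to `cone g`. -/
def octahedronIso : (⟨cone g⟩ : H0 k D) ≅ ⟨cone (coneMapRight f g)⟩ :=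
  H0.isoMk
    (Z0.mk (comp (zero_add 0) (inr _) (comp (zero_add 0) (inr (Z0comp g f)) (snd g)) +
      comp (neg_add_cancel 1) (inl _) (comp (zero_add 1) (inr f) (fst g))) (by simp))
    (Z0.mk (comp (zero_add 0) (coneMapLeft f g).1 (snd _) +
      comp (neg_add_cancel 1) (inl g) (comp (zero_add 1) (snd f) (fst _))) (by simp; abel))
    0
    (-comp (add_zero (-1)) (inl (coneMapRight f g)) (comp (neg_add_cancel 1)
      (inl f) (comp (add_zero 1) (fst (Z0comp g f)) (snd (coneMapRight f g)))))
    (by simp [Z0.mk, tot_total])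
    (by
      apply from_cone_ext <;> apply from_cone_ext <;> simp [Z0.mk, sub_eq_add_neg])

theorem octahedron_std : Nonempty (Triangulated.Octahedron rfl (std_mem f) (std_mem g)
    (std_mem (Z0comp g f))) := by
  refine ⟨⟨H0.homMk (coneMapRight f g), H0.homMk (coneMapLeft f g), ?_, ?_, ?_, ?_, ?_⟩⟩
  · refine H0.homMk_congr (f := Z0comp (coneMapRight f g) (inrZ f))
      (g := Z0comp (inrZ (Z0comp g f)) g) ?_
    simp
  · refine H0.homMk_congr (f := Z0comp (connZ (Z0comp g f)) (coneMapRight f g))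
      (g := connZ f) ?_
    simp
  · refine H0.homMk_congr (f := Z0comp (coneMapLeft f g) (inrZ (Z0comp g f)))
      (g := inrZ g) ?_
    simp
  · refine H0.homMk_congr (f := Z0comp (shZ0 1 _ _ f) (connZ (Z0comp g f)))
      (g := Z0comp (connZ g) (coneMapLeft f g)) ?_
    simp
  · refine mem_of_iso_cone (coneMapRight f g) _ _ (octahedronIso f g) ?_ ?_
    · refine H0.homMk_congr (f := Z0comp (Z0.mk _ _) (inrZ (coneMapRight f g)))
        (g := coneMapLeft f g) ?_
      simp [Z0.mk]
    · refine H0.homMk_congr (f := Z0comp (connZ (coneMapRight f g)) (Z0.mk _ _))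
        (g := Z0comp (shZ0 1 _ _ (inrZ f)) (connZ g)) ?_
      simp [Z0.mk]

instance : IsTriangulated (H0 k D) := by
  refine IsTriangulated.mk' fun X Y Z u v => ?_
  obtain ⟨f, rfl⟩ := H0.homMk_surjective u
  obtain ⟨g, rfl⟩ := H0.homMk_surjective v
  exact ⟨X, Y, Z, _, _, _, H0.homMk f, H0.homMk g, Iso.refl _, Iso.refl _, Iso.refl _,
    (Category.comp_id _).trans (Category.id_comp _).symm,
    (Category.comp_id _).trans (Category.id_comp _).symm, _, _, std_mem f, _, _, std_mem g, _, _,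
    std_mem (Z0comp g f), octahedron_std f g⟩

end octahedron

end StrictPretr

/-! ### Shifts and cones of dg modules -/

namespace DGMod

variable {k : Type u} [CommRing k] {A : Type u} [DGCategory k A]

/-- Transport between components of equal degrees. -/
def castL (M : DGMod k A) (x : A) {p q : ℤ} (h : p = q) : M.X x p →ₗ[k] M.X x q :=
  h ▸ LinearMap.id

/-- The closed isomorphism `M → M[n]` of degree `-n`, the identity on components. -/
def toShift (M : DGMod k A) (n : ℤ) : Mor M (M.shift n) (-n) :=
  Mor.mk (fun x p q h => (M.castL x (by omega : p = q + n) : M.X x p →ₗ[k] M.X x (q + n))) (by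
    intro x y p q r p' r' h hp hr h' m a
    obtain rfl : p = p' + n := by omega
    obtain rfl : r = r' + n := by omega
    rfl)

/-- The inverse of `toShift`. -/
def ofShift (M : DGMod k A) (n : ℤ) : Mor (M.shift n) M n :=
  Mor.mk (fun x p q h => (M.castL x h : M.X x (p + n) →ₗ[k] M.X x q)) (by
    intro x y p q r p' r' h hp hr h' m a
    subst hp hr
    rfl)

variable {M N : DGMod k A} (f : Z0 k M N)

/-- The inclusion of `M` into the cone of `f : M ⟶ N`. -/
def coneInl : Mor M (cone f) (-1) :=
  Mor.mk (fun x p q h => LinearMap.inr k (N.X x q) (M.X x (q + 1)) ∘ₗ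
    M.castL x (by omega : p = q + 1)) (by
    intro x y p q r p' r' h hp hr h' m a
    obtain rfl : p = p' + 1 := by omega
    obtain rfl : r = r' + 1 := by omega
    exact Prod.ext (LinearMap.map_zero₂ (N.act h') a).symm rfl)

/-- The projection of the cone of `f : M ⟶ N` to `M`. -/
def coneFst' : Mor (cone f) M 1 :=
  Mor.mk (fun x p q h => M.castL x h ∘ₗ LinearMap.snd k (N.X x p) (M.X x (p + 1))) (by
    intro x y p q r p' r' h hp hr h' m a
    subst hp hr
    rfl)

/-- The projection of the cone of `f : M ⟶ N` to `N`. -/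
def coneSnd : Mor (cone f) N 0 :=
  Mor.mk (fun x p q h => N.castL x (by omega) ∘ₗ LinearMap.fst k (N.X x p) (M.X x (p + 1))) (by
    intro x y p q r p' r' h hp hr h' m a
    obtain rfl : p = p' := by omega
    obtain rfl : r = r' := by omega
    rfl)

noncomputable instance : StrictPretr k (DGMod k A) where
  zero := DGMod.zero k A
  one_zero := Mor.ext fun _ _ _ _ _ => rfl
  sh M n := M.shift n
  σ := toShift
  τ := ofShift
  d_σ M n := by
    refine Mor.ext fun x p q h m => ?_
    obtain rfl : p = q - 1 + n := by omega
    refine (dMor_app rfl _ x h (by omega : q - 1 + n + -n = q - 1) (by omega)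
      (by omega : q - 1 + n + 1 = q + n) (by omega) m).trans ?_
    change n.negOnePow • M.d (q - 1 + n) (q + n) _ m - (-n).negOnePow • M.d (q - 1 + n) (q + n) _ m
      = 0
    rw [Int.negOnePow_neg, sub_self]
  d_τ M n := by
    refine Mor.ext fun x p q h m => ?_
    obtain rfl : q = p + 1 + n := by omega
    refine (dMor_app rfl _ x h rfl (by omega) rfl (by omega) m).trans ?_
    change M.d (p + n) (p + 1 + n) _ m - n.negOnePow • n.negOnePow • M.d (p + n) (p + 1 + n) _ m
      = 0
    rw [smul_smul, Int.units_mul_self, one_smul, sub_self]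
  τ_σ M n := by
    refine Mor.ext fun x p q h m => ?_
    obtain rfl : p = q := by omega
    obtain ⟨r, rfl⟩ : ∃ r, p = r + n := ⟨p - n, by omega⟩
    exact compMor_app (add_neg_cancel n) _ _ x h (by omega : r + n + -n = r) rfl m
  σ_τ M n := by
    refine Mor.ext fun x p q h m => ?_
    obtain rfl : p = q := by omega
    exact compMor_app (neg_add_cancel n) _ _ x h rfl (by omega) m
  cone := DGMod.cone
  inl := coneInl
  inr f := (coneInr f).1
  fst := coneFst'
  snd := coneSnd
  d_inl {M N} f := by
    refine Mor.ext fun x p q h m => ?_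
    obtain rfl : p = q := by omega
    obtain ⟨r, rfl⟩ : ∃ r, p = r + 1 := ⟨p - 1, by omega⟩
    refine (dMor_app _ _ x h (by omega : r + 1 + -1 = r) rfl rfl (by omega) m).trans
      (Eq.trans ?_ (compMor_app (zero_add 0) _ _ x h (by omega : r + 1 + 0 = r + 1)
        (by omega) m).symm)
    refine Prod.ext ?_ ?_
    · change N.d r (r + 1) rfl 0 + Mor.app f.1 x (r + 1) (r + 1) (by omega) m -
        Int.negOnePow (-1) • 0 = Mor.app f.1 x (r + 1) (r + 1) (by omega) m
      rw [map_zero, zero_add, smul_zero, sub_zero]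
    · change -(M.d (r + 1) (r + 1 + 1) rfl m) -
        Int.negOnePow (-1) • M.d (r + 1) (r + 1 + 1) rfl m = 0
      rw [Int.negOnePow_neg, Int.negOnePow_one, Units.neg_smul, one_smul, sub_neg_eq_add,
        neg_add_cancel]
  d_inr f := (coneInr f).2
  d_fst {M N} f := by
    refine Mor.ext fun x p q h m => ?_
    obtain rfl : q = p + 1 + 1 := by omega
    refine (dMor_app _ _ x h rfl rfl rfl rfl m).trans ?_
    change M.d (p + 1) (p + 1 + 1) rfl m.2 -
      Int.negOnePow 1 • -(M.d (p + 1) (p + 1 + 1) rfl m.2) = 0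
    rw [Int.negOnePow_one, Units.neg_smul, one_smul, neg_neg, sub_self]
  d_snd {M N} f := by
    refine Mor.ext fun x p q h m => ?_
    subst h
    refine (dMor_app _ _ x rfl (add_zero p) rfl rfl (add_zero _) m).trans
      (Eq.trans ?_ (congrArg Neg.neg (compMor_app (zero_add 1) _ _ x rfl rfl
        (add_zero (p + 1)) m)).symm)
    change N.d p (p + 1) rfl m.1 - Int.negOnePow 0 • (N.d p (p + 1) rfl m.1 +
      Mor.app f.1 x (p + 1) (p + 1) (by omega) m.2) =
      -Mor.app f.1 x (p + 1) (p + 1) (by omega) m.2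
    rw [Int.negOnePow_zero, one_smul]
    abel
  fst_inl {M N} f := by
    refine Mor.ext fun x p q h m => ?_
    obtain rfl : p = q := by omega
    obtain ⟨r, rfl⟩ : ∃ r, p = r + 1 := ⟨p - 1, by omega⟩
    exact compMor_app (add_neg_cancel 1) _ _ x h (by omega : r + 1 + -1 = r) rfl m
  fst_inr {M N} f := by
    refine Mor.ext fun x p q h m => ?_
    subst h
    exact compMor_app _ _ _ x rfl (add_zero p) rfl m
  snd_inl {M N} f := by
    refine Mor.ext fun x p q h m => ?_
    subst h
    exact compMor_app (zero_add (-1)) _ _ x rfl rfl (add_zero _) m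
  snd_inr {M N} f := by
    refine Mor.ext fun x p q h m => ?_
    obtain rfl : p = q := by omega
    exact compMor_app _ _ _ x h h h m
  total {M N} f := by
    refine Mor.ext fun x p q h m => ?_
    obtain rfl : p = q := by omega
    refine (congrArg₂ (· + ·)
      (compMor_app (zero_add 0) (coneInr f).1 (coneSnd f) x h h h m)
      (compMor_app (neg_add_cancel 1) (coneInl f) (coneFst' f) x h rfl
        (by omega : p + 1 + -1 = p) m)).trans ?_
    exact Prod.ext (add_zero m.1) (zero_add m.2)

end DGMod

/-! ### Transport of triangulated structures -/

namespace CategoryTheory.Functor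

section commShift

variable {C D : Type*} [Category* C] [Category* D] {F : C ⥤ D} [HasShift C ℤ] [HasShift D ℤ]

open Functor.CommShift

/-- For a functor `F`, the pairs of an integer `n` and an isomorphism between `F ∘ [n]` and
`[n] ∘ F`.  They form a group under pasting, in which a compatible family of such isomorphisms is a
homomorphism from `ℤ`; so the family is determined by its value at `1`, which is arbitrary. -/
def ShiftIsos (F : C ⥤ D) : Type _ := Σ n : ℤ, (shiftFunctor C n ⋙ F ≅ F ⋙ shiftFunctor D n)

theorem ShiftIsos.mk_isoAdd' {a b c : ℤ} (h : a + b = c)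
    (e₁ : shiftFunctor C a ⋙ F ≅ F ⋙ shiftFunctor D a)
    (e₂ : shiftFunctor C b ⋙ F ≅ F ⋙ shiftFunctor D b) :
    (⟨c, isoAdd' h e₁ e₂⟩ : ShiftIsos F) = ⟨a + b, isoAdd e₁ e₂⟩ := by
  subst h; rfl

noncomputable instance : Monoid (ShiftIsos F) where
  mul x y := ⟨x.1 + y.1, isoAdd x.2 y.2⟩
  one := ⟨0, isoZero F ℤ⟩
  mul_one x := (ShiftIsos.mk_isoAdd' (add_zero x.1) x.2 _).symm.trans
    (congrArg (fun e => (⟨x.1, e⟩ : ShiftIsos F)) (isoAdd'_isoZero x.2))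
  one_mul x := (ShiftIsos.mk_isoAdd' (zero_add x.1) _ x.2).symm.trans
    (congrArg (fun e => (⟨x.1, e⟩ : ShiftIsos F)) (isoZero_isoAdd'_ x.2))
  mul_assoc x y z :=
    (congrArg (fun e => (⟨x.1 + y.1 + z.1, e⟩ : ShiftIsos F))
      (isoAdd'_assoc x.2 y.2 z.2 rfl rfl rfl)).trans
      (ShiftIsos.mk_isoAdd' (by omega) x.2 (isoAdd y.2 z.2))

/-- The underlying integer, as a homomorphism of monoids. -/
def ShiftIsos.deg : ShiftIsos F →* Multiplicative ℤ where
  toFun x := Multiplicative.ofAdd x.1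
  map_one' := rfl
  map_mul' _ _ := rfl

theorem ShiftIsos.exists_mul_eq_one (x : ShiftIsos F) : ∃ y : ShiftIsos F, x * y = 1 := by
  obtain ⟨a, e⟩ := x
  have h : a + -a = 0 := add_neg_cancel a
  -- Precomposition with the equivalence `[a]` is fully faithful, so an isomorphism between
  -- `F ∘ [-a]` and `[-a] ∘ F` is the same as one after precomposition with `[a]`, where it is
  -- dictated by `e`.
  let W := (whiskeringLeft C C D).obj (shiftFunctor C a)
  let θ := (isoWhiskerRight (shiftFunctorAdd' C a (-a) 0 h) F ≪≫ Functor.associator _ _ _).symm ≪≫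
    isoZero F ℤ ≪≫ ((Functor.associator _ _ _).symm ≪≫ isoWhiskerRight e _ ≪≫
      Functor.associator _ _ _ ≪≫ isoWhiskerLeft _ (shiftFunctorAdd' D a (-a) 0 h).symm).symm
  have hθ : isoWhiskerLeft _ (W.preimageIso θ) = θ := by
    ext1; exact W.map_preimage θ.hom
  refine ⟨⟨-a, W.preimageIso θ⟩, (ShiftIsos.mk_isoAdd' h e _).symm.trans
    (congrArg (fun e => (⟨0, e⟩ : ShiftIsos F)) ?_)⟩
  unfold isoAdd'
  rw [hθ]
  ext X
  simp [θ]

theorem ShiftIsos.isUnit (x : ShiftIsos F) : IsUnit x := by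
  obtain ⟨y, hy⟩ := x.exists_mul_eq_one
  obtain ⟨z, hz⟩ := y.exists_mul_eq_one
  have : x = z := by rw [← mul_one x, ← hz, ← mul_assoc, hy, one_mul]
  exact ⟨⟨x, y, hy, by rw [this, hz]⟩, rfl⟩

/-- The powers of an isomorphism between `F ∘ [1]` and `[1] ∘ F`. -/
noncomputable def ShiftIsos.pow (e : shiftFunctor C (1 : ℤ) ⋙ F ≅ F ⋙ shiftFunctor D (1 : ℤ))
    (n : ℤ) : ShiftIsos F :=
  ((ShiftIsos.isUnit (⟨1, e⟩ : ShiftIsos F)).unit ^ n : (ShiftIsos F)ˣ)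

theorem ShiftIsos.pow_fst (e : shiftFunctor C (1 : ℤ) ⋙ F ≅ F ⋙ shiftFunctor D (1 : ℤ))
    (n : ℤ) : (ShiftIsos.pow e n).1 = n := by
  have h := map_zpow (Units.map (ShiftIsos.deg (F := F)))
    ((ShiftIsos.isUnit (⟨1, e⟩ : ShiftIsos F)).unit) n
  have h' := congrArg Units.val h
  have h₁ : ((Units.map (ShiftIsos.deg (F := F)) (ShiftIsos.isUnit (⟨1, e⟩ : ShiftIsos F)).unit :
      (Multiplicative ℤ)ˣ) : Multiplicative ℤ) = Multiplicative.ofAdd (1 : ℤ) := rfl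
  rw [Units.val_zpow_eq_zpow_val, h₁] at h'
  exact Multiplicative.ofAdd.injective (h'.trans (by rw [← ofAdd_zsmul, smul_eq_mul, mul_one]))

theorem ShiftIsos.eq_mk {x : ShiftIsos F} {n : ℤ} (h : x.1 = n) :
    ∃ e, x = (⟨n, e⟩ : ShiftIsos F) := by
  subst h; exact ⟨x.2, rfl⟩

/-- A functor commutes with the shifts by all integers as soon as it commutes with the shift
by `1`. -/
theorem exists_commShift_of_iso
    (e : shiftFunctor C (1 : ℤ) ⋙ F ≅ F ⋙ shiftFunctor D (1 : ℤ)) :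
    ∃ c : F.CommShift ℤ, c.commShiftIso (1 : ℤ) = e := by
  choose i hi using fun n => ShiftIsos.eq_mk (ShiftIsos.pow_fst e n)
  have inj : ∀ {n : ℤ} {a b : shiftFunctor C n ⋙ F ≅ F ⋙ shiftFunctor D n},
      (⟨n, a⟩ : ShiftIsos F) = ⟨n, b⟩ → a = b := fun h => eq_of_heq (Sigma.mk.inj h).2
  refine ⟨{ commShiftIso := i, commShiftIso_zero := ?_, commShiftIso_add := fun a b => ?_ }, ?_⟩
  · exact inj ((hi 0).symm.trans (congrArg Units.val (zpow_zero _)))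
  · refine inj ((hi (a + b)).symm.trans ((congrArg Units.val (zpow_add _ a b)).trans ?_))
    exact congrArg₂ (· * ·) (hi a) (hi b)
  · exact inj ((hi 1).symm.trans (congrArg Units.val (zpow_one _)))

end commShift

section fullyFaithful

variable {C D : Type*} [Category* C] [Category* D] {F : C ⥤ D}

/-- Lift of a functor `G : C ⥤ D` through a fully faithful functor. -/
def FullyFaithful.liftFunctor (hF : F.FullyFaithful) (G : C ⥤ D) (o : C → C)
    (e : ∀ X, F.obj (o X) ≅ G.obj X) : C ⥤ C where
  obj := o
  map f := hF.preimage ((e _).hom ≫ G.map f ≫ (e _).inv)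
  map_id X := hF.map_injective (by simp)
  map_comp f g := hF.map_injective (by simp)

/-- The isomorphism between the lift of `G` through `F`, composed with `F`, and `G`. -/
def FullyFaithful.liftFunctorIso (hF : F.FullyFaithful) (G : C ⥤ D) (o : C → C)
    (e : ∀ X, F.obj (o X) ≅ G.obj X) : hF.liftFunctor G o e ⋙ F ≅ G :=
  have key {X Y : C} (g : G.obj X ⟶ G.obj Y) :
    ((e X).hom ≫ g ≫ (e Y).inv) ≫ (e Y).hom = (e X).hom ≫ g := by simp
  NatIso.ofComponents e (fun f => by
    exact (congrArg (· ≫ _) (hF.map_preimage _)).trans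
      (key _))

variable [Preadditive C] [Preadditive D] [F.Additive] [HasShift C ℤ] [HasShift D ℤ]
  [F.CommShift ℤ] [∀ n : ℤ, (shiftFunctor D n).Additive]

variable (F) in
theorem shiftFunctor_additive_of_faithful [F.Faithful] (n : ℤ) : (shiftFunctor C n).Additive where
  map_add {X Y f g} := by
    have h : ∀ f : X ⟶ Y, F.map (f⟦n⟧') = (F.commShiftIso n).hom.app X ≫ (F.map f)⟦n⟧' ≫
        (F.commShiftIso n).inv.app Y := fun f => by simp
    apply F.map_injective
    rw [F.map_add, h, h, h, F.map_add, Functor.map_add]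
    simp only [Preadditive.add_comp, Preadditive.comp_add]

variable [HasZeroObject C] [HasZeroObject D] [∀ n : ℤ, (shiftFunctor C n).Additive]
  [Pretriangulated D]

/-- A category with a shift and a fully faithful functor to a pretriangulated category, commuting
with the shifts and such that the image is closed under cones, is pretriangulated. -/
@[reducible]
noncomputable def FullyFaithful.pretriangulated (hF : F.FullyFaithful)
    (hc : ∀ {X Y : C} (f : X ⟶ Y), ∃ (Z : C) (g : F.obj Y ⟶ F.obj Z)
      (h : F.obj Z ⟶ (F.obj X)⟦(1 : ℤ)⟧), Triangle.mk (F.map f) g h ∈ distTriang D) :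
    Pretriangulated C where
  distinguishedTriangles := F.mapTriangle.obj ⁻¹' (distTriang D)
  isomorphic_distinguished T₁ hT₁ T₂ e :=
    isomorphic_distinguished _ hT₁ _ (F.mapTriangle.mapIso e)
  contractible_distinguished X :=
    isomorphic_distinguished _ (contractible_distinguished (F.obj X)) _
      (Triangle.isoMk _ _ (Iso.refl _) (Iso.refl _) F.mapZeroObject
        (by change F.map (𝟙 X) ≫ 𝟙 _ = 𝟙 _ ≫ 𝟙 _; simp) (by exact comp_zero.trans comp_zero.symm)
        ((F.map_isZero (isZero_zero C)).eq_of_src _ _))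
  distinguished_cocone_triangle {X Y} f := by
    obtain ⟨Z, g, h, mem⟩ := hc f
    exact ⟨Z, hF.preimage g, hF.preimage (h ≫ (F.commShiftIso (1 : ℤ)).inv.app X),
      isomorphic_distinguished _ mem _ (Triangle.isoMk _ _ (Iso.refl _) (Iso.refl _)
        (Iso.refl _)
        (by change F.map f ≫ 𝟙 _ = 𝟙 _ ≫ F.map f; simp)
        (by change F.map (hF.preimage g) ≫ 𝟙 _ = 𝟙 _ ≫ g; simp)
        (by
          change (F.map (hF.preimage _) ≫ (F.commShiftIso (1 : ℤ)).hom.app X) ≫ (𝟙 _)⟦1⟧' =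
            𝟙 _ ≫ h
          simp))⟩
  rotate_distinguished_triangle T :=
    (rotate_distinguished_triangle (F.mapTriangle.obj T)).trans
      (distinguished_iff_of_iso (F.mapTriangleRotateIso.app T))
  complete_distinguished_triangle_morphism T₁ T₂ hT₁ hT₂ a b comm := by
    obtain ⟨c, ⟨hc₁, hc₂⟩⟩ := complete_distinguished_triangle_morphism (F.mapTriangle.obj T₁)
      (F.mapTriangle.obj T₂) hT₁ hT₂ (F.map a) (F.map b)
      (by
        change F.map T₁.mor₁ ≫ F.map b = F.map a ≫ F.map T₂.mor₁
        rw [← F.map_comp, comm, F.map_comp])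
    change F.map T₁.mor₂ ≫ c = F.map b ≫ F.map T₂.mor₂ at hc₁
    change (F.map T₁.mor₃ ≫ (F.commShiftIso (1 : ℤ)).hom.app T₁.obj₁) ≫ (F.map a)⟦(1 : ℤ)⟧' =
      c ≫ F.map T₂.mor₃ ≫ (F.commShiftIso (1 : ℤ)).hom.app T₂.obj₁ at hc₂
    obtain ⟨c, rfl⟩ : ∃ c' : T₁.obj₃ ⟶ T₂.obj₃, F.map c' = c :=
      ⟨hF.preimage c, hF.map_preimage c⟩
    refine ⟨c, hF.map_injective
      ((F.map_comp _ _).trans (hc₁.trans (F.map_comp _ _).symm)), hF.map_injective ?_⟩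
    rw [← cancel_mono ((F.commShiftIso (1 : ℤ)).hom.app T₂.obj₁)]
    simp only [F.map_comp, Category.assoc, commShiftIso_hom_naturality]
    exact (Category.assoc _ _ _).symm.trans hc₂

end fullyFaithful

end CategoryTheory.Functor

namespace CategoryTheory.ObjectProperty

variable {C : Type*} [Category* C] [HasShift C ℤ] (Q : ObjectProperty C)
  [Q.IsClosedUnderIsomorphisms]

theorem isStableUnderShift_of_one (h₁ : ∀ X, Q X → Q (X⟦(1 : ℤ)⟧))
    (h₂ : ∀ X, Q X → Q (X⟦(-1 : ℤ)⟧)) : Q.IsStableUnderShift ℤ where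
  isStableUnderShiftBy n := ⟨fun X hX => by
    change Q (X⟦n⟧)
    induction n using Int.induction_on with
    | zero => exact Q.prop_of_iso ((shiftFunctorZero C ℤ).app X).symm hX
    | succ n ih => exact Q.prop_of_iso ((shiftFunctorAdd C (n : ℤ) 1).app X).symm (h₁ _ ih)
    | pred n ih =>
      exact Q.prop_of_iso ((shiftFunctorAdd' C (-n : ℤ) (-1) (-n - 1) rfl).app X).symm (h₂ _ ih)⟩

end CategoryTheory.ObjectProperty

/-! ### The Yoneda embedding and canonical triangulations -/

theorem H0.homMk_eq_iff_d {k : Type u} [CommRing k] {A : Type v} [DGCategory k A] {x y : A}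
    {f g : Z0 k x y} : H0.homMk f = H0.homMk g ↔
      ∃ t : Hom k x y (-1), f.1 - g.1 = d (-1) 0 (neg_add_cancel 1) t := by
  simp only [H0.homMk_eq_iff, δ_tot (neg_add_cancel 1), ← tot_sub, tot_inj]

namespace DGFunctor

variable {k : Type u} [CommRing k] {A : Type*} [DGCategory k A] {B : Type*} [DGCategory k B]
  (F : DGFunctor k A B)

instance : F.mapH0.Additive where
  map_add {X Y f g} := by
    obtain ⟨f, rfl⟩ := H0.homMk_surjective f
    obtain ⟨g, rfl⟩ := H0.homMk_surjective g
    exact congrArg H0.homMk (map_add (F.mapZ0 _ _) f g)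

variable (hF : ∀ (x y : A) (n : ℤ), Function.Bijective (F.map : Hom k x y n → _))

include hF in
/-- A dg functor that is bijective on Hom-complexes induces a fully faithful functor. -/
theorem full_of_bijective : F.mapH0.Full where
  map_surjective {X Y} g := by
    obtain ⟨g, rfl⟩ := H0.homMk_surjective g
    obtain ⟨f, hf⟩ := (hF X.obj Y.obj 0).2 g.1
    refine ⟨H0.homMk ⟨f, (hF _ _ 1).1 ?_⟩, congrArg H0.homMk (Subtype.ext hf)⟩
    rw [F.map_d, hf, map_zero]
    exact g.2

include hF in
theorem faithful_of_bijective : F.mapH0.Faithful where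
  map_injective {X Y} f g h := by
    obtain ⟨f, rfl⟩ := H0.homMk_surjective f
    obtain ⟨g, rfl⟩ := H0.homMk_surjective g
    obtain ⟨t, ht⟩ := H0.homMk_eq_iff_d.1 h
    obtain ⟨t, rfl⟩ := (hF _ _ _).2 t
    refine H0.homMk_eq_iff_d.2 ⟨t, (hF _ _ _).1 ?_⟩
    rw [F.map_d, ← ht, map_sub]
    rfl

include hF in
theorem quasiIso_of_bijective (x y : A) : QuasiIso (F.mapComplex x y) := by
  have : ∀ n, IsIso ((F.mapComplex x y).f n) := fun n =>
    (ConcreteCategory.isIso_iff_bijective _).2 (hF x y n)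
  have : IsIso (F.mapComplex x y) := HomologicalComplex.Hom.isIso_of_components _
  infer_instance

end DGFunctor

/-- The inclusion of a full dg subcategory. -/
def DGFull.incl (k : Type u) [CommRing k] {A : Type v} [DGCategory k A] (P : A → Prop) :
    DGFunctor k (DGFull P) A where
  obj x := x.1
  map := LinearMap.id
  map_d _ _ _ _ := rfl
  map_one _ := rfl
  map_comp _ _ _ := rfl

namespace DGMod

variable {k : Type u} [CommRing k] {A : Type u} [DGCategory k A]

/-- The morphism `A(-, y) ⟶ N` given by an element of `N(y)`. -/
def ofElem {y : A} {N : DGMod k A} {n : ℤ} (m : N.X y n) : Mor (yonedaObj k y) N n :=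
  Mor.mk (fun x p q h => (N.act (by omega : n + p = q) m : Hom k x y p →ₗ[k] N.X x q)) (by
    intro x w p q r p' r' h hp hr h' a b
    exact (N.act_act _ _ _ _ m a b).symm)

theorem ofElem_app_one {y : A} {N : DGMod k A} {n : ℤ} (m : N.X y n) :
    (ofElem m).app y 0 n (zero_add n) (one y : Hom k y y 0) = m := N.act_one _ m

theorem ofElem_app {y : A} {N : DGMod k A} {n : ℤ} (f : Mor (yonedaObj k y) N n) :
    ofElem (f.app y 0 n (zero_add n) (one y : Hom k y y 0)) = f := by
  refine Mor.ext fun x p q h m => ?_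
  have e := f.comm (zero_add p) (zero_add n) h (by omega : n + p = q) (one y : Hom k y y 0) m
  refine e.symm.trans (congrArg (f.app x p q h) ?_)
  exact one_comp _ _

/-- The Yoneda lemma. -/
theorem app_one_bijective (y : A) (N : DGMod k A) (n : ℤ) :
    Function.Bijective (fun f : Mor (yonedaObj k y) N n =>
      f.app y 0 n (zero_add n) (one y : Hom k y y 0)) :=
  Function.bijective_iff_has_inverse.2 ⟨ofElem, ofElem_app, ofElem_app_one⟩

theorem yoneda_bijective (y z : A) (n : ℤ) :
    Function.Bijective ((yoneda k A).map : Hom k y z n → _) := by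
  refine (Function.Bijective.of_comp_iff' (app_one_bijective y (yonedaObj k z) n) _).1 ?_
  have e : (fun f : Mor (yonedaObj k y) (yonedaObj k z) n =>
      f.app y 0 n (zero_add n) (one y : Hom k y y 0)) ∘ ((yoneda k A).map : Hom k y z n → _) = id :=
    funext fun f => comp_one _ f
  rw [e]
  exact Function.bijective_id

instance : (yoneda k A).mapH0.Full := DGFunctor.full_of_bijective _ yoneda_bijective

instance : (yoneda k A).mapH0.Faithful := DGFunctor.faithful_of_bijective _ yoneda_bijective

end DGMod

namespace DGFull

variable (k : Type u) [CommRing k] {A : Type v} [DGCategory k A] (P : A → Prop)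

instance : (incl k P).mapH0.Full :=
  DGFunctor.full_of_bijective _ fun _ _ _ => Function.bijective_id

instance : (incl k P).mapH0.Faithful :=
  DGFunctor.faithful_of_bijective _ fun _ _ _ => Function.bijective_id

end DGFull

/-- As the Yoneda embedding is fully faithful, `A` is pretriangulated if and only if all modules in
the pretriangulated hull are homotopy equivalent to representable ones. -/
theorem isPretriangulatedDG_iff (k : Type u) [CommRing k] (A : Type u) [DGCategory k A] :
    IsPretriangulatedDG k A ↔ ∀ M, DGMod.InPretr k A M →
      ∃ x : A, Nonempty ((⟨DGMod.yonedaObj k x⟩ : H0 k (DGMod k A)) ≅ ⟨M⟩) := by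
  constructor
  · rintro ⟨-, h⟩ M hM
    obtain ⟨x, ⟨e⟩⟩ := h.mem_essImage ⟨⟨M, hM⟩⟩
    exact ⟨x.obj, ⟨(DGFull.incl k (DGMod.InPretr k A)).mapH0.mapIso e⟩⟩
  · intro h
    refine ⟨fun x y => DGFunctor.quasiIso_of_bijective (toPretrHull k A)
      (fun y z n => DGMod.yoneda_bijective y z n) x y, ⟨fun X => ?_⟩⟩
    obtain ⟨x, ⟨e⟩⟩ := h X.obj.1 X.obj.2
    exact ⟨⟨x⟩, ⟨(DGFull.incl k (DGMod.InPretr k A)).mapH0.preimageIso e⟩⟩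

/-! ### Canonical triangulations of pretriangulated dg categories -/

section

-- Compositions in homotopy categories are compared factor by factor, not by representatives.
attribute [local irreducible] H0comp

/-- An isomorphism of triangles, spelled out in terms of a functor `S` isomorphic to the shift and
an object `Z` isomorphic to the third vertex of the target. -/
theorem CategoryTheory.Pretriangulated.nonempty_triangle_iso_iff {C : Type*} [Category* C]
    [HasShift C ℤ] {S : C ⥤ C} (ν : shiftFunctor C (1 : ℤ) ≅ S) (T T' : Triangle C) {Z : C}
    (κ : T'.obj₃ ≅ Z) (v : T'.obj₂ ⟶ Z) (w : Z ⟶ S.obj T'.obj₁) (hv : T'.mor₂ ≫ κ.hom = v)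
    (hw : T'.mor₃ ≫ ν.hom.app T'.obj₁ = κ.hom ≫ w) :
    Nonempty (T ≅ T') ↔ ∃ (a : T.obj₁ ≅ T'.obj₁) (b : T.obj₂ ≅ T'.obj₂) (c : T.obj₃ ≅ Z),
      T.mor₁ ≫ b.hom = a.hom ≫ T'.mor₁ ∧ T.mor₂ ≫ c.hom = b.hom ≫ v ∧
      T.mor₃ ≫ ν.hom.app T.obj₁ ≫ S.map a.hom = c.hom ≫ w := by
  subst hv
  obtain rfl : w = κ.inv ≫ T'.mor₃ ≫ ν.hom.app T'.obj₁ := by rw [hw, Iso.inv_hom_id_assoc]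
  constructor
  · rintro ⟨e⟩
    have h₁ := e.hom.comm₁
    have h₂ := e.hom.comm₂
    have h₃ := e.hom.comm₃
    refine ⟨⟨e.hom.hom₁, e.inv.hom₁, by simp, by simp⟩, ⟨e.hom.hom₂, e.inv.hom₂, by simp, by simp⟩,
      (⟨e.hom.hom₃, e.inv.hom₃, by simp, by simp⟩ : T.obj₃ ≅ T'.obj₃) ≪≫ κ, h₁, ?_, ?_⟩
    · simp only [Iso.trans_hom, ← Category.assoc, h₂]
    · rw [← ν.hom.naturality]
      simp only [Iso.trans_hom, Category.assoc, Iso.hom_inv_id_assoc, ← reassoc_of% h₃]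
  · rintro ⟨a, b, c, h₁, h₂, h₃⟩
    rw [← ν.hom.naturality] at h₃
    refine ⟨Triangle.isoMk _ _ a b (c ≪≫ κ.symm) h₁ ?_ ?_⟩
    · simp [reassoc_of% h₂]
    · rw [← cancel_mono (ν.hom.app _)]
      simpa using h₃

namespace DGMod

variable {k : Type u} [CommRing k] {A : Type u} [DGCategory k A]

theorem shZ0_one_eq_susp {M N : DGMod k A} (f : Z0 k M N) :
    StrictPretr.shZ0 1 M N f = (susp k A).mapZ0 M N f := by
  refine Subtype.ext (Mor.ext fun x p q h m => ?_)
  obtain rfl : p = q := by omega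
  refine (compMor_app (neg_add_cancel 1) _ _ x h rfl (by omega : p + 1 + -1 = p) m).trans ?_
  refine (congrArg (Mor.app (toShift N 1) x (p + 1) p _) (compMor_app (zero_add 1) f.1
    (ofShift M 1) x rfl rfl (add_zero (p + 1)) m)).trans ?_
  exact (one_smul ℤˣ (f.1.app x (p + 1) (p + 1) (add_zero _) m)).symm

/-- The identity of `M[1]`, from the shift of the `StrictPretr` structure to the suspension.  The
two agree by definition; an explicit comparison keeps unification from unfolding them. -/
def shiftSuspHom (M : DGMod k A) : Z0 k (StrictPretr.sh k M 1) (M.shift 1) := Z0one (M.shift 1)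

/-- The inverse of `shiftSuspHom`. -/
def shiftSuspInv (M : DGMod k A) : Z0 k (M.shift 1) (StrictPretr.sh k M 1) := Z0one (M.shift 1)

/-- The identity of a cone, from the cone of the `StrictPretr` structure to that of dg modules. -/
def coneHom {M N : DGMod k A} (f : Z0 k M N) : Z0 k (StrictPretr.cone f) (cone f) :=
  Z0one (cone f)

/-- The inverse of `coneHom`. -/
def coneInv {M N : DGMod k A} (f : Z0 k M N) : Z0 k (cone f) (StrictPretr.cone f) :=
  Z0one (cone f)

/-- The two descriptions of `M[1]` give isomorphic objects of `H⁰(DGMod-A)`. -/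
noncomputable def shiftSuspIso (M : DGMod k A) :
    (⟨StrictPretr.sh k M 1⟩ : H0 k (DGMod k A)) ≅ ⟨M.shift 1⟩ :=
  H0.isoMk' (shiftSuspHom M) (shiftSuspInv M) (Category.comp_id _) (Category.comp_id _)

/-- The two descriptions of a cone give isomorphic objects of `H⁰(DGMod-A)`. -/
noncomputable def coneIso {M N : DGMod k A} (f : Z0 k M N) :
    (⟨StrictPretr.cone f⟩ : H0 k (DGMod k A)) ≅ ⟨cone f⟩ :=
  H0.isoMk' (coneHom f) (coneInv f) (Category.comp_id _) (Category.comp_id _)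

theorem shZ0_comp_shiftSuspHom {M N : DGMod k A} (f : Z0 k M N) :
    Z0comp (shiftSuspHom N) (StrictPretr.shZ0 1 M N f) =
      Z0comp ((susp k A).mapZ0 M N f) (shiftSuspHom M) := by
  rw [shZ0_one_eq_susp]
  exact Subtype.ext ((one_comp _ _).trans (comp_one _ _).symm)

theorem homMk_shZ0_comp_shiftSuspIso {M N : DGMod k A} (f : Z0 k M N) :
    H0.homMk (StrictPretr.shZ0 1 M N f) ≫ (shiftSuspIso N).hom =
      (shiftSuspIso M).hom ≫ H0.homMk ((susp k A).mapZ0 M N f) :=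
  (H0.homMk_comp _ _).trans ((congrArg H0.homMk (shZ0_comp_shiftSuspHom f)).trans
    (H0.homMk_comp _ _).symm)

theorem connZ_comp {M N : DGMod k A} (f : Z0 k M N) :
    Z0comp (shiftSuspHom M) (StrictPretr.connZ f) = Z0comp (coneFst f) (coneHom f) := by
  refine Subtype.ext (((one_comp _ _).trans ?_).trans (comp_one _ _).symm)
  refine (Mor.ext fun x p q h m => ?_)
  obtain rfl : p = q := by omega
  exact compMor_app (neg_add_cancel 1) _ _ x h rfl (by omega : p + 1 + -1 = p) m

theorem inrZ_comp {M N : DGMod k A} (f : Z0 k M N) :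
    Z0comp (coneHom f) (StrictPretr.inrZ f) = coneInr f :=
  Subtype.ext (one_comp _ _)

/-- The shift on `H⁰(DGMod-A)` is the suspension. -/
noncomputable def shiftIsoSusp :
    shiftFunctor (H0 k (DGMod k A)) (1 : ℤ) ≅ (susp k A).mapH0 :=
  NatIso.ofComponents (fun X => shiftSuspIso X.obj) (fun {X Y} f => by
    obtain ⟨f, rfl⟩ := H0.homMk_surjective f
    exact homMk_shZ0_comp_shiftSuspIso f)

/-- The class of `coneFst f`. -/
noncomputable def coneFstH {M N : DGMod k A} (f : Z0 k M N) :
    (⟨cone f⟩ : H0 k (DGMod k A)) ⟶ (susp k A).mapH0.obj (StrictPretr.stdTriangle f).obj₁ :=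
  H0.homMk (coneFst f)

theorem stdTriangle_mor₃_comp {M N : DGMod k A} (f : Z0 k M N) :
    (StrictPretr.stdTriangle f).mor₃ ≫ shiftIsoSusp.hom.app (StrictPretr.stdTriangle f).obj₁ =
      (coneIso f).hom ≫ coneFstH f :=
  (H0.homMk_comp _ _).trans ((congrArg H0.homMk (connZ_comp f)).trans (H0.homMk_comp _ _).symm)

/-- The class of `coneInr f`. -/
noncomputable def coneInrH {M N : DGMod k A} (f : Z0 k M N) :
    (StrictPretr.stdTriangle f).obj₂ ⟶ (⟨cone f⟩ : H0 k (DGMod k A)) :=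
  H0.homMk (coneInr f)

theorem stdTriangle_mor₂_comp {M N : DGMod k A} (f : Z0 k M N) :
    (StrictPretr.stdTriangle f).mor₂ ≫ (coneIso f).hom = coneInrH f :=
  (H0.homMk_comp _ _).trans (congrArg H0.homMk (inrZ_comp f))

/-- Distinguished triangles in `H⁰(DGMod-A)`, unwound. -/
theorem distinguished_iff (T : Triangle (H0 k (DGMod k A))) :
    T ∈ distTriang (H0 k (DGMod k A)) ↔
    ∃ (M N : DGMod k A) (f : Z0 k M N) (a : T.obj₁ ≅ ⟨M⟩) (b : T.obj₂ ≅ ⟨N⟩)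
      (c : T.obj₃ ≅ ⟨cone f⟩),
      T.mor₁ ≫ b.hom = a.hom ≫ H0.homMk f ∧ T.mor₂ ≫ c.hom = b.hom ≫ H0.homMk (coneInr f) ∧
      T.mor₃ ≫ shiftIsoSusp.hom.app T.obj₁ ≫ (susp k A).mapH0.map a.hom =
        c.hom ≫ H0.homMk (coneFst f) := by
  refine (StrictPretr.mem_distTriang_iff T).trans ?_
  refine exists_congr fun M => exists_congr fun N => exists_congr fun f => ?_
  exact nonempty_triangle_iso_iff shiftIsoSusp T (StrictPretr.stdTriangle f) (coneIso f)
    (coneInrH f) (coneFstH f) (stdTriangle_mor₂_comp f) (stdTriangle_mor₃_comp f)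

end DGMod

theorem CategoryTheory.Pretriangulated.mk_distinguished_of_iso₃ {C : Type*} [Category* C]
    [HasZeroObject C] [HasShift C ℤ] [Preadditive C] [∀ n : ℤ, (shiftFunctor C n).Additive]
    [Pretriangulated C] (T : Triangle C) (hT : T ∈ distTriang C) {Z : C} (b : Z ≅ T.obj₃) :
    Triangle.mk T.mor₁ (T.mor₂ ≫ b.inv) (b.hom ≫ T.mor₃) ∈ distTriang C :=
  isomorphic_distinguished _ hT _ (Triangle.isoMk _ _ (Iso.refl _) (Iso.refl _) b
    ((Category.comp_id _).trans (Category.id_comp _).symm)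
    ((((Category.assoc _ _ _).trans (congrArg (T.mor₂ ≫ ·) b.inv_hom_id)).trans
      (Category.comp_id _)).trans
      (Category.id_comp _).symm)
    ((congrArg (_ ≫ ·) ((shiftFunctor C (1 : ℤ)).map_id _)).trans (Category.comp_id _)))

theorem CategoryTheory.Functor.mapTriangle_mor₃_comp {C D : Type*} [Category* C] [Category* D]
    [HasShift C ℤ] [HasShift D ℤ] (F : C ⥤ D) [F.CommShift ℤ] {S : D ⥤ D}
    (ν : shiftFunctor D (1 : ℤ) ≅ S) (T : Triangle C) {M : D} (g : S.obj (F.obj T.obj₁) ⟶ M) :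
    (F.mapTriangle.obj T).mor₃ ≫ ν.hom.app (F.obj T.obj₁) ≫ g =
      F.map T.mor₃ ≫ (F.commShiftIso (1 : ℤ) ≪≫ Functor.isoWhiskerLeft F ν).hom.app T.obj₁ ≫ g :=
  (Category.assoc _ _ _).trans (congrArg (F.map T.mor₃ ≫ ·) (Category.assoc _ _ _).symm)

section

variable {k : Type u} [CommRing k] {A : Type u} [DGCategory k A]

open DGMod Functor

/-- The representable modules of a pretriangulated dg category are closed under shifts, up to
homotopy equivalence. -/
theorem exists_yoneda_shift (hA : IsPretriangulatedDG k A) (n : ℤ) (X : H0 k A) :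
    ∃ Y : H0 k A, Nonempty ((yoneda k A).mapH0.obj Y ≅ ((yoneda k A).mapH0.obj X)⟦n⟧) := by
  rw [isPretriangulatedDG_iff] at hA
  have : (yoneda k A).mapH0.essImage.IsStableUnderShift ℤ := by
    refine ObjectProperty.isStableUnderShift_of_one _ ?_ ?_
    · rintro M ⟨X, ⟨e⟩⟩
      obtain ⟨y, ⟨e'⟩⟩ := hA _ (.susp (.yoneda X.obj))
      exact ⟨⟨y⟩, ⟨e' ≪≫ (shiftFunctor _ (1 : ℤ)).mapIso e⟩⟩
    · rintro M ⟨X, ⟨e⟩⟩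
      obtain ⟨y, ⟨e'⟩⟩ := hA _ (.desusp (.yoneda X.obj))
      exact ⟨⟨y⟩, ⟨e' ≪≫ (shiftFunctor _ (-1 : ℤ)).mapIso e⟩⟩
  exact ObjectProperty.le_shift _ n _ (Functor.obj_mem_essImage _ X)

theorem hasZeroObject_of_isPretriangulatedDG (hA : IsPretriangulatedDG k A) :
    HasZeroObject (H0 k A) := by
  obtain ⟨x, ⟨e⟩⟩ := (isPretriangulatedDG_iff k A).1 hA _ .zero
  refine ⟨⟨x⟩, (IsZero.iff_id_eq_zero _).2 ((yoneda k A).mapH0.map_injective ?_)⟩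
  exact ((StrictPretr.isZero_zero (k := k) (D := DGMod k A)).of_iso e).eq_of_src _ _

/-- The representable modules of a pretriangulated dg category are closed under cones, up to
homotopy equivalence. -/
theorem exists_yoneda_cone (hA : IsPretriangulatedDG k A) {X Y : H0 k A} (f : X ⟶ Y) :
    ∃ (Z : H0 k A) (g : (yoneda k A).mapH0.obj Y ⟶ (yoneda k A).mapH0.obj Z)
      (h : (yoneda k A).mapH0.obj Z ⟶ ((yoneda k A).mapH0.obj X)⟦(1 : ℤ)⟧),
      Triangle.mk ((yoneda k A).mapH0.map f) g h ∈ distTriang (H0 k (DGMod k A)) := by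
  obtain ⟨f, rfl⟩ := H0.homMk_surjective f
  obtain ⟨z, ⟨a⟩⟩ := (isPretriangulatedDG_iff k A).1 hA _
    (.cone ((yoneda k A).mapZ0 _ _ f) (.yoneda X.obj) (.yoneda Y.obj))
  let b : (yoneda k A).mapH0.obj ⟨z⟩ ≅
      (StrictPretr.stdTriangle ((yoneda k A).mapZ0 _ _ f)).obj₃ := a ≪≫ (coneIso _).symm
  exact ⟨⟨z⟩, _, _, mk_distinguished_of_iso₃ _ (StrictPretr.std_mem _) b⟩

theorem yoneda_mapTriangle_distinguished_iff [HasShift (H0 k A) ℤ]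
    [(yoneda k A).mapH0.CommShift ℤ] (T : Triangle (H0 k A)) :
    (yoneda k A).mapH0.mapTriangle.obj T ∈ distTriang (H0 k (DGMod k A)) ↔
    ∃ (M N : DGMod k A) (f : Z0 k M N)
      (a : (yoneda k A).mapH0.obj T.obj₁ ≅ ⟨M⟩) (b : (yoneda k A).mapH0.obj T.obj₂ ≅ ⟨N⟩)
      (c : (yoneda k A).mapH0.obj T.obj₃ ≅ ⟨cone f⟩),
      (yoneda k A).mapH0.map T.mor₁ ≫ b.hom = a.hom ≫ H0.homMk f ∧
      (yoneda k A).mapH0.map T.mor₂ ≫ c.hom = b.hom ≫ H0.homMk (coneInr f) ∧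
      (yoneda k A).mapH0.map T.mor₃ ≫ ((yoneda k A).mapH0.commShiftIso (1 : ℤ) ≪≫
          isoWhiskerLeft (yoneda k A).mapH0 shiftIsoSusp).hom.app T.obj₁ ≫
        (susp k A).mapH0.map a.hom = c.hom ≫ H0.homMk (coneFst f) := by
  refine (DGMod.distinguished_iff ((yoneda k A).mapH0.mapTriangle.obj T)).trans ?_
  refine exists_congr fun M => exists_congr fun N => exists_congr fun f =>
    exists_congr fun a => exists_congr fun b => exists_congr fun c =>
    and_congr_right fun _ => and_congr_right fun _ => ?_
  exact Eq.congr_left (mapTriangle_mor₃_comp _ _ _ _)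

/-- A triangulated structure on `H⁰(A)` that is reflected by the Yoneda embedding is canonical. -/
theorem nonempty_canonicalTriangulation_of_iff [HasShift (H0 k A) ℤ] [HasZeroObject (H0 k A)]
    [∀ n : ℤ, (shiftFunctor (H0 k A) n).Additive] [Pretriangulated (H0 k A)]
    [IsTriangulated (H0 k A)] [(yoneda k A).mapH0.CommShift ℤ]
    (h : ∀ T : Triangle (H0 k A), T ∈ distTriang (H0 k A) ↔
      (yoneda k A).mapH0.mapTriangle.obj T ∈ distTriang (H0 k (DGMod k A))) :
    Nonempty (CanonicalTriangulation k A) :=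
  ⟨{ shiftIso := (yoneda k A).mapH0.commShiftIso (1 : ℤ) ≪≫
       isoWhiskerLeft (yoneda k A).mapH0 shiftIsoSusp
     distinguished_iff := fun T => (h T).trans (yoneda_mapTriangle_distinguished_iff T) }⟩

/-- The homotopy category of a pretriangulated dg category has a canonical triangulation: shifts and
distinguished triangles are transported from `H⁰(DGMod-A)` along the Yoneda embedding. -/
theorem nonempty_canonicalTriangulation (hA : IsPretriangulatedDG k A) :
    Nonempty (CanonicalTriangulation k A) := by
  let Y := (yoneda k A).mapH0
  let hY : Y.FullyFaithful := Functor.FullyFaithful.ofFullyFaithful Y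
  choose o e using exists_yoneda_shift hA
  let e' := fun n X => (e n X).some
  let s := fun n => hY.liftFunctor (Y ⋙ shiftFunctor _ n) (o n) (e' n)
  let i := fun n => hY.liftFunctorIso (Y ⋙ shiftFunctor _ n) (o n) (e' n)
  let := hY.hasShift s i
  let : Y.CommShift ℤ := CommShift.ofHasShiftOfFullyFaithful hY s i
  have := hasZeroObject_of_isPretriangulatedDG hA
  have : ∀ n : ℤ, (shiftFunctor (H0 k A) n).Additive := shiftFunctor_additive_of_faithful Y
  let : Pretriangulated (H0 k A) := hY.pretriangulated (exists_yoneda_cone hA)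
  have : Y.IsTriangulated := ⟨fun _ h => h⟩
  have := IsTriangulated.of_fully_faithful_triangulated_functor Y
  exact nonempty_canonicalTriangulation_of_iff fun _ => Iff.rfl

end

end

/-! ### Dg functors are exact -/

namespace DGFunctor

variable {k : Type u} [CommRing k] {D E : Type v} [DGCategory k D] [DGCategory k E]
  (G : DGFunctor k D E)

@[simp] theorem tot_mapZ0 {x y : D} (f : Z0 k x y) : tot (G.mapZ0 x y f).1 = tot (G.map f.1) := rfl

theorem tot_map_comp {x y z : D} {p q n : ℤ} (h : p + q = n) (g : Hom k y z p) (f : Hom k x y q) :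
    tot (G.map (comp h g f)) = tot (G.map f) ≫ tot (G.map g) := by
  rw [G.map_comp, tot_comp]

theorem δ_tot_map {x y : D} {p q : ℤ} (h : p + 1 = q) (f : Hom k x y p) :
    δ (tot (G.map f)) = tot (G.map (d p q h f)) := by
  rw [δ_tot h, G.map_d]

variable [StrictPretr k D]

open StrictPretr

section

variable (x : D) (n : ℤ)

@[simp] theorem map_σ_τ : tot (G.map (σ (k := k) x n)) ≫ tot (G.map (τ x n)) = 𝟙 _ := by
  rw [← tot_map_comp G (add_neg_cancel n), τ_σ, G.map_one, tot_one]

@[simp] theorem map_σ_τ_assoc {W : Tot k E} (h : (⟨G.obj (x)⟩ : Tot k E) ⟶ W) :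
    tot (G.map (σ (k := k) x n)) ≫ tot (G.map (τ x n)) ≫ h = h := by
  rw [← Category.assoc, map_σ_τ, Category.id_comp]

@[simp] theorem map_τ_σ : tot (G.map (τ (k := k) x n)) ≫ tot (G.map (σ x n)) = 𝟙 _ := by
  rw [← tot_map_comp G (neg_add_cancel n), σ_τ, G.map_one, tot_one]

@[simp] theorem δ_map_σ : δ (tot (G.map (σ (k := k) x n))) = 0 := by
  rw [δ_tot_map G rfl, d_σ, map_zero, tot_zero]

@[simp] theorem δ_map_τ : δ (tot (G.map (τ (k := k) x n))) = 0 := by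
  rw [δ_tot_map G rfl, d_τ, map_zero, tot_zero]

end

section

variable {x y : D} (f : Z0 k x y)

@[simp] theorem map_inl_fst : tot (G.map (inl f)) ≫ tot (G.map (fst f)) = 𝟙 _ := by
  rw [← tot_map_comp G (add_neg_cancel 1), fst_inl, G.map_one, tot_one]

@[simp] theorem map_inl_fst_assoc {W : Tot k E} (h : (⟨G.obj (x)⟩ : Tot k E) ⟶ W) :
    tot (G.map (inl f)) ≫ tot (G.map (fst f)) ≫ h = h := by
  rw [← Category.assoc, map_inl_fst, Category.id_comp]

@[simp] theorem map_inr_fst : tot (G.map (inr f)) ≫ tot (G.map (fst f)) = 0 := by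
  rw [← tot_map_comp G (add_zero 1), fst_inr, map_zero, tot_zero]

@[simp] theorem map_inr_fst_assoc {W : Tot k E} (h : (⟨G.obj (x)⟩ : Tot k E) ⟶ W) :
    tot (G.map (inr f)) ≫ tot (G.map (fst f)) ≫ h = 0 := by
  rw [← Category.assoc, map_inr_fst, zero_comp]

@[simp] theorem map_inl_snd : tot (G.map (inl f)) ≫ tot (G.map (snd f)) = 0 := by
  rw [← tot_map_comp G (zero_add (-1)), snd_inl, map_zero, tot_zero]

@[simp] theorem map_inl_snd_assoc {W : Tot k E} (h : (⟨G.obj (y)⟩ : Tot k E) ⟶ W) :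
    tot (G.map (inl f)) ≫ tot (G.map (snd f)) ≫ h = 0 := by
  rw [← Category.assoc, map_inl_snd, zero_comp]

@[simp] theorem map_inr_snd : tot (G.map (inr f)) ≫ tot (G.map (snd f)) = 𝟙 _ := by
  rw [← tot_map_comp G (zero_add 0), snd_inr, G.map_one, tot_one]

@[simp] theorem map_inr_snd_assoc {W : Tot k E} (h : (⟨G.obj (y)⟩ : Tot k E) ⟶ W) :
    tot (G.map (inr f)) ≫ tot (G.map (snd f)) ≫ h = h := by
  rw [← Category.assoc, map_inr_snd, Category.id_comp]

theorem map_total : tot (G.map (snd f)) ≫ tot (G.map (inr f)) +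
    tot (G.map (fst f)) ≫ tot (G.map (inl f)) = 𝟙 _ := by
  rw [← tot_map_comp G (zero_add 0), ← tot_map_comp G (neg_add_cancel 1), ← tot_add, ← map_add,
    total, G.map_one, tot_one]

@[simp] theorem δ_map_inl : δ (tot (G.map (inl f))) = tot (G.map f.1) ≫ tot (G.map (inr f)) := by
  rw [δ_tot_map G (neg_add_cancel 1), d_inl, tot_map_comp]

@[simp] theorem δ_map_inr : δ (tot (G.map (inr f))) = 0 := by
  rw [δ_tot_map G (zero_add 1), d_inr, map_zero, tot_zero]

@[simp] theorem δ_map_fst : δ (tot (G.map (fst f))) = 0 := by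
  rw [δ_tot_map G (by norm_num : (1 : ℤ) + 1 = 2), d_fst, map_zero, tot_zero]

@[simp] theorem δ_map_snd : δ (tot (G.map (snd f))) =
    -(tot (G.map (fst f)) ≫ tot (G.map f.1)) := by
  rw [δ_tot_map G (zero_add 1), d_snd, map_neg, tot_neg, tot_map_comp]

@[simp] theorem ε_map_inl : ε (tot (G.map (inl f))) = -tot (G.map (inl f)) := ε_tot_neg_one _
@[simp] theorem ε_map_inr : ε (tot (G.map (inr f))) = tot (G.map (inr f)) := ε_tot_zero _

end

theorem tot_map_inrZ {x y : D} (f : Z0 k x y) : tot (G.map (inrZ f).1) = tot (G.map (inr f)) := rfl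

theorem tot_map_connZ {x y : D} (f : Z0 k x y) :
    tot (G.map (connZ f).1) = tot (G.map (fst f)) ≫ tot (G.map (σ x 1)) :=
  tot_map_comp G (neg_add_cancel 1) _ _

variable [StrictPretr k E]

/-- The comparison `G(x[1]) ⟶ G(x)[1]`. -/
noncomputable def shComparison (x : D) : Z0 k (G.obj (sh k x 1)) (sh k (G.obj x) 1) :=
  Z0.mk (comp (neg_add_cancel 1) (σ (G.obj x) 1) (G.map (τ x 1)))
    (by simp)

@[simp] theorem tot_shComparison (x : D) :
    tot (G.shComparison x).1 = tot (G.map (τ x 1)) ≫ tot (σ (G.obj x) 1) := by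
  simp [shComparison, Z0.mk]

/-- The inverse of `shComparison`. -/
noncomputable def shComparisonInv (x : D) : Z0 k (sh k (G.obj x) 1) (G.obj (sh k x 1)) :=
  Z0.mk (comp (neg_add_cancel 1) (G.map (σ x 1)) (τ (G.obj x) 1))
    (by simp)

@[simp] theorem tot_shComparisonInv (x : D) :
    tot (G.shComparisonInv x).1 = tot (τ (G.obj x) 1) ≫ tot (G.map (σ x 1)) := by
  simp [shComparisonInv, Z0.mk]

/-- The comparison `G(cone f) ⟶ cone (G f)`. -/
noncomputable def coneComparison {x y : D} (f : Z0 k x y) :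
    Z0 k (G.obj (cone f)) (cone (G.mapZ0 x y f)) :=
  Z0.mk (comp (zero_add 0) (inr (G.mapZ0 x y f)) (G.map (snd f)) +
      comp (neg_add_cancel 1) (inl (G.mapZ0 x y f)) (G.map (fst f)))
    (by simp)

@[simp] theorem tot_coneComparison {x y : D} (f : Z0 k x y) :
    tot (G.coneComparison f).1 = tot (G.map (snd f)) ≫ tot (inr (G.mapZ0 x y f)) +
      tot (G.map (fst f)) ≫ tot (inl (G.mapZ0 x y f)) := by
  simp [coneComparison, Z0.mk]

/-- The inverse of `coneComparison`. -/
noncomputable def coneComparisonInv {x y : D} (f : Z0 k x y) :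
    Z0 k (cone (G.mapZ0 x y f)) (G.obj (cone f)) :=
  Z0.mk (comp (zero_add 0) (G.map (inr f)) (snd (G.mapZ0 x y f)) +
      comp (neg_add_cancel 1) (G.map (inl f)) (fst (G.mapZ0 x y f)))
    (by simp)

@[simp] theorem tot_coneComparisonInv {x y : D} (f : Z0 k x y) :
    tot (G.coneComparisonInv f).1 = tot (snd (G.mapZ0 x y f)) ≫ tot (G.map (inr f)) +
      tot (fst (G.mapZ0 x y f)) ≫ tot (G.map (inl f)) := by
  simp [coneComparisonInv, Z0.mk]

/-- A dg functor preserves cones. -/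
noncomputable def coneComparisonIso {x y : D} (f : Z0 k x y) :
    (⟨G.obj (cone f)⟩ : H0 k E) ≅ ⟨cone (G.mapZ0 x y f)⟩ :=
  H0.isoMk' (G.coneComparison f) (G.coneComparisonInv f)
    (by simp [← G.map_total f]) (by simp [← tot_total])

/-- A dg functor commutes with the shift on homotopy categories. -/
noncomputable def shComparisonIso :
    shiftFunctor (H0 k D) (1 : ℤ) ⋙ G.mapH0 ≅ G.mapH0 ⋙ shiftFunctor (H0 k E) (1 : ℤ) :=
  NatIso.ofComponents (fun X => (H0.isoMk' (G.shComparison X.obj) (G.shComparisonInv X.obj)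
    (by simp) (by simp) : (⟨G.obj (sh k X.obj 1)⟩ : H0 k E) ≅ ⟨sh k (G.obj X.obj) 1⟩))
    (fun {X Y} f => by
      obtain ⟨f, rfl⟩ := H0.homMk_surjective f
      refine H0.homMk_congr (f := Z0comp (G.shComparison Y.obj) (G.mapZ0 _ _ (shZ0 1 _ _ f)))
        (g := Z0comp (shZ0 1 _ _ (G.mapZ0 _ _ f)) (G.shComparison X.obj)) ?_
      have e : tot (G.map (shZ0 1 _ _ f).1) =
          tot (G.map (τ X.obj 1)) ≫ tot (G.map f.1) ≫ tot (G.map (σ Y.obj 1)) := by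
        rw [← tot_map_comp G (add_comm _ _), ← tot_map_comp G (neg_add_cancel 1)]
        exact congrArg (tot <| G.map ·) (tot_injective (by simp))
      simp [e])

noncomputable instance : G.mapH0.CommShift ℤ :=
  (Functor.exists_commShift_of_iso G.shComparisonIso).choose

theorem commShiftIso_one : G.mapH0.commShiftIso (1 : ℤ) = G.shComparisonIso :=
  (Functor.exists_commShift_of_iso G.shComparisonIso).choose_spec

instance : G.mapH0.IsTriangulated where
  map_distinguished T hT := by
    obtain ⟨x, y, f, ⟨e⟩⟩ := (mem_distTriang_iff T).1 hT
    refine (mem_distTriang_iff _).2 ⟨_, _, G.mapZ0 x y f, ⟨G.mapH0.mapTriangle.mapIso e ≪≫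
      Triangle.isoMk _ _ (Iso.refl _) (Iso.refl _) (G.coneComparisonIso f) ?_ ?_ ?_⟩⟩
    · exact (Category.comp_id _).trans (Category.id_comp _).symm
    · refine Eq.trans ?_ (Category.id_comp _).symm
      refine H0.homMk_congr (f := Z0comp (G.coneComparison f) (G.mapZ0 _ _ (inrZ f)))
        (g := inrZ (G.mapZ0 x y f)) ?_
      simp [tot_map_inrZ]
    · refine (congrArg (_ ≫ ·) ((shiftFunctor (H0 k E) (1 : ℤ)).map_id _)).trans
        ((Category.comp_id _).trans ?_)
      refine (congrArg (fun a => G.mapH0.map (stdTriangle f).mor₃ ≫ a.hom.app (⟨x⟩ : H0 k D))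
        G.commShiftIso_one).trans ?_
      refine H0.homMk_congr (f := Z0comp (G.shComparison x) (G.mapZ0 _ _ (connZ f)))
        (g := Z0comp (connZ (G.mapZ0 x y f)) (G.coneComparison f)) ?_
      simp [tot_map_connZ]

end DGFunctor

/-! ### Partially defined adjoints of dg functors -/

/-- The dg category with a given family of objects of a dg category as objects. -/
structure DGInduced {ι : Type*} {D : Type*} (o : ι → D) where
  idx : ι

namespace DGInduced

variable (k : Type u) [CommRing k] {ι : Type*} {D : Type*} [DGCategory k D] (o : ι → D)

instance : DGCategory k (DGInduced o) where
  Hom x y n := DGCategory.Hom k (o x.idx) (o y.idx) n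
  d p q h := DGCategory.d p q h
  comp h := DGCategory.comp h
  one x := DGCategory.one (o x.idx)
  d_d := DGCategory.d_d
  one_comp := DGCategory.one_comp
  comp_one := DGCategory.comp_one
  assoc := DGCategory.assoc
  leibniz := DGCategory.leibniz

/-- The fully faithful dg functor from an induced dg category. -/
def functor : DGFunctor k (DGInduced o) D where
  obj x := o x.idx
  map := LinearMap.id
  map_d _ _ _ _ := rfl
  map_one _ := rfl
  map_comp _ _ _ := rfl

instance : (functor k o).mapH0.Full :=
  DGFunctor.full_of_bijective _ fun _ _ _ => Function.bijective_id

instance : (functor k o).mapH0.Faithful :=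
  DGFunctor.faithful_of_bijective _ fun _ _ _ => Function.bijective_id

end DGInduced

namespace DGFunctor

variable {k : Type u} [CommRing k] {D D' : Type v} [DGCategory k D] [DGCategory k D']
  (R : DGFunctor k D' D)

/-- An object `X'` together with a universal morphism from `X` to `R(X')`: the partial left adjoint
of the dg functor `R` takes `X` to `X'`. -/
structure Ext where
  X : D
  X' : D'
  u : Z0 k X (R.obj X')
  univ : ∀ (N : D') (n : ℤ), Function.Bijective
    (fun φ : Hom k X' N n => comp (add_zero n) (R.map φ) u.1)

namespace Ext

variable {R}

/-- The morphism `X' ⟶ N` corresponding to a morphism `X ⟶ R(N)`. -/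
noncomputable def lift (S : R.Ext) {N : D'} {n : ℤ} (φ : Hom k S.X (R.obj N) n) :
    Hom k S.X' N n := ((S.univ N n).2 φ).choose

theorem u_lift (S : R.Ext) {N : D'} {n : ℤ} (φ : Hom k S.X (R.obj N) n) :
    tot S.u.1 ≫ tot (R.map (S.lift φ)) = tot φ := by
  rw [← tot_comp (add_zero n)]
  exact congrArg tot ((S.univ N n).2 φ).choose_spec

theorem hom_ext (S : R.Ext) {N : D'} {n : ℤ} {φ ψ : Hom k S.X' N n}
    (h : tot S.u.1 ≫ tot (R.map φ) = tot S.u.1 ≫ tot (R.map ψ)) : φ = ψ :=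
  (S.univ N n).1 (tot_injective (by rwa [tot_comp, tot_comp]))

variable {S T U : R.Ext} {n : ℤ}

/-- The action of the partial left adjoint on morphisms. -/
noncomputable def map (φ : Hom k S.X T.X n) : Hom k S.X' T.X' n :=
  S.lift (comp (zero_add n) T.u.1 φ)

theorem u_map (φ : Hom k S.X T.X n) :
    tot S.u.1 ≫ tot (R.map (map φ)) = tot φ ≫ tot T.u.1 := by
  rw [map, u_lift, tot_comp]

theorem map_eq {φ : Hom k S.X T.X n} {ψ : Hom k S.X' T.X' n}
    (h : tot S.u.1 ≫ tot (R.map ψ) = tot φ ≫ tot T.u.1) : map φ = ψ :=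
  S.hom_ext ((u_map φ).trans h.symm)

theorem u_map_eq (f : Z0 k S.X T.X) (f' : Z0 k S.X' T.X') (hf : map f.1 = f'.1) :
    tot S.u.1 ≫ tot (R.map f'.1) = tot f.1 ≫ tot T.u.1 := by rw [← hf, u_map]

theorem map_smul' (c : k) (φ : Hom k S.X T.X n) : map (c • φ) = c • map φ := by
  refine (S.univ _ n).1 ?_
  change comp _ (R.map (map _)) S.u.1 = comp _ (R.map (c • map _)) S.u.1
  have h : ∀ φ : Hom k S.X T.X n, comp (add_zero n) (R.map (map φ)) S.u.1 =
      comp (zero_add n) T.u.1 φ := fun φ => ((S.univ _ n).2 _).choose_spec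
  rw [h, map_smul, map_smul, map_smul, LinearMap.smul_apply, h]

theorem map_add' (φ ψ : Hom k S.X T.X n) : map (φ + ψ) = map φ + map ψ :=
  map_eq (by simp only [map_add, tot_add, Preadditive.comp_add, Preadditive.add_comp, u_map])

theorem map_d' {m : ℤ} (h : n + 1 = m) (φ : Hom k S.X T.X n) :
    map (d n m h φ) = d n m h (map φ) := map_eq (by
  have e := congrArg δ (u_map φ)
  rw [δ_comp, δ_comp, Z0.δ_tot, Z0.δ_tot, zero_comp, add_zero, comp_zero, zero_add, Z0.ε_tot,
    δ_tot h, δ_tot h] at e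
  rw [R.map_d, e])

theorem map_one' (S : R.Ext) : map (one S.X) = one S.X' :=
  map_eq (by rw [R.map_one, tot_one, tot_one, Category.comp_id, Category.id_comp])

theorem map_comp' {p q : ℤ} (h : p + q = n) (g : Hom k T.X U.X p) (f : Hom k S.X T.X q) :
    map (comp h g f) = comp h (map g) (map f) :=
  map_eq (by rw [tot_map_comp, ← Category.assoc, u_map, Category.assoc, u_map, tot_comp,
    Category.assoc])

variable (R) in
/-- The full dg subcategory on which the partial left adjoint of `R` is given. -/
abbrev Cat := DGInduced (Ext.X : R.Ext → D)

variable (R) in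
/-- The partial left adjoint of `R`. -/
noncomputable def adj : DGFunctor k (Cat R) (D') where
  obj S := S.idx.X'
  map {S T _} :=
    { toFun := fun φ => map (S := S.idx) (T := T.idx) φ
      map_add' := map_add' (S := S.idx) (T := T.idx)
      map_smul' := map_smul' (S := S.idx) (T := T.idx) }
  map_d _ _ h φ := map_d' h φ
  map_one S := map_one' S.idx
  map_comp h g f := map_comp' h g f

section StrictPretr

open StrictPretr

variable [StrictPretr k D] [StrictPretr k D']

variable (R) in
/-- The zero objects correspond to each other. -/
noncomputable def zeroExt : R.Ext where
  X := zero k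
  X' := zero k
  u := 0
  univ N n := by
    have h : ∀ φ : Hom k (zero k : D') N n, φ = 0 := fun φ => by
      rw [← comp_one (add_zero n) φ, one_zero, map_zero]
    have h' : ∀ φ : Hom k (zero k : D) (R.obj N) n, φ = 0 := fun φ => by
      rw [← comp_one (add_zero n) φ, one_zero, map_zero]
    exact ⟨fun φ ψ _ => (h φ).trans (h ψ).symm, fun φ => ⟨0, (h' _).trans (h' φ).symm⟩⟩

/-- The unit at a shift. -/
noncomputable def shUnit (S : R.Ext) (m : ℤ) : Z0 k (sh k S.X m) (R.obj (sh k S.X' m)) :=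
  Z0.mk (comp (neg_add_cancel m) (R.map (σ S.X' m)) (comp (zero_add m) S.u.1 (τ S.X m)))
    (by simp)

theorem tot_shUnit (S : R.Ext) (m : ℤ) : tot (shUnit S m).1 =
    tot (τ S.X m) ≫ tot S.u.1 ≫ tot (R.map (σ S.X' m)) := by
  simp [shUnit, Z0.mk]

/-- The partial left adjoint commutes with shifts. -/
noncomputable def shExt (S : R.Ext) (m : ℤ) : R.Ext where
  X := sh k S.X m
  X' := sh k S.X' m
  u := shUnit S m
  univ N n := by
    constructor
    · intro φ ψ h
      have h := congrArg tot h
      simp only [tot_comp] at h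
      have key : ∀ φ : Hom k (sh k S.X' m) N n,
          tot S.u.1 ≫ tot (R.map (comp (rfl : n + -m = n + -m) φ (σ S.X' m))) =
          tot (σ S.X m) ≫ tot (shUnit S m).1 ≫ tot (R.map φ) := fun φ => by
        simp [tot_map_comp, tot_shUnit]
      have e : comp rfl φ (σ S.X' m) = comp rfl ψ (σ S.X' m) :=
        S.hom_ext ((key φ).trans ((congrArg (_ ≫ ·) h).trans (key ψ).symm))
      have e := congrArg (tot (τ S.X' m) ≫ tot ·) e
      simpa [tot_inj] using e
    · intro φ
      refine ⟨comp (by omega : (n - m) + m = n) (S.lift (comp (by omega) φ (σ S.X m))) (τ S.X' m),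
        tot_injective ?_⟩
      simp [tot_shUnit, tot_map_comp, u_lift]

section

variable (f : Z0 k S.X T.X) (f' : Z0 k S.X' T.X') (hf : map f.1 = f'.1)

/-- The unit at a cone. -/
noncomputable def coneUnit : Z0 k (cone f) (R.obj (cone f')) :=
  Z0.mk (comp (zero_add 0) (R.map (inr f')) (comp (zero_add 0) T.u.1 (snd f)) +
      comp (neg_add_cancel 1) (R.map (inl f')) (comp (zero_add 1) S.u.1 (fst f)))
    (by
      have e := congrArg (tot (fst f) ≫ · ≫ tot (R.map (inr f'))) (u_map_eq f f' hf)
      simp only [Category.assoc] at e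
      simp [e])

theorem tot_coneUnit : tot (coneUnit f f' hf).1 =
    tot (snd f) ≫ tot T.u.1 ≫ tot (R.map (inr f')) +
      tot (fst f) ≫ tot S.u.1 ≫ tot (R.map (inl f')) := by
  simp [coneUnit, Z0.mk]

/-- The partial left adjoint commutes with cones. -/
noncomputable def coneExt : R.Ext where
  X := cone f
  X' := cone f'
  u := coneUnit f f' hf
  univ N n := by
    constructor
    · intro φ ψ h
      have h := congrArg tot h
      simp only [tot_comp] at h
      have key₁ : ∀ φ : Hom k (cone f') N n,
          tot S.u.1 ≫ tot (R.map (comp (rfl : n + -1 = n + -1) φ (inl f'))) =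
          tot (inl f) ≫ tot (coneUnit f f' hf).1 ≫ tot (R.map φ) := fun φ => by
        simp [tot_map_comp, tot_coneUnit]
      have key₂ : ∀ φ : Hom k (cone f') N n,
          tot T.u.1 ≫ tot (R.map (comp (add_zero n) φ (inr f'))) =
          tot (inr f) ≫ tot (coneUnit f f' hf).1 ≫ tot (R.map φ) := fun φ => by
        simp [tot_map_comp, tot_coneUnit]
      have e₁ : comp rfl φ (inl f') = comp rfl ψ (inl f') :=
        S.hom_ext ((key₁ φ).trans ((congrArg (_ ≫ ·) h).trans (key₁ ψ).symm))
      have e₂ : comp (add_zero n) φ (inr f') = comp (add_zero n) ψ (inr f') :=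
        T.hom_ext ((key₂ φ).trans ((congrArg (_ ≫ ·) h).trans (key₂ ψ).symm))
      have e₁ := congrArg tot e₁
      have e₂ := congrArg tot e₂
      rw [tot_comp, tot_comp] at e₁ e₂
      exact tot_injective (from_cone_ext f' e₁ e₂)
    · intro φ
      refine ⟨comp (add_zero n) (T.lift (comp (add_zero n) φ (inr f))) (snd f') +
        comp (by omega : n + -1 + 1 = n) (S.lift (comp rfl φ (inl f))) (fst f'),
        tot_injective (from_cone_ext f ?_ ?_)⟩
      · simp [tot_coneUnit, tot_map_comp, u_lift]
      · simp [tot_coneUnit, tot_map_comp, u_lift]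

end

noncomputable instance : StrictPretr k (Cat R) where
  zero := ⟨zeroExt R⟩
  one_zero := StrictPretr.one_zero (D := D)
  sh S m := ⟨shExt S.idx m⟩
  σ S := StrictPretr.σ S.idx.X
  τ S := StrictPretr.τ S.idx.X
  d_σ S := StrictPretr.d_σ S.idx.X
  d_τ S := StrictPretr.d_τ S.idx.X
  τ_σ S := StrictPretr.τ_σ S.idx.X
  σ_τ S := StrictPretr.σ_τ S.idx.X
  cone {S T} f := ⟨coneExt (S := S.idx) (T := T.idx) f ((adj R).mapZ0 S T f) rfl⟩
  inl {S T} f := StrictPretr.inl (x := S.idx.X) (y := T.idx.X) f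
  inr {S T} f := StrictPretr.inr (x := S.idx.X) (y := T.idx.X) f
  fst {S T} f := StrictPretr.fst (x := S.idx.X) (y := T.idx.X) f
  snd {S T} f := StrictPretr.snd (x := S.idx.X) (y := T.idx.X) f
  d_inl {S T} f := StrictPretr.d_inl (x := S.idx.X) (y := T.idx.X) f
  d_inr {S T} f := StrictPretr.d_inr (x := S.idx.X) (y := T.idx.X) f
  d_fst {S T} f := StrictPretr.d_fst (x := S.idx.X) (y := T.idx.X) f
  d_snd {S T} f := StrictPretr.d_snd (x := S.idx.X) (y := T.idx.X) f
  fst_inl {S T} f := StrictPretr.fst_inl (x := S.idx.X) (y := T.idx.X) f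
  fst_inr {S T} f := StrictPretr.fst_inr (x := S.idx.X) (y := T.idx.X) f
  snd_inl {S T} f := StrictPretr.snd_inl (x := S.idx.X) (y := T.idx.X) f
  snd_inr {S T} f := StrictPretr.snd_inr (x := S.idx.X) (y := T.idx.X) f
  total {S T} f := StrictPretr.total (x := S.idx.X) (y := T.idx.X) f

end StrictPretr

end Ext

end DGFunctor

/-! ### Extension of dg modules along a dg functor -/

namespace DGFunctor

variable {k : Type u} [CommRing k] {A A' : Type u} [DGCategory k A] [DGCategory k A']
  (F : DGFunctor k A A')

open DGMod

/-- The restriction of a module along a dg functor. -/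
def resObj (N : DGMod k A') : DGMod k A where
  X x n := N.X (F.obj x) n
  d p q h := N.d p q h
  act h := (N.act h).compl₂ F.map
  d_d := N.d_d
  act_one h m := (congrArg (N.act h m) (F.map_one _)).trans (N.act_one h m)
  act_act h₁ h₂ h₃ h₄ m a b := (N.act_act h₁ h₂ h₃ h₄ m _ _).trans
    (congrArg (N.act h₄ m) (F.map_comp h₃ a b).symm)
  d_act h hn hp h₁ hq h₂ m a := (N.d_act h hn hp h₁ hq h₂ m _).trans
    (congrArg (fun b => N.act h₁ (N.d _ _ hp m) (F.map a) + _ • N.act h₂ m b)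
      (F.map_d _ _ hq a).symm)

/-- Restriction of modules along a dg functor. -/
def res : DGFunctor k (DGMod k A') (DGMod k A) where
  obj N := F.resObj N
  map {M N n} :=
    { toFun := fun f => (Mor.mk (fun x p q h =>
          (Mor.app f (F.obj x) p q h : M.X (F.obj x) p →ₗ[k] N.X (F.obj x) q)) (by
            intro x w p q r p' r' h hp hr h' m a
            exact Mor.comm f h hp hr h' m (F.map a)) : Mor (F.resObj M) (F.resObj N) n)
      map_add' := fun _ _ => rfl
      map_smul' := fun _ _ => rfl }
  map_d := by
    intro M N p q h f
    subst h
    rfl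
  map_one _ := rfl
  map_comp _ _ _ := rfl

/-- The Yoneda embedding of `A`, as a dg functor to the dg `A`-modules that have an extension along
`F : A → A'`: the extension of `A(-, x)` is `A'(-, F x)`, by the Yoneda lemma. -/
noncomputable def yonedaExt : DGFunctor k A (Ext.Cat F.res) where
  obj x := ⟨{
    X := yonedaObj k x
    X' := yonedaObj k (F.obj x)
    u := ⟨(Mor.mk (fun y p q h => (by
        obtain rfl : p = q := by omega
        exact F.map : Hom k y x p →ₗ[k] Hom k (F.obj y) (F.obj x) q)) (by
          intro y z p q r p' r' h hp hr h' m a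
          obtain rfl : p = p' := by omega
          obtain rfl : r = r' := by omega
          exact F.map_comp _ m a) : Mor (yonedaObj k x) (F.resObj (yonedaObj k (F.obj x))) 0), by
      refine Mor.ext fun y p q h m => ?_
      refine (dMor_app (zero_add 1) _ y h (add_zero p) h h (add_zero q) m).trans ?_
      rw [Int.negOnePow_zero, one_smul]
      exact sub_eq_zero.2 (F.map_d p q h m).symm⟩
    univ := fun N n => (Function.Bijective.of_comp_iff' (app_one_bijective x (F.resObj N) n) _).1
      ((congrArg Function.Bijective (funext fun φ => congrArg (Mor.app φ (F.obj x) 0 n (zero_add n))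
        (F.map_one x))).mpr (app_one_bijective (F.obj x) N n)) }⟩
  map := (yoneda k A).map
  map_d := (yoneda k A).map_d
  map_one := (yoneda k A).map_one
  map_comp := (yoneda k A).map_comp

end DGFunctor

/-! ### Exactness of dg functors between pretriangulated dg categories -/

namespace CategoryTheory.Functor

variable {C E M : Type*} [Category* C] [Category* E] [Category* M]

theorem trans_isoWhiskerLeft_symm_trans {G : C ⥤ M} {F : C ⥤ E} {s S : E ⥤ M} (θ : G ≅ F ⋙ S)
    (ν : s ≅ S) : (θ ≪≫ isoWhiskerLeft F ν.symm) ≪≫ isoWhiskerLeft F ν = θ := by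
  ext; simp

variable [HasShift C ℤ] [HasShift E ℤ] [HasShift M ℤ]
  {y : C ⥤ E} {I : E ⥤ M} {Y : C ⥤ M}

/-- The commutation with shifts of the lift of a functor through a fully faithful functor. -/
noncomputable def liftShiftIso (e : y ⋙ I ≅ Y) [I.Full] [I.Faithful] [I.CommShift ℤ]
    [Y.CommShift ℤ] : shiftFunctor C (1 : ℤ) ⋙ y ≅ y ⋙ shiftFunctor E (1 : ℤ) :=
  NatIso.ofComponents (fun X => I.preimageIso (e.app _ ≪≫ (Y.commShiftIso (1 : ℤ)).app X ≪≫
      (shiftFunctor M (1 : ℤ)).mapIso (e.symm.app X) ≪≫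
      ((I.commShiftIso (1 : ℤ)).symm.app (y.obj X))))
    (fun {X X'} f => I.map_injective (by
      have h₁ := e.hom.naturality (f⟦(1 : ℤ)⟧')
      have h₂ := (Y.commShiftIso (1 : ℤ)).hom.naturality f
      have h₃ := congrArg (·⟦(1 : ℤ)⟧') (e.inv.naturality f)
      have h₄ := (I.commShiftIso (1 : ℤ)).inv.naturality (y.map f)
      dsimp at h₁ h₂ h₃ h₄
      rw [Functor.map_comp, Functor.map_comp] at h₃
      simp [reassoc_of% h₁, reassoc_of% h₂, reassoc_of% h₃, h₄]))

theorem map_liftShiftIso (e : y ⋙ I ≅ Y) [I.Full] [I.Faithful] [I.CommShift ℤ]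
    [Y.CommShift ℤ] (X : C) : I.map ((liftShiftIso e).hom.app X) ≫
      (I.commShiftIso (1 : ℤ)).hom.app (y.obj X) =
    e.hom.app _ ≫ (Y.commShiftIso (1 : ℤ)).hom.app X ≫ (e.inv.app X)⟦(1 : ℤ)⟧' := by
  simp [liftShiftIso]

variable [HasZeroObject C] [HasZeroObject E] [HasZeroObject M] [Preadditive C] [Preadditive E]
  [Preadditive M] [∀ n : ℤ, (shiftFunctor C n).Additive] [∀ n : ℤ, (shiftFunctor E n).Additive]
  [∀ n : ℤ, (shiftFunctor M n).Additive] [Pretriangulated C] [Pretriangulated E]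
  [Pretriangulated M]

/-- The lift of an exact functor through a fully faithful exact functor is exact. -/
theorem exists_isTriangulated_of_comp (e : y ⋙ I ≅ Y) [I.Full] [I.Faithful] [I.CommShift ℤ]
    [I.IsTriangulated] [Y.CommShift ℤ] [Y.IsTriangulated] :
    ∃ _ : y.CommShift ℤ, y.IsTriangulated := by
  obtain ⟨c, hc⟩ := exists_commShift_of_iso (liftShiftIso e)
  refine ⟨c, ⟨fun T hT => ?_⟩⟩
  rw [← I.map_distinguished_iff]
  refine isomorphic_distinguished _ (Y.map_distinguished T hT) _
    (Triangle.isoMk _ _ (e.app _) (e.app _) (e.app _) (e.hom.naturality _) (e.hom.naturality _) ?_)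
  have h₁ := e.hom.naturality T.mor₃
  have h₂ := map_liftShiftIso e T.obj₁
  change (I.map (y.map T.mor₃ ≫ (y.commShiftIso (1 : ℤ)).hom.app T.obj₁) ≫
    (I.commShiftIso (1 : ℤ)).hom.app (y.obj T.obj₁)) ≫ (e.hom.app T.obj₁)⟦(1 : ℤ)⟧' =
    e.hom.app T.obj₃ ≫ Y.map T.mor₃ ≫ (Y.commShiftIso (1 : ℤ)).hom.app T.obj₁
  dsimp at h₁
  rw [hc, Functor.map_comp, Category.assoc, Category.assoc, reassoc_of% h₂, reassoc_of% h₁]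
  simp [← Functor.map_comp]

end CategoryTheory.Functor

section

open DGMod

-- Compositions in homotopy categories are compared factor by factor, not by representatives.
attribute [local irreducible] H0comp

section

variable {k : Type u} [CommRing k] {A : Type u} [DGCategory k A]

variable (k A) in
/-- A triangulated structure on `H⁰(A)` for which the Yoneda embedding is exact. -/
def YonedaExact [HasShift (H0 k A) ℤ] [HasZeroObject (H0 k A)]
    [∀ n : ℤ, (shiftFunctor (H0 k A) n).Additive] [Pretriangulated (H0 k A)] : Prop :=
  ∃ _ : (yoneda k A).mapH0.CommShift ℤ, (yoneda k A).mapH0.IsTriangulated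

theorem CanonicalTriangulation.yonedaExact (S : CanonicalTriangulation k A) :
    @YonedaExact k _ A _ S.hasShift S.hasZeroObject S.shiftAdditive S.pretriangulated := by
  obtain @⟨h₁, h₂, h₃, h₄, h₅, θ, h⟩ := S
  obtain ⟨c, hc⟩ := Functor.exists_commShift_of_iso
    (θ ≪≫ Functor.isoWhiskerLeft (yoneda k A).mapH0 shiftIsoSusp.symm)
  refine ⟨c, ⟨fun T hT => ?_⟩⟩
  refine (yoneda_mapTriangle_distinguished_iff T).2 ?_
  rw [hc, Functor.trans_isoWhiskerLeft_symm_trans]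
  exact (h T).1 hT

end

namespace DGFunctor

variable {k : Type u} [CommRing k] {A A' : Type u} [DGCategory k A] [DGCategory k A']
  (F : DGFunctor k A A')

/-- The Yoneda embedding factors through the modules that have an extension along `F`. -/
noncomputable def yonedaExtCompIso :
    F.yonedaExt.mapH0 ⋙ (DGInduced.functor k (Ext.X : F.res.Ext → _)).mapH0 ≅
      (yoneda k A).mapH0 :=
  NatIso.ofComponents (fun X => Iso.refl (⟨yonedaObj k X.obj⟩ : H0 k (DGMod k A)))
    (fun {X Y} f => by
      obtain ⟨f, rfl⟩ := H0.homMk_surjective f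
      refine (Category.comp_id _).trans (Eq.trans ?_ (Category.id_comp _).symm)
      rfl)

theorem tot_comp_eq {D : Type*} [DGCategory k D] {x y y' z : D} {p q p' q' n : ℤ} {h : p + q = n}
    {h' : p' + q' = n} {g : Hom k y z p} {f : Hom k x y q} {g' : Hom k y' z p'} {f' : Hom k x y' q'}
    (e : comp h g f = comp h' g' f') : tot f ≫ tot g = tot f' ≫ tot g' := by
  rw [← tot_comp h, e, tot_comp]

theorem adj_map_yonedaExt {x y : A} {n : ℤ} (f : Hom k x y n) :
    (Ext.adj F.res).map (F.yonedaExt.map f) = (yoneda k A').map (F.map f) :=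
  Ext.map_eq (S := (F.yonedaExt.obj x).idx) (T := (F.yonedaExt.obj y).idx) (by
    refine tot_comp_eq (h := add_zero n) (h' := zero_add n) ?_
    refine Mor.ext fun w p q h m => ?_
    refine (compMor_app (add_zero n) _ _ w h (add_zero p) h m).trans
      (Eq.trans ?_ (compMor_app (zero_add n) _ _ w h h (add_zero q) m).symm)
    exact (F.map_comp _ f m).symm)

/-- Extension along `F` sends `A(-, x)` to `A'(-, F x)`, naturally in `x`. -/
noncomputable def yonedaExtAdjIso : F.mapH0 ⋙ (yoneda k A').mapH0 ≅
    F.yonedaExt.mapH0 ⋙ (Ext.adj F.res).mapH0 :=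
  NatIso.ofComponents (fun X => Iso.refl (⟨yonedaObj k (F.obj X.obj)⟩ : H0 k (DGMod k A')))
    (fun {X Y} f => by
      obtain ⟨f, rfl⟩ := H0.homMk_surjective f
      refine (Category.comp_id _).trans (Eq.trans ?_ (Category.id_comp _).symm)
      exact congrArg H0.homMk (Subtype.ext (F.adj_map_yonedaExt f.1).symm))

/-- A dg functor induces an exact functor between homotopy categories, for any triangulated
structures for which the Yoneda embeddings are exact.  Both the inclusion of the modules that have
an extension along `F` and the extension functor are exact, so that the composite of `F` with the
Yoneda embedding of `A'` is exact, and hence so is `F`. -/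
theorem exists_isTriangulated
    [HasShift (H0 k A) ℤ] [HasZeroObject (H0 k A)] [∀ n : ℤ, (shiftFunctor (H0 k A) n).Additive]
    [Pretriangulated (H0 k A)] (hA : YonedaExact k A)
    [HasShift (H0 k A') ℤ] [HasZeroObject (H0 k A')] [∀ n : ℤ, (shiftFunctor (H0 k A') n).Additive]
    [Pretriangulated (H0 k A')] (hA' : YonedaExact k A') :
    ∃ _ : F.mapH0.CommShift ℤ, F.mapH0.IsTriangulated := by
  obtain ⟨_, _⟩ := hA
  obtain ⟨_, _⟩ := hA'
  obtain ⟨_, _⟩ := Functor.exists_isTriangulated_of_comp F.yonedaExtCompIso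
  exact Functor.exists_isTriangulated_of_comp F.yonedaExtAdjIso

/-- If `A` is pretriangulated, then the modules `A'(-, F z)` are closed under cones of morphisms in
the image of `F`. -/
theorem exists_iso_cone (hA : IsPretriangulatedDG k A) {x y : A} (f : Z0 k x y) :
    ∃ z : A, Nonempty ((⟨yonedaObj k (F.obj z)⟩ : H0 k (DGMod k A')) ≅
      ⟨cone ((yoneda k A').mapZ0 _ _ (F.mapZ0 x y f))⟩) := by
  obtain ⟨z, ⟨e⟩⟩ := (isPretriangulatedDG_iff k A).1 hA _
    (.cone ((yoneda k A).mapZ0 _ _ f) (.yoneda x) (.yoneda y))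
  let e' : (⟨F.yonedaExt.obj z⟩ : H0 k (Ext.Cat F.res)) ≅
      ⟨StrictPretr.cone (F.yonedaExt.mapZ0 x y f)⟩ :=
    (DGInduced.functor k (Ext.X : F.res.Ext → _)).mapH0.preimageIso e
  have h : (Ext.adj F.res).mapZ0 _ _ (F.yonedaExt.mapZ0 x y f) =
      (yoneda k A').mapZ0 _ _ (F.mapZ0 x y f) := Subtype.ext (F.adj_map_yonedaExt f.1)
  refine ⟨z, ⟨(Ext.adj F.res).mapH0.mapIso e' ≪≫ eqToIso ?_⟩⟩
  exact congrArg (fun g : Z0 k (yonedaObj k (F.obj x)) (yonedaObj k (F.obj y)) =>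
    (⟨cone g⟩ : H0 k (DGMod k A'))) h

/-- If `A` is pretriangulated, then the modules `A'(-, F z)` are closed under shifts. -/
theorem exists_iso_shift (hA : IsPretriangulatedDG k A) (x : A) (n : ℤ) :
    ∃ z : A, Nonempty ((⟨yonedaObj k (F.obj z)⟩ : H0 k (DGMod k A')) ≅
      ⟨(yonedaObj k (F.obj x)).shift n⟩) := by
  obtain ⟨⟨z⟩, ⟨e⟩⟩ := exists_yoneda_shift hA n ⟨x⟩
  let e' : (⟨F.yonedaExt.obj z⟩ : H0 k (Ext.Cat F.res)) ≅
      ⟨StrictPretr.sh k (F.yonedaExt.obj x) n⟩ :=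
    (DGInduced.functor k (Ext.X : F.res.Ext → _)).mapH0.preimageIso e
  exact ⟨z, ⟨(Ext.adj F.res).mapH0.mapIso e'⟩⟩

theorem exists_iso_zero (hA : IsPretriangulatedDG k A) :
    ∃ z : A, Nonempty ((⟨yonedaObj k (F.obj z)⟩ : H0 k (DGMod k A')) ≅ ⟨DGMod.zero k A'⟩) := by
  obtain ⟨z, ⟨e⟩⟩ := (isPretriangulatedDG_iff k A).1 hA _ .zero
  let e' : (⟨F.yonedaExt.obj z⟩ : H0 k (Ext.Cat F.res)) ≅ ⟨StrictPretr.zero k⟩ :=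
    (DGInduced.functor k (Ext.X : F.res.Ext → _)).mapH0.preimageIso e
  exact ⟨z, ⟨(Ext.adj F.res).mapH0.mapIso e'⟩⟩

end DGFunctor

section

variable {k : Type u} [CommRing k] {A : Type u} [DGCategory k A] (P : A → Prop)

theorem H0.sub_eq_essImage : H0.sub k P = (DGFull.incl k P).mapH0.essImage := by
  ext X
  constructor
  · rintro ⟨Y, hY, ⟨e⟩⟩
    exact ⟨⟨⟨Y.obj, hY⟩⟩, ⟨e.symm⟩⟩
  · rintro ⟨Y, ⟨e⟩⟩
    exact ⟨_, Y.obj.2, ⟨e.symm⟩⟩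

/-- The objects isomorphic to objects of a pretriangulated full dg subcategory form a triangulated
subcategory, as the essential image of a full exact functor. -/
theorem H0.isTriangulated_sub [HasShift (H0 k A) ℤ] [HasZeroObject (H0 k A)]
    [∀ n : ℤ, (shiftFunctor (H0 k A) n).Additive] [Pretriangulated (H0 k A)]
    (hA : YonedaExact k A) (hB : IsPretriangulatedDG k (DGFull P)) :
    (H0.sub k P).IsTriangulated := by
  obtain ⟨S⟩ := nonempty_canonicalTriangulation hB
  let := S.hasShift
  let := S.hasZeroObject
  let := S.shiftAdditive
  let := S.pretriangulated
  obtain ⟨_, _⟩ := (DGFull.incl k P).exists_isTriangulated S.yonedaExact hA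
  rw [H0.sub_eq_essImage]
  infer_instance

end

end

/-! ### Killing the cohomology of a complex by attaching cells -/

/-- A family of complexes of `k`-modules, indexed by the elements of `A`. -/
structure CxFam (k : Type u) [CommRing k] (A : Type u) where
  X : A → ℤ → Type u
  [addCommGroup : ∀ U p, AddCommGroup (X U p)]
  [module : ∀ U p, Module k (X U p)]
  d : ∀ {U : A} (p q : ℤ), p + 1 = q → (X U p →ₗ[k] X U q)
  d_d : ∀ {U : A} (p q r : ℤ) (h : p + 1 = q) (h' : q + 1 = r) (c : X U p),
    d q r h' (d p q h c) = 0

namespace CxFam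

attribute [instance] CxFam.addCommGroup CxFam.module

variable {k : Type u} [CommRing k] {A : Type u} (C : CxFam k A)

/-- Formal cells: a cell of degree `p` is a tentative boundary `c + ∑ rᵢ eᵢ` of degree `p + 1`,
with `c` in the given complex and cells `eᵢ`.  As the cells of all stages are generated at once, a
single application of the construction makes the complex acyclic. -/
inductive Cell (U : A) : ℤ → Type u
  | mk {p : ℤ} (c : C.X U (p + 1)) (n : ℕ) (r : Fin n → k) (e : Fin n → Cell U (p + 1)) : Cell U p

namespace Cell

variable {C} {U : A}

/-- The number of stages needed to attach a cell. -/
def rank : ∀ {p : ℤ}, Cell C U p → ℕ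
  | _, mk _ _ _ e => Finset.univ.sup fun i => (e i).rank + 1

open scoped Classical in
/-- The boundary of a cell.  It is the tentative boundary if that is closed, and zero otherwise. -/
noncomputable def bd : ∀ {p : ℤ}, Cell C U p → C.X U (p + 1) × (Cell C U (p + 1) →₀ k)
  | _, mk c _ r e =>
    if C.d _ _ rfl c + ∑ i, r i • (e i).bd.1 = 0 ∧ ∑ i, r i • (e i).bd.2 = 0 then
      (c, ∑ i, r i • Finsupp.single (e i) 1) else 0

end Cell

/-- The differential of the complex with all cells attached. -/
noncomputable def cellD (U : A) (p : ℤ) :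
    C.X U p × (Cell C U p →₀ k) →ₗ[k] C.X U (p + 1) × (Cell C U (p + 1) →₀ k) :=
  LinearMap.coprod (LinearMap.inl k _ _ ∘ₗ C.d p (p + 1) rfl)
    (Finsupp.linearCombination k Cell.bd)

variable {C}

theorem cellD_single {U : A} {p : ℤ} (e : Cell C U p) :
    C.cellD U p (0, Finsupp.single e 1) = e.bd := by
  simp [cellD]

theorem cellD_inl {U : A} {p : ℤ} (c : C.X U p) :
    C.cellD U p (c, 0) = (C.d p (p + 1) rfl c, 0) := by
  simp [cellD]

theorem cellD_sum {U : A} {p : ℤ} (c : C.X U p) {n : ℕ} (r : Fin n → k) (e : Fin n → Cell C U p) :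
    C.cellD U p (c, ∑ i, r i • Finsupp.single (e i) 1) =
      (C.d p (p + 1) rfl c + ∑ i, r i • (e i).bd.1, ∑ i, r i • (e i).bd.2) := by
  simp only [cellD, LinearMap.coprod_apply, LinearMap.comp_apply, LinearMap.inl_apply, map_sum,
    map_smul, Finsupp.linearCombination_single, one_smul]
  ext
  · simp [Prod.fst_sum]
  · simp [Prod.snd_sum]

theorem cellD_bd {U : A} {p : ℤ} (e : Cell C U p) : C.cellD U (p + 1) e.bd = 0 := by
  cases e with
  | mk c n r e =>
    rw [Cell.bd]
    split_ifs with h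
    · rw [cellD_sum, h.1, h.2]; rfl
    · exact map_zero _

theorem cellD_cellD {U : A} {p : ℤ} (v : C.X U p × (Cell C U p →₀ k)) :
    C.cellD U (p + 1) (C.cellD U p v) = 0 := by
  have h : C.cellD U (p + 1) ∘ₗ C.cellD U p = 0 := by
    refine LinearMap.prod_ext (LinearMap.ext fun c => ?_) (Finsupp.lhom_ext' fun e =>
      LinearMap.ext_ring ?_)
    · change C.cellD U (p + 1) (C.cellD U p (c, 0)) = 0
      rw [cellD_inl, cellD_inl, C.d_d]; rfl
    · change C.cellD U (p + 1) (C.cellD U p (0, Finsupp.single e 1)) = 0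
      rw [cellD_single, cellD_bd]
  exact LinearMap.congr_fun h v

/-- Every closed element is the boundary of a cell. -/
theorem exists_cell {U : A} {p : ℤ} (v : C.X U (p + 1) × (Cell C U (p + 1) →₀ k))
    (hv : C.cellD U (p + 1) v = 0) : ∃ e : Cell C U p, e.bd = v := by
  obtain ⟨c, w⟩ := v
  let f := w.support.equivFin.symm
  have hw : w = ∑ i, w (f i).1 • Finsupp.single (f i).1 1 := by
    rw [Equiv.sum_comp f (fun j => w j.1 • Finsupp.single j.1 (1 : k)),
      Finset.sum_coe_sort w.support (fun j => w j • Finsupp.single j (1 : k))]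
    simpa [Finsupp.sum] using (Finsupp.sum_single w).symm
  refine ⟨Cell.mk c _ (fun i => w (f i).1) (fun i => (f i).1), ?_⟩
  rw [hw, cellD_sum] at hv
  rw [Cell.bd, if_pos ⟨congrArg Prod.fst hv, congrArg Prod.snd hv⟩, ← hw]

open scoped Classical in
theorem Cell.rank_lt {U : A} {p : ℤ} (e : Cell C U p) {e' : Cell C U (p + 1)}
    (h : e' ∈ e.bd.2.support) : e'.rank < e.rank := by
  cases e with
  | mk c n r e =>
    rw [Cell.bd] at h
    split_ifs at h with hc
    · obtain ⟨i, -, hi⟩ := Finset.mem_biUnion.1 (Finsupp.support_finsetSum h)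
      have hi := Finsupp.support_single_subset (Finsupp.support_smul hi)
      rw [Finset.mem_singleton] at hi
      subst hi
      rw [Cell.rank]
      exact Nat.lt_of_succ_le (Finset.le_sup (f := fun i => (e i).rank + 1) (Finset.mem_univ i))
    · simp at h

variable (C) in
/-- The complexes obtained by attaching all cells; they are acyclic. -/
noncomputable def cellular : CxFam k A where
  X U p := C.X U p × (Cell C U p →₀ k)
  d p q h := h ▸ C.cellD _ p
  d_d p q r h h' c := by subst h h'; exact cellD_cellD c

theorem exists_of_cellular_d_eq_zero {U : A} {p q r : ℤ} (h : p + 1 = q) (h' : q + 1 = r)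
    (v : C.cellular.X U q) (hv : C.cellular.d q r h' v = 0) : ∃ w, C.cellular.d p q h w = v := by
  subst h h'
  obtain ⟨e, he⟩ := exists_cell v hv
  exact ⟨(0, Finsupp.single e 1), (cellD_single e).trans he⟩

end CxFam

/-! ### Bar complexes -/

namespace CxFam

open DGQuot

variable {k : Type u} [CommRing k] {A : Type u} [DGCategory k A] {P : A → Prop}

variable (P) in
/-- The degree `m` part of `⨁_U C(U) ⊗ kε_U ⊗ A(x, U)`, where `U` runs over the objects
satisfying `P`. -/
abbrev Bar (C : CxFam k A) (x : A) (m : ℤ) : Type u :=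
  ⨁ i : Idx P m, C.X i.U i.p ⊗[k] Hom k x i.U i.q

variable {C C' : CxFam k A} {x : A} {m : ℤ}

/-- The element `c ⊗ ε_U ⊗ a`. -/
noncomputable def el {U : A} (hU : P U) {p q : ℤ} (h : p + q = m + 1) :
    C.X U p →ₗ[k] Hom k x U q →ₗ[k] Bar P C x m :=
  (TensorProduct.mk k (C.X U p) (Hom k x U q)).compr₂
    (DirectSum.lof k (Idx P m) (fun i => C.X i.U i.p ⊗[k] Hom k x i.U i.q) ⟨U, hU, p, q, h⟩)

/-- Linear maps out of a bar complex. -/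
noncomputable def barLift {V : Type*} [AddCommGroup V] [Module k V]
    (f : ∀ (U : A) (_ : P U) (p q : ℤ) (_ : p + q = m + 1),
      C.X U p →ₗ[k] Hom k x U q →ₗ[k] V) : Bar P C x m →ₗ[k] V :=
  DirectSum.toModule k (Idx P m) V fun i => TensorProduct.lift (f i.U i.hU i.p i.q i.h)

theorem barLift_el {V : Type*} [AddCommGroup V] [Module k V]
    (f : ∀ (U : A) (_ : P U) (p q : ℤ) (_ : p + q = m + 1),
      C.X U p →ₗ[k] Hom k x U q →ₗ[k] V) {U : A} (hU : P U) {p q : ℤ} (h : p + q = m + 1)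
    (c : C.X U p) (a : Hom k x U q) : barLift f (el hU h c a) = f U hU p q h c a := by
  refine (DirectSum.toModule_lof k (M := fun i : Idx P m => C.X i.U i.p ⊗[k] Hom k x i.U i.q)
    (⟨U, hU, p, q, h⟩ : Idx P m) (c ⊗ₜ[k] a)).trans ?_
  exact TensorProduct.lift.tmul _ _

theorem bar_induction {motive : Bar P C x m → Prop} (t : Bar P C x m) (h0 : motive 0)
    (hadd : ∀ t t', motive t → motive t' → motive (t + t'))
    (hel : ∀ (U : A) (hU : P U) (p q : ℤ) (h : p + q = m + 1) (c : C.X U p) (a : Hom k x U q),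
      motive (el hU h c a)) : motive t := by
  induction t using DirectSum.induction_on with
  | zero => exact h0
  | add t t' ht ht' => exact hadd t t' ht ht'
  | of i t =>
    induction t using TensorProduct.induction_on with
    | zero =>
      have e := map_zero (DirectSum.lof k (Idx P m) (fun i => C.X i.U i.p ⊗[k] Hom k x i.U i.q) i)
      exact e ▸ h0
    | add v w hv hw =>
      have e := map_add
        (DirectSum.lof k (Idx P m) (fun i => C.X i.U i.p ⊗[k] Hom k x i.U i.q) i) v w
      exact e ▸ hadd _ _ hv hw
    | tmul c a => exact hel i.U i.hU i.p i.q i.h c a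

/-- The differential `d(c ε_U a) = d(c) ε_U a - (-1)^|c| c ε_U d(a)` of the bar complex; the sign of
the second term comes from the degree `-1` of `ε_U`.  The term `(-1)^|c| c a` of the dg quotient,
which has one `ε` less, is left out. -/
noncomputable def barD (m n : ℤ) (h : m + 1 = n) : Bar P C x m →ₗ[k] Bar P C x n :=
  barLift fun U hU p q hpq =>
    LinearMap.mk₂ k (fun c a =>
        (el hU (by omega : p + 1 + q = n + 1) (C.d p (p + 1) rfl c) a : Bar P C x n) -
          p.negOnePow • el hU (by omega : p + (q + 1) = n + 1) c (DGCategory.d q (q + 1) rfl a))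
      (fun c c' a => by
        simp only [map_add, LinearMap.add_apply, smul_add]
        abel)
      (fun r c a => by
        simp only [map_smul, LinearMap.smul_apply, smul_sub, smul_comm r])
      (fun c a a' => by
        simp only [map_add, smul_add]
        abel)
      (fun r c a => by
        simp only [map_smul, smul_sub, smul_comm r])

theorem barD_el {U : A} (hU : P U) {p q p' q' n : ℤ} (hpq : p + q = m + 1) (h : m + 1 = n)
    (hp : p + 1 = p') (hq : q + 1 = q') (h₁ : p' + q = n + 1) (h₂ : p + q' = n + 1)
    (c : C.X U p) (a : Hom k x U q) :
    barD m n h (el hU hpq c a : Bar P C x m) = el hU h₁ (C.d p p' hp c) a -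
      p.negOnePow • el hU h₂ c (DGCategory.d q q' hq a) := by
  subst hp hq
  unfold barD
  rw [barLift_el]
  rfl

theorem barD_barD {n l : ℤ} (h : m + 1 = n) (h' : n + 1 = l) (t : Bar P C x m) :
    barD n l h' (barD m n h t) = 0 := by
  induction t using bar_induction with
  | h0 => simp
  | hadd t t' ht ht' => simp only [map_add, ht, ht', add_zero]
  | hel U hU p q hpq c a =>
    rw [barD_el hU hpq h rfl rfl (by omega) (by omega), map_sub, DGMod.map_units_smul_int,
      barD_el hU _ h' rfl rfl (by omega) (by omega), barD_el hU _ h' rfl rfl (by omega) (by omega),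
      C.d_d, DGCategory.d_d, map_zero, map_zero, DGMod.smul_negOnePow_succ]
    simp

/-- The right action of a morphism of degree zero on the bar complex. -/
noncomputable def barAct {x' : A} (s : Hom k x' x 0) : Bar P C x m →ₗ[k] Bar P C x' m :=
  barLift fun _ hU _ q hpq =>
    (el hU hpq).compl₂ ((DGCategory.comp (k := k) (add_zero q)).flip s)

theorem barAct_el {x' U : A} (s : Hom k x' x 0) (hU : P U) {p q : ℤ} (hpq : p + q = m + 1)
    (c : C.X U p) (a : Hom k x U q) :
    barAct s (el hU hpq c a : Bar P C x m) = el hU hpq c (DGCategory.comp (add_zero q) a s) := by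
  unfold barAct
  rw [barLift_el]
  rfl

theorem d_comp_Z0 {D : Type*} [DGCategory k D] {x x' y : D} {q q' : ℤ} (h : q + 1 = q')
    (a : Hom k x y q) (s : Z0 k x' x) :
    DGCategory.d q q' h (DGCategory.comp (add_zero q) a s.1) =
      DGCategory.comp (add_zero q') (DGCategory.d q q' h a) s.1 :=
  tot_injective (by rw [← δ_tot h, tot_comp, tot_comp, δ_comp, Z0.δ_tot, zero_comp, add_zero,
    δ_tot h])

theorem barD_barAct {x' : A} (s : Z0 k x' x) {n : ℤ} (h : m + 1 = n) (t : Bar P C x m) :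
    barD m n h (barAct s.1 t) = barAct s.1 (barD m n h t) := by
  induction t using bar_induction with
  | h0 => simp
  | hadd t t' ht ht' => simp only [map_add, ht, ht']
  | hel U hU p q hpq c a =>
    rw [barAct_el, barD_el hU hpq h rfl rfl (by omega) (by omega),
      barD_el hU hpq h rfl rfl (by omega) (by omega), map_sub, DGMod.map_units_smul_int,
      barAct_el, barAct_el, d_comp_Z0]

theorem barAct_comp {x' x'' : A} (s : Hom k x' x 0) (s' : Hom k x'' x' 0) (t : Bar P C x m) :
    barAct (DGCategory.comp (zero_add 0) s s') t = barAct s' (barAct s t) := by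
  induction t using bar_induction with
  | h0 => simp
  | hadd t t' ht ht' => simp only [map_add, ht, ht']
  | hel U hU p q hpq c a =>
    rw [barAct_el, barAct_el, barAct_el, DGCategory.assoc (add_zero q) (add_zero q) _ (add_zero q)]

theorem barAct_one (t : Bar P C x m) : barAct (DGCategory.one x) t = t := by
  induction t using bar_induction with
  | h0 => simp
  | hadd t t' ht ht' => simp only [map_add, ht, ht']
  | hel U hU p q hpq c a => rw [barAct_el, DGCategory.comp_one]

/-- Functoriality of bar complexes in the coefficients. -/
noncomputable def barMap (f : ∀ U p, C.X U p →ₗ[k] C'.X U p) :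
    Bar P C x m →ₗ[k] Bar P C' x m :=
  barLift fun U hU p _ hpq => (el hU hpq) ∘ₗ f U p

theorem barMap_el (f : ∀ U p, C.X U p →ₗ[k] C'.X U p) {U : A} (hU : P U) {p q : ℤ}
    (hpq : p + q = m + 1) (c : C.X U p) (a : Hom k x U q) :
    barMap f (el hU hpq c a : Bar P C x m) = el hU hpq (f U p c) a := by
  unfold barMap
  rw [barLift_el]
  rfl

end CxFam

/-! ### Bar complexes with acyclic coefficients -/

namespace CxFam

open DGQuot

variable {k : Type u} [CommRing k] {A : Type u} {P : A → Prop}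

/-- A member of a family of complexes, as a cochain complex. -/
def toComplex (C : CxFam k A) (U : A) : CochainComplex (ModuleCat.{u} k) ℤ where
  X p := ModuleCat.of k (C.X U p)
  d p q := if h : p + 1 = q then ModuleCat.ofHom (C.d p q h) else 0
  shape p q h := dif_neg h
  d_comp_d' p q r h h' := by
    have h1 : p + 1 = q := h
    have h2 : q + 1 = r := h'
    rw [dif_pos h1, dif_pos h2]
    ext c
    exact C.d_d _ _ _ h1 h2 c

theorem toComplex_d (C : CxFam k A) {U : A} {p q : ℤ} (h : p + 1 = q) (c : C.X U p) :
    ((C.toComplex U).d p q).hom c = C.d p q h c := by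
  dsimp only [toComplex]
  rw [dif_pos h]
  rfl

theorem toComplex_acyclic (C : CxFam k A) (U : A)
    (hC : ∀ (p q r : ℤ) (h : p + 1 = q) (h' : q + 1 = r) (c : C.X U q), C.d q r h' c = 0 →
      ∃ b, C.d p q h b = c) : (C.toComplex U).Acyclic := by
  intro p
  rw [HomologicalComplex.exactAt_iff' _ (p - 1) p (p + 1) (by simp) (by simp),
    ShortComplex.moduleCat_exact_iff]
  intro c hc
  obtain ⟨b, hb⟩ := hC (p - 1) p (p + 1) (by omega) rfl c ((toComplex_d C rfl c).symm.trans hc)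
  exact ⟨b, (toComplex_d C (by omega) b).trans hb⟩

variable [DGCategory k A]

theorem homComplex_d {x y : A} {p q : ℤ} (h : p + 1 = q) (a : Hom k x y p) :
    ((homComplex k x y).d p q).hom a = DGCategory.d p q h a := by
  dsimp only [homComplex]
  rw [dif_pos h]
  rfl

variable (k) in
/-- The tensor product complex `C(U) ⊗ A(x, U)`. -/
noncomputable abbrev tens (C : CxFam k A) (x U : A) : CochainComplex (ModuleCat.{u} k) ℤ :=
  HomologicalComplex.tensorObj (C.toComplex U) (homComplex k x U)

variable {C : CxFam k A} {x U : A}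

/-- The element `c ⊗ a` of the tensor product complex. -/
noncomputable def tensEl {p q n : ℤ} (h : p + q = n) :
    C.X U p →ₗ[k] Hom k x U q →ₗ[k] (tens k C x U).X n :=
  (TensorProduct.mk k (C.X U p) (Hom k x U q)).compr₂
    (HomologicalComplex.ιTensorObj (C.toComplex U) (homComplex k x U) p q n h).hom

theorem tens_d_tensEl {p q n p' q' n' : ℤ} (h : p + q = n) (hp : p + 1 = p')
    (hq : q + 1 = q') (h₁ : p' + q = n') (h₂ : p + q' = n') (c : C.X U p) (a : Hom k x U q) :
    ((tens k C x U).d n n').hom (tensEl h c a) =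
      tensEl h₁ (C.d p p' hp c) a + p.negOnePow • tensEl h₂ c (DGCategory.d q q' hq a) := by
  have e : HomologicalComplex.ιTensorObj (C.toComplex U) (homComplex k x U) p q n h ≫
      (tens k C x U).d n n' =
      MonoidalCategory.whiskerRight ((C.toComplex U).d p p') ((homComplex k x U).X q) ≫
        HomologicalComplex.ιTensorObj (C.toComplex U) (homComplex k x U) p' q n' h₁ +
      p.negOnePow • (MonoidalCategory.whiskerLeft ((C.toComplex U).X p)
        ((homComplex k x U).d q q') ≫
        HomologicalComplex.ιTensorObj (C.toComplex U) (homComplex k x U) p q' n' h₂) := by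
    rw [HomologicalComplex.mapBifunctor.d_eq, Preadditive.comp_add,
      HomologicalComplex.mapBifunctor.ι_D₁, HomologicalComplex.mapBifunctor.ι_D₂,
      HomologicalComplex.mapBifunctor.d₁_eq _ _ _ _ (show (ComplexShape.up ℤ).Rel p p' from hp)
        _ _ h₁,
      HomologicalComplex.mapBifunctor.d₂_eq _ _ _ _ _ (show (ComplexShape.up ℤ).Rel q q' from hq)
        _ h₂]
    congr 1
    exact one_smul _ _
  have e' := congrArg (fun f => f.hom (c ⊗ₜ[k] a)) e
  refine e'.trans ?_
  have e1 : ((C.toComplex U).d p p').hom c = C.d p p' hp c := toComplex_d C hp c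
  have e2 : ((homComplex k x U).d q q').hom a = DGCategory.d q q' hq a := homComplex_d hq a
  rw [← e1, ← e2]
  rfl

/-- Linear maps out of the tensor product complex. -/
noncomputable def tensLift {V : Type u} [AddCommGroup V] [Module k V] {n : ℤ}
    (f : ∀ p q : ℤ, p + q = n → (C.X U p →ₗ[k] Hom k x U q →ₗ[k] V)) :
    (tens k C x U).X n →ₗ[k] V :=
  (HomologicalComplex.mapBifunctorDesc (A := ModuleCat.of k V)
    (fun p q h => ModuleCat.ofHom (TensorProduct.lift (f p q h)))).hom

theorem tensLift_tensEl {V : Type u} [AddCommGroup V] [Module k V] {n : ℤ}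
    (f : ∀ p q : ℤ, p + q = n → (C.X U p →ₗ[k] Hom k x U q →ₗ[k] V)) {p q : ℤ} (h : p + q = n)
    (c : C.X U p) (a : Hom k x U q) : tensLift f (tensEl h c a) = f p q h c a := by
  have e := HomologicalComplex.ι_mapBifunctorDesc (K₁ := C.toComplex U) (K₂ := homComplex k x U)
    (A := ModuleCat.of k V) (F := MonoidalCategory.curriedTensor (ModuleCat k))
    (c := ComplexShape.up ℤ) (j := n)
    (fun p q h => ModuleCat.ofHom (TensorProduct.lift (f p q h))) p q h
  refine (congrArg (fun g => g.hom (c ⊗ₜ[k] a)) e).trans ?_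
  exact TensorProduct.lift.tmul _ _

theorem tens_hom_ext {V : Type u} [AddCommGroup V] [Module k V] {n : ℤ}
    {f g : (tens k C x U).X n →ₗ[k] V}
    (h : ∀ (p q : ℤ) (h : p + q = n) (c : C.X U p) (a : Hom k x U q),
      f (tensEl h c a) = g (tensEl h c a)) : f = g := by
  have e : (ModuleCat.ofHom f : (tens k C x U).X n ⟶ ModuleCat.of k V) = ModuleCat.ofHom g := by
    refine HomologicalComplex.mapBifunctor.hom_ext fun p q hpq => ?_
    refine ModuleCat.hom_ext (TensorProduct.ext' fun c a => h p q hpq c a)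
  exact congrArg ModuleCat.Hom.hom e

/-- The inclusion of the summand `C(U) ⊗ kε_U ⊗ A(x, U)` into the bar complex.  The sign `(-1)^|a|`
makes it commute with the differentials. -/
noncomputable def ofTens (hU : P U) {m n : ℤ} (hn : m + 1 = n) :
    (tens k C x U).X n →ₗ[k] Bar P C x m :=
  tensLift fun _ q h => (q.negOnePow : ℤ) • el hU (h.trans hn.symm)

theorem ofTens_tensEl (hU : P U) {m n p q : ℤ} (hn : m + 1 = n) (h : p + q = n)
    (c : C.X U p) (a : Hom k x U q) :
    (ofTens hU hn (tensEl h c a) : Bar P C x m) =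
      q.negOnePow • el hU (h.trans hn.symm) c a := by
  unfold ofTens
  rw [tensLift_tensEl]
  rfl

theorem barD_ofTens (hU : P U) {m n l : ℤ} (hn : m + 1 = n) (hl : n + 1 = l)
    (t : (tens k C x U).X n) :
    barD m n hn (ofTens hU hn t : Bar P C x m) = ofTens hU hl (((tens k C x U).d n l).hom t) := by
  have e : (barD m n hn ∘ₗ ofTens hU hn : (tens k C x U).X n →ₗ[k] Bar P C x n) =
      ofTens hU hl ∘ₗ ((tens k C x U).d n l).hom := by
    refine tens_hom_ext fun p q h c a => ?_
    rw [LinearMap.comp_apply, LinearMap.comp_apply, ofTens_tensEl, DGMod.map_units_smul_int,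
      barD_el hU _ hn rfl rfl (by omega) (by omega),
      tens_d_tensEl h rfl rfl (by omega) (by omega), map_add, DGMod.map_units_smul_int,
      ofTens_tensEl, ofTens_tensEl, DGMod.smul_negOnePow_succ]
    rw [smul_sub, smul_neg, sub_eq_add_neg, smul_comm]
  exact LinearMap.congr_fun e t

open scoped Classical in
variable (P) in
/-- The components of the bar complex. -/
noncomputable def toTens {m n : ℤ} (hn : m + 1 = n) :
    Bar P C x m →ₗ[k] ⨁ U : {U // P U}, (tens k C x U.1).X n :=
  barLift fun U hU _ q h => (q.negOnePow : ℤ) • (tensEl (h.trans hn)).compr₂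
    (DirectSum.lof k {U // P U} (fun U => (tens k C x U.1).X n) ⟨U, hU⟩)

open scoped Classical in
theorem toTens_el {m n : ℤ} (hn : m + 1 = n) (hU : P U) {p q : ℤ} (h : p + q = m + 1)
    (c : C.X U p) (a : Hom k x U q) :
    toTens P hn (el hU h c a : Bar P C x m) = q.negOnePow •
      DirectSum.lof k {U // P U} (fun U => (tens k C x U.1).X n) ⟨U, hU⟩
        (tensEl (h.trans hn) c a) := by
  unfold toTens
  rw [barLift_el]
  rfl

open scoped Classical in
theorem toTens_barD {m n l : ℤ} (hn : m + 1 = n) (hl : n + 1 = l) (t : Bar P C x m) :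
    toTens P hl (barD m n hn t) =
      DirectSum.lmap (fun U : {U // P U} => ((tens k C x U.1).d n l).hom) (toTens P hn t) := by
  induction t using bar_induction with
  | h0 => simp
  | hadd t t' ht ht' => simp only [map_add, ht, ht']
  | hel U hU p q hpq c a =>
    rw [toTens_el, barD_el hU hpq hn rfl rfl (by omega) (by omega), map_sub,
      DGMod.map_units_smul_int, DGMod.map_units_smul_int, toTens_el, toTens_el,
      DirectSum.lmap_lof, tens_d_tensEl (hpq.trans hn) rfl rfl (by omega) (by omega), map_add,
      DGMod.map_units_smul_int, DGMod.smul_negOnePow_succ]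
    rw [smul_add, smul_neg, sub_neg_eq_add, smul_comm]

open scoped Classical in
theorem sum_ofTens_toTens {m n : ℤ} (hn : m + 1 = n) (t : Bar P C x m) :
    DirectSum.toModule k {U // P U} (Bar P C x m) (fun U => ofTens U.2 hn) (toTens P hn t) =
      t := by
  induction t using bar_induction with
  | h0 => simp
  | hadd t t' ht ht' => simp only [map_add, ht, ht']
  | hel U hU p q hpq c a =>
    rw [toTens_el, DGMod.map_units_smul_int, DirectSum.toModule_lof, ofTens_tensEl, smul_smul,
      ← Int.negOnePow_add, Int.negOnePow_even _ (Even.add_self q), one_smul]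

/-- If the coefficients are acyclic and the complexes `A(x, U)` are homotopically flat, then the
bar complex is acyclic, since it is a direct sum of shifts of tensor products `C(U) ⊗ A(x, U)`. -/
theorem exists_barD_eq
    (hflat : ∀ x U : A, P U → HomotopicallyFlat (homComplex k x U))
    (hC : ∀ (U : A) (p q r : ℤ) (h : p + 1 = q) (h' : q + 1 = r) (c : C.X U q),
      C.d q r h' c = 0 → ∃ b, C.d p q h b = c)
    {l m n : ℤ} (hm : l + 1 = m) (hn : m + 1 = n) (t : Bar P C x m) (ht : barD m n hn t = 0) :
    ∃ s : Bar P C x l, barD l m hm s = t := by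
  classical
  have key : ∀ U : {U // P U}, ∃ s : (tens k C x U.1).X m,
      ((tens k C x U.1).d m n).hom s = toTens P hn t U := fun U => by
    have hex := hflat x U.1 U.2 (C.toComplex U.1) (toComplex_acyclic C U.1 (hC U.1)) n
    rw [HomologicalComplex.exactAt_iff' _ m n (n + 1) (by simp; omega) (by simp),
      ShortComplex.moduleCat_exact_iff] at hex
    refine hex _ ?_
    have h0 := toTens_barD hn rfl t
    rw [ht, map_zero] at h0
    have h1 := congrArg (fun v => v U) h0
    exact ((DirectSum.lmap_apply _ _ _).symm.trans h1.symm)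
  choose s hs using key
  refine ⟨∑ U ∈ (toTens P hn t).support, ofTens U.2 hm (s U), ?_⟩
  conv_rhs => rw [← sum_ofTens_toTens hn t, ← DirectSum.sum_support_of (toTens P hn t)]
  rw [map_sum, map_sum]
  refine Finset.sum_congr rfl fun U _ => ?_
  rw [barD_ofTens U.2 hm hn, hs]
  exact (DirectSum.toModule_lof k (M := fun U : {U // P U} => (tens k C x U.1).X n)
    (φ := fun U => (ofTens U.2 hn : _ →ₗ[k] Bar P C x m)) U _).symm

end CxFam

/-! ### Making cycles of bar complexes into boundaries -/

/-- A class of closed morphisms of degree zero of `A` which contains the identities, is closed under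
composition, and such that every closed morphism `a : x → U` with `P U`, of any degree, becomes a
coboundary after composition with a member `x' → x` of the class. -/
structure DGCategory.IsKilling {k : Type u} [CommRing k] {A : Type u} [DGCategory k A]
    (P : A → Prop) (W : ∀ ⦃x' x : A⦄, Z0 k x' x → Prop) : Prop where
  one : ∀ x, W (Z0one x)
  comp : ∀ {x'' x' x : A} (s : Z0 k x' x) (s' : Z0 k x'' x'), W s → W s' → W (Z0comp s s')
  kill : ∀ {x U : A}, P U → ∀ {p q r : ℤ} (h : p + 1 = q) (h' : q + 1 = r) (a : Hom k x U q),
    DGCategory.d q r h' a = 0 → ∃ (x' : A) (s : Z0 k x' x), W s ∧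
      ∃ b : Hom k x' U p, DGCategory.d p q h b = DGCategory.comp (add_zero q) a s.1

namespace CxFam

open DGQuot

variable {k : Type u} [CommRing k] {A : Type u} {P : A → Prop}

/-- The indices of the cells attached at objects satisfying `P`. -/
structure CellIdx (P : A → Prop) (C : CxFam k A) where
  U : A
  hU : P U
  p : ℤ
  e : Cell C U p

variable {C : CxFam k A}

variable (C) in
/-- The inclusion of a family of complexes into the family with all cells attached. -/
noncomputable def inc (U : A) (p : ℤ) : C.X U p →ₗ[k] C.cellular.X U p := LinearMap.inl k _ _

variable (C) in
/-- The projection to a family of complexes from the family with all cells attached; it does not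
commute with the differentials. -/
noncomputable def prj (U : A) (p : ℤ) : C.cellular.X U p →ₗ[k] C.X U p := LinearMap.fst k _ _

/-- A cell, as an element of the complex it is attached to. -/
noncomputable def cel {U : A} {p : ℤ} (e : Cell C U p) : C.cellular.X U p :=
  ((0, Finsupp.single e 1) : C.X U p × (Cell C U p →₀ k))

variable (C) in
/-- The coefficients of the cells in an element. -/
noncomputable def coef (U : A) (p : ℤ) : C.cellular.X U p →ₗ[k] Cell C U p →₀ k :=
  LinearMap.snd k (C.X U p) (Cell C U p →₀ k)

theorem coef_cel {U : A} {p : ℤ} (e : Cell C U p) : C.coef U p (cel e) = Finsupp.single e 1 := rfl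

theorem coef_inc {U : A} {p : ℤ} (c : C.X U p) : C.coef U p (C.inc U p c) = 0 := rfl

theorem rank_lt_of_mem_support {U : A} {p : ℤ} (e : Cell C U p) {e' : Cell C U (p + 1)}
    (h : e' ∈ (C.coef U (p + 1) (C.cellular.d p (p + 1) rfl (cel e))).support) :
    e'.rank < e.rank := by
  have e1 : C.cellular.d p (p + 1) rfl (cel e) = e.bd := cellD_single e
  rw [e1] at h
  exact e.rank_lt h

theorem inc_prj_add_sum {U : A} {p : ℤ} (c : C.cellular.X U p) :
    C.inc U p (C.prj U p c) + (C.coef U p c).sum (fun e r => r • cel e) = c := by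
  obtain ⟨c, w⟩ := c
  refine Prod.ext ?_ ?_
  · change c + (∑ e ∈ w.support, w e • ((0, Finsupp.single e 1) : C.X U p × (Cell C U p →₀ k))).1 =
      c
    simp [Prod.fst_sum]
  · change 0 +
      (∑ e ∈ w.support, w e • ((0, Finsupp.single e 1) : C.X U p × (Cell C U p →₀ k))).2 = w
    simpa [Prod.snd_sum, Finsupp.sum] using Finsupp.sum_single w

variable [DGCategory k A]

theorem barAct_barMap {C C' : CxFam k A} (f : ∀ U p, C.X U p →ₗ[k] C'.X U p) {x x' : A} {m : ℤ}
    (s : Hom k x' x 0) (t : Bar P C x m) : barAct s (barMap f t) = barMap f (barAct s t) := by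
  induction t using bar_induction with
  | h0 => simp
  | hadd t t' ht ht' => simp only [map_add, ht, ht']
  | hel U hU p q hpq c a => rw [barMap_el, barAct_el, barAct_el, barMap_el]

variable {x : A} {m : ℤ}

theorem barD_barMap_inc {n : ℤ} (h : m + 1 = n) (t : Bar P C x m) :
    barD m n h (barMap C.inc t) = barMap C.inc (barD m n h t) := by
  induction t using bar_induction with
  | h0 => simp
  | hadd t t' ht ht' => simp only [map_add, ht, ht']
  | hel U hU p q hpq c a =>
    rw [barMap_el, barD_el hU hpq h rfl rfl (by omega) (by omega),
      barD_el hU hpq h rfl rfl (by omega) (by omega), map_sub, DGMod.map_units_smul_int,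
      barMap_el, barMap_el]
    congr 3
    exact cellD_inl c

theorem barMap_prj_inc (t : Bar P C x m) : barMap C.prj (barMap C.inc t) = t := by
  induction t using bar_induction with
  | h0 => simp
  | hadd t t' ht ht' => simp only [map_add, ht, ht']
  | hel U hU p q hpq c a => rw [barMap_el, barMap_el]; rfl

variable (P C) in
/-- The part of the bar complex spanned by the cells. -/
abbrev CellBar (x : A) (m : ℤ) : Type u := ⨁ j : CellIdx P C, Hom k x j.U (m + 1 - j.p)

open scoped Classical in
/-- The inclusion of the summand indexed by a cell. -/
noncomputable def cellEl (j : CellIdx P C) {q : ℤ} (h : j.p + q = m + 1) :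
    Hom k x j.U q →ₗ[k] CellBar P C x m :=
  (eq_sub_of_add_eq' h) ▸
    DirectSum.lof k (CellIdx P C) (fun j => Hom k x j.U (m + 1 - j.p)) j

open scoped Classical in
theorem cellEl_rfl (j : CellIdx P C) (h : j.p + (m + 1 - j.p) = m + 1) :
    (cellEl j h : Hom k x j.U (m + 1 - j.p) →ₗ[k] CellBar P C x m) =
      DirectSum.lof k (CellIdx P C) (fun j => Hom k x j.U (m + 1 - j.p)) j := rfl

open scoped Classical in
/-- The cell components of an element of the bar complex. -/
noncomputable def cellCoef : Bar P C.cellular x m →ₗ[k] CellBar P C x m :=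
  barLift fun U hU p _ h =>
    (Finsupp.linearCombination k fun e => cellEl ⟨U, hU, p, e⟩ h) ∘ₗ C.coef U p

open scoped Classical in
theorem cellCoef_el {U : A} (hU : P U) {p q : ℤ} (h : p + q = m + 1)
    (v : C.cellular.X U p) (a : Hom k x U q) :
    cellCoef (el hU h v a : Bar P C.cellular x m) =
      (C.coef U p v).sum fun e r => r • cellEl ⟨U, hU, p, e⟩ h a := by
  unfold cellCoef
  rw [barLift_el, LinearMap.comp_apply, Finsupp.linearCombination_apply, Finsupp.sum, Finsupp.sum,
    LinearMap.sum_apply]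
  rfl

open scoped Classical in
/-- The sum of the cells with given coefficients. -/
noncomputable def ofCells : CellBar P C x m →ₗ[k] Bar P C.cellular x m :=
  DirectSum.toModule k (CellIdx P C) _ fun j =>
    el j.hU (by omega) (cel j.e)

open scoped Classical in
theorem ofCells_cellEl (j : CellIdx P C) {q : ℤ} (h : j.p + q = m + 1) (a : Hom k x j.U q) :
    ofCells (cellEl j h a) = el j.hU h (cel j.e) a := by
  obtain rfl : q = m + 1 - j.p := by omega
  unfold ofCells
  rw [cellEl_rfl]
  exact DirectSum.toModule_lof k (M := fun j : CellIdx P C => Hom k x j.U (m + 1 - j.p)) j _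

theorem cellCoef_cel (j : CellIdx P C) {q : ℤ} (h : j.p + q = m + 1) (a : Hom k x j.U q) :
    cellCoef (el j.hU h (cel j.e) a : Bar P C.cellular x m) = cellEl j h a := by
  classical
  rw [cellCoef_el, coef_cel]
  refine (Finsupp.sum_single_index ?_).trans ?_
  · exact zero_smul _ _
  · exact one_smul _ _

theorem cellCoef_inc (t : Bar P C x m) : cellCoef (barMap C.inc t) = 0 := by
  induction t using bar_induction with
  | h0 => simp
  | hadd t t' ht ht' => simp only [map_add, ht, ht', add_zero]
  | hel U hU p q hpq c a =>
    rw [barMap_el, cellCoef_el, coef_inc]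
    exact Finsupp.sum_zero_index

theorem inc_prj_add_ofCells (t : Bar P C.cellular x m) :
    barMap C.inc (barMap C.prj t) + ofCells (cellCoef t) = t := by
  induction t using bar_induction with
  | h0 => simp
  | hadd t t' ht ht' =>
    simp only [map_add]
    rw [add_add_add_comm, ht, ht']
  | hel U hU p q hpq c a =>
    rw [barMap_el, barMap_el, cellCoef_el, Finsupp.sum, map_sum]
    conv_rhs => rw [← inc_prj_add_sum c, Finsupp.sum, map_add, map_sum, LinearMap.add_apply,
      LinearMap.sum_apply]
    simp only [map_smul, LinearMap.smul_apply]
    exact congrArg _ (Finset.sum_congr rfl fun e _ =>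
      congrArg _ (ofCells_cellEl ⟨U, hU, p, e⟩ hpq a))

/-- The elements whose coefficients at cells of rank at least `N` vanish. -/
def rankLT (N : ℕ) : Submodule k (CellBar P C x m) where
  carrier := {g | ∀ j : CellIdx P C, N ≤ j.e.rank → g j = 0}
  zero_mem' _ _ := rfl
  add_mem' {g g'} hg hg' j hj := by
    rw [DirectSum.add_apply, hg j hj, hg' j hj, add_zero]
  smul_mem' r g hg j hj := by
    rw [DirectSum.smul_apply, hg j hj, smul_zero]

theorem cellEl_mem_rankLT (j : CellIdx P C) {q : ℤ} (h : j.p + q = m + 1) (a : Hom k x j.U q)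
    {N : ℕ} (hj : j.e.rank < N) : cellEl j h a ∈ rankLT (P := P) (C := C) (x := x) (m := m) N := by
  classical
  obtain rfl : q = m + 1 - j.p := by omega
  intro i hi
  exact DirectSum.of_eq_of_ne (β := fun j : CellIdx P C => Hom k x j.U (m + 1 - j.p)) j i a
    (by rintro rfl; omega)

/-- The action of the differential of `A` on the coefficients of the cells.  This is the part of the
differential of the bar complex that preserves the rank of cells. -/
noncomputable def cellVert (n : ℤ) (h : m + 1 = n) : CellBar P C x m →ₗ[k] CellBar P C x n :=
  DirectSum.lmap fun j => (-(j.p.negOnePow : ℤ)) •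
    DGCategory.d (k := k) (m + 1 - j.p) (n + 1 - j.p) (by omega)

theorem cellVert_apply (n : ℤ) (h : m + 1 = n) (g : CellBar P C x m) (j : CellIdx P C) :
    cellVert n h g j = -(j.p.negOnePow •
      DGCategory.d (k := k) (m + 1 - j.p) (n + 1 - j.p) (by omega) (g j)) := by
  unfold cellVert
  rw [DirectSum.lmap_apply, LinearMap.smul_apply, neg_smul]
  rfl

theorem cellVert_cellEl {n : ℤ} (h : m + 1 = n) (j : CellIdx P C) {q q' : ℤ}
    (hq : j.p + q = m + 1) (hq' : q + 1 = q') (h' : j.p + q' = n + 1) (a : Hom k x j.U q) :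
    cellVert n h (cellEl j hq a : CellBar P C x m) =
      -(j.p.negOnePow • cellEl j h' (DGCategory.d q q' hq' a)) := by
  classical
  obtain rfl : q = m + 1 - j.p := by omega
  obtain rfl : q' = n + 1 - j.p := by omega
  unfold cellVert
  rw [cellEl_rfl, cellEl_rfl, DirectSum.lmap_lof, LinearMap.smul_apply, neg_smul, map_neg]
  congr 1
  exact DGMod.map_units_smul_int _ _ _

theorem cellCoef_barD_cellEl {n : ℤ} (h : m + 1 = n) (j : CellIdx P C)
    (a : Hom k x j.U (m + 1 - j.p)) :
    cellCoef (barD m n h (ofCells (cellEl j (by omega) a))) - cellVert n h (cellEl j (by omega) a) ∈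
      rankLT (P := P) (C := C) (x := x) (m := n) j.e.rank := by
  classical
  rw [ofCells_cellEl, barD_el j.hU (by omega) h rfl rfl (by omega) (by omega), map_sub,
    DGMod.map_units_smul_int, cellVert_cellEl h j (by omega) rfl (by omega), cellCoef_cel,
    sub_neg_eq_add, sub_add_cancel, cellCoef_el]
  exact Submodule.sum_mem _ fun e he => Submodule.smul_mem _ _
    (cellEl_mem_rankLT _ _ _ (rank_lt_of_mem_support _ he))

theorem cellCoef_barD_ofCells {n : ℤ} (h : m + 1 = n) {N : ℕ} (g : CellBar P C x m)
    (hg : g ∈ rankLT (P := P) (C := C) (x := x) (m := m) (N + 1)) :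
    cellCoef (barD m n h (ofCells g)) - cellVert n h g ∈
      rankLT (P := P) (C := C) (x := x) (m := n) N := by
  classical
  rw [← DirectSum.sum_support_of g]
  simp only [map_sum]
  rw [← Finset.sum_sub_distrib]
  refine Submodule.sum_mem _ fun j hj => ?_
  have hj' : j.e.rank < N + 1 := by
    by_contra hlt
    exact (DFinsupp.mem_support_iff.1 hj) (hg j (by omega))
  intro i hi
  exact cellCoef_barD_cellEl h j (g j) i (by omega)

/-- The right action of a morphism of degree zero on the cell components. -/
noncomputable def cellAct {x' : A} (s : Hom k x' x 0) : CellBar P C x m →ₗ[k] CellBar P C x' m :=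
  DirectSum.lmap fun j => (DGCategory.comp (k := k) (add_zero (m + 1 - j.p))).flip s

theorem cellAct_apply {x' : A} (s : Hom k x' x 0) (g : CellBar P C x m) (j : CellIdx P C) :
    cellAct s g j = DGCategory.comp (k := k) (add_zero (m + 1 - j.p)) (g j) s := by
  unfold cellAct
  rw [DirectSum.lmap_apply]
  rfl

theorem cellAct_cellEl {x' : A} (s : Hom k x' x 0) (j : CellIdx P C) {q : ℤ}
    (h : j.p + q = m + 1) (a : Hom k x j.U q) :
    cellAct s (cellEl j h a : CellBar P C x m) =
      cellEl j h (DGCategory.comp (add_zero q) a s) := by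
  classical
  obtain rfl : q = m + 1 - j.p := by omega
  unfold cellAct
  rw [cellEl_rfl, cellEl_rfl, DirectSum.lmap_lof]
  rfl

theorem cellCoef_barAct {x' : A} (s : Hom k x' x 0) (t : Bar P C.cellular x m) :
    cellCoef (barAct s t) = cellAct s (cellCoef t) := by
  classical
  induction t using bar_induction with
  | h0 => simp
  | hadd t t' ht ht' => simp only [map_add, ht, ht']
  | hel U hU p q hpq c a =>
    rw [barAct_el, cellCoef_el, cellCoef_el, Finsupp.sum, Finsupp.sum, map_sum]
    refine Finset.sum_congr rfl fun e _ => ?_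
    rw [map_smul]
    exact congrArg _ (cellAct_cellEl s ⟨U, hU, p, e⟩ hpq a).symm

variable {W : ∀ ⦃x' x : A⦄, Z0 k x' x → Prop}

/-- Finitely many closed morphisms can be made into coboundaries simultaneously. -/
theorem exists_kill (hW : IsKilling P W) {x : A} (J : Finset (CellIdx P C))
    (g : ∀ j : CellIdx P C, Hom k x j.U (m + 1 - j.p))
    {l n : ℤ} (hl : l + 1 = m) (hn : m + 1 = n)
    (hg : ∀ j ∈ J, DGCategory.d (k := k) _ (n + 1 - j.p) (by omega) (g j) = 0) :
    ∃ (x' : A) (s : Z0 k x' x), W s ∧ ∀ j ∈ J, ∃ b : Hom k x' j.U (l + 1 - j.p),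
      DGCategory.d (l + 1 - j.p) (m + 1 - j.p) (by omega) b =
        DGCategory.comp (add_zero _) (g j) s.1 := by
  classical
  induction J using Finset.induction_on with
  | empty => exact ⟨x, Z0one x, hW.one x, by simp⟩
  | insert i J _ ih =>
    obtain ⟨x', s, hs, hJ⟩ := ih fun j hj => hg j (Finset.mem_insert_of_mem hj)
    obtain ⟨x'', s', hs', b, hb⟩ := hW.kill i.hU (by omega : l + 1 - i.p + 1 = m + 1 - i.p)
      (by omega : m + 1 - i.p + 1 = n + 1 - i.p)
      (DGCategory.comp (add_zero _) (g i) s.1)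
      (by rw [d_comp_Z0, hg i (Finset.mem_insert_self _ _), map_zero, LinearMap.zero_apply])
    refine ⟨x'', Z0comp s s', hW.comp s s' hs hs', fun j hj => ?_⟩
    have hassoc : DGCategory.comp (add_zero _) (g j) (Z0comp s s').1 =
        DGCategory.comp (add_zero _) (DGCategory.comp (add_zero _) (g j) s.1) s'.1 :=
      (DGCategory.assoc _ _ _ _ _ _ _).symm
    rw [hassoc]
    obtain rfl | hj := Finset.mem_insert.1 hj
    · exact ⟨b, hb⟩
    · obtain ⟨b, hb⟩ := hJ j hj
      exact ⟨DGCategory.comp (add_zero _) b s'.1, by rw [d_comp_Z0, hb]⟩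

/-- If the boundary of an element `t` of the bar complex of the complexes with all cells attached
has no cell components, then it is a boundary in the bar complex of the given complexes, after the
action of some member of `W`.  The components of `t` at the cells of highest rank are closed morphisms of
`A`, as the differential of a cell only involves cells of lower rank; a member of `W` makes them
coboundaries, and subtracting a boundary from `t` then lowers the rank. -/
theorem exists_barD_eq_barAct (hW : IsKilling P W) (N : ℕ) {l n : ℤ} (hl : l + 1 = m)
    (h : m + 1 = n) (t : Bar P C.cellular x m)
    (ht : cellCoef t ∈ rankLT (P := P) (C := C) (x := x) (m := m) N)
    (hDt : cellCoef (barD m n h t) = 0) :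
    ∃ (x' : A) (s : Z0 k x' x), W s ∧ ∃ t' : Bar P C x' m,
      barAct s.1 (barD m n h t) = barMap C.inc (barD m n h t') := by
  classical
  induction N generalizing x with
  | zero =>
    have h0 : cellCoef t = 0 := DFinsupp.ext fun j => ht j (Nat.zero_le _)
    refine ⟨x, Z0one x, hW.one x, barMap C.prj t, ?_⟩
    rw [← barD_barMap_inc]
    have e := inc_prj_add_ofCells t
    rw [h0, map_zero, add_zero] at e
    rw [e]
    exact barAct_one _
  | succ N ih =>
    have hvert : cellVert n h (cellCoef t) ∈
        rankLT (P := P) (C := C) (x := x) (m := n) N := by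
      have e := congrArg (fun t => cellCoef (barD m n h t)) (inc_prj_add_ofCells t)
      simp only [map_add, hDt, barD_barMap_inc, cellCoef_inc, zero_add] at e
      have e' := cellCoef_barD_ofCells h _ ht
      rw [e, zero_sub] at e'
      exact neg_mem_iff.1 e'
    -- The components at the cells of rank `N` are closed.
    obtain ⟨x', s, hs, hb⟩ := exists_kill hW
      ((cellCoef t).support.filter fun j => j.e.rank = N) (fun j => cellCoef t j) hl h
      (fun j hj => by
        have e := hvert j (Finset.mem_filter.1 hj).2.ge
        rwa [cellVert_apply, neg_eq_zero, smul_eq_zero_iff_eq] at e)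
    choose b hb using hb
    -- The boundary of `w` has the components of `t` at the cells of rank `N`, up to lower rank.
    let w : CellBar P C x' l := DirectSum.mk (fun j : CellIdx P C => Hom k x' j.U (l + 1 - j.p))
      ((cellCoef t).support.filter fun j => j.e.rank = N)
      (fun j => -(j.1.p.negOnePow • b j.1 j.2))
    have hw : w ∈ rankLT (P := P) (C := C) (x := x') (m := l) (N + 1) := fun j hj =>
      DirectSum.mk_apply_of_notMem fun hjJ => by
        have := (Finset.mem_filter.1 hjJ).2
        omega
    have hu : cellCoef (barAct s.1 t - barD l m hl (ofCells w)) ∈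
        rankLT (P := P) (C := C) (x := x') (m := m) N := by
      have e := cellCoef_barD_ofCells hl w hw
      rw [map_sub, cellCoef_barAct]
      rw [show cellAct s.1 (cellCoef t) - cellCoef (barD l m hl (ofCells w)) =
        (cellAct s.1 (cellCoef t) - cellVert m hl w) -
          (cellCoef (barD l m hl (ofCells w)) - cellVert m hl w) by abel]
      refine Submodule.sub_mem _ (fun j hj => ?_) e
      rw [DirectSum.sub_apply, cellAct_apply, cellVert_apply]
      by_cases hjJ : j ∈ (cellCoef t).support.filter fun j => j.e.rank = N
      · have e1 : w j = -(j.p.negOnePow • b j hjJ) := DirectSum.mk_apply_of_mem hjJ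
        rw [e1, map_neg, DGMod.map_units_smul_int, smul_neg, neg_neg, smul_smul,
          Int.units_mul_self, one_smul, hb, sub_self]
      · have e1 : w j = 0 := DirectSum.mk_apply_of_notMem hjJ
        have e2 : cellCoef t j = 0 := by
          by_contra hne
          rcases hj.lt_or_eq with hlt | heq
          · exact hne (ht j hlt)
          · exact hjJ (Finset.mem_filter.2 ⟨DFinsupp.mem_support_iff.2 hne, heq.symm⟩)
        rw [e1, e2]
        simp
    have hDu : cellCoef (barD m n h (barAct s.1 t - barD l m hl (ofCells w))) = 0 := by
      rw [map_sub, barD_barD, sub_zero, barD_barAct, cellCoef_barAct, hDt, map_zero]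
    obtain ⟨x'', s', hs', t', ht'⟩ := ih _ hu hDu
    refine ⟨x'', Z0comp s s', hW.comp s s' hs hs', t', ?_⟩
    rw [map_sub, barD_barD, sub_zero, barD_barAct] at ht'
    exact (barAct_comp s.1 s'.1 _).trans ht'

/-- If the complexes `A(x, U)` are homotopically flat, then a cycle of the bar complex becomes a
boundary after the action of some member of `W`.  Attaching cells makes the coefficients acyclic,
so that the cycle bounds there; the cells are then removed one rank at a time. -/
theorem exists_barD_eq_barAct_of_closed (hW : IsKilling P W)
    (hflat : ∀ x U : A, P U → HomotopicallyFlat (homComplex k x U))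
    {l n : ℤ} (hl : l + 1 = m) (h : m + 1 = n) (t : Bar P C x m) (ht : barD m n h t = 0) :
    ∃ (x' : A) (s : Z0 k x' x), W s ∧ ∃ t' : Bar P C x' l, barD l m hl t' = barAct s.1 t := by
  classical
  obtain ⟨u, hu⟩ := exists_barD_eq (C := C.cellular) hflat
    (fun U p q r h h' c hc => exists_of_cellular_d_eq_zero h h' c hc) hl h (barMap C.inc t)
    (by rw [barD_barMap_inc, ht, map_zero])
  obtain ⟨x', s, hs, t', ht'⟩ := exists_barD_eq_barAct hW
    ((cellCoef u).support.sup fun j => j.e.rank + 1) (l := l - 1) (by omega) hl u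
    (fun j hj => by
      by_contra hne
      have := Finset.le_sup (f := fun j : CellIdx P C => j.e.rank + 1)
        (DFinsupp.mem_support_iff.2 hne)
      omega)
    (by rw [hu, cellCoef_inc])
  refine ⟨x', s, hs, t', ?_⟩
  rw [hu, barAct_barMap] at ht'
  simpa only [barMap_prj_inc] using (congrArg (barMap C.prj) ht').symm

end CxFam

/-! ### The word length filtration of the dg quotient -/

namespace DGQuot

open CxFam

variable {k : Type u} [CommRing k] {A : Type u} [DGCategory k A] {P : A → Prop}

variable (k P) in
/-- The part of the differential of the dg quotient that preserves the number of letters `ε`.  It is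
bundled with the proof that it squares to zero, because words with `n + 1` letters form the bar
complex with the words with `n` letters as coefficients. -/
noncomputable def wordD (y : A) : ∀ n : ℕ, {D : ∀ {x : A} (p q : ℤ), p + 1 = q →
    (Word k P y n x p →ₗ[k] Word k P y n x q) //
      ∀ {x : A} (p q r : ℤ) (h : p + 1 = q) (h' : q + 1 = r) (w : Word k P y n x p),
        D q r h' (D p q h w) = 0}
  | 0 => ⟨fun {x} p q h => DGCategory.d (k := k) (x := x) (y := y) p q h,
      fun {x} p q r h h' w => DGCategory.d_d (k := k) (x := x) (y := y) p q r h h' w⟩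
  | n + 1 => ⟨fun {x} p q h => barD (P := P) (x := x)
      (C := { X := fun x m => Word k P y n x m, d := (wordD y n).1, d_d := (wordD y n).2 }) p q h,
      fun _ _ _ h h' w => barD_barD (P := P)
        (C := { X := fun x m => Word k P y n x m, d := (wordD y n).1, d_d := (wordD y n).2 })
        h h' w⟩

variable (k P) in
/-- The words with `n` letters `ε`, as a family of complexes. -/
noncomputable def wordFam (y : A) (n : ℕ) : CxFam k A where
  X x m := Word k P y n x m
  d := (wordD k P y n).1
  d_d := (wordD k P y n).2

/-- The words with `n` letters `ε`, in the dg quotient. -/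
noncomputable def ofWord {x y : A} {m : ℤ} (n : ℕ) :
    (wordFam k P y n).X x m →ₗ[k] QHom k P x y m :=
  DirectSum.lof k ℕ (fun n => Word k P y n x m) n

/-- The words with `n + 1` letters `ε`, in the dg quotient. -/
noncomputable def ofBar {x y : A} {m : ℤ} (n : ℕ) :
    Bar P (wordFam k P y n) x m →ₗ[k] QHom k P x y m :=
  DirectSum.lof k ℕ (fun n => Word k P y n x m) (n + 1)

variable {x y : A} {m : ℤ}

theorem snoc_ofWord {U : A} (hU : P U) {p q : ℤ} (h : p + q = m + 1) (n : ℕ)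
    (w : (wordFam k P y n).X U p) (a : Hom k x U q) :
    (snoc hU h (ofWord n w) a : QHom k P x y m) = ofBar n (el hU h w a) := by
  unfold snoc
  exact LinearMap.congr_fun
    (DirectSum.toModule_lof k (M := fun n => Word k P y n U p) n w) a

variable (k P) in
/-- The morphisms of the dg quotient with fewer than `N` letters `ε`. -/
def filLT (x y : A) (m : ℤ) (N : ℕ) : Submodule k (QHom k P x y m) where
  carrier := {t | ∀ j : ℕ, N ≤ j → t j = 0}
  zero_mem' _ _ := rfl
  add_mem' {g g'} hg hg' j hj := by
    rw [DirectSum.add_apply, hg j hj, hg' j hj, add_zero]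
  smul_mem' r g hg j hj := by
    rw [DirectSum.smul_apply, hg j hj, smul_zero]

theorem ofWord_mem_filLT {n N : ℕ} (h : n < N) (w : (wordFam k P y n).X x m) :
    ofWord n w ∈ filLT k P x y m N := fun j hj =>
  DirectSum.of_eq_of_ne (β := fun n => Word k P y n x m) n j w (by omega)

theorem ofBar_mem_filLT {n N : ℕ} (h : n + 1 < N) (t : Bar P (wordFam k P y n) x m) :
    ofBar n t ∈ filLT k P x y m N := ofWord_mem_filLT h t

theorem filLT_mono {N N' : ℕ} (h : N ≤ N') : filLT k P x y m N ≤ filLT k P x y m N' :=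
  fun _ ht j hj => ht j (h.trans hj)

open scoped Classical in
theorem sum_ofWord (t : QHom k P x y m) :
    ∑ n ∈ DFinsupp.support t, ofWord n (t n) = t := DirectSum.sum_support_of t

theorem map_mem_of_mem_filLT {V : Type*} [AddCommGroup V] [Module k V] (S : Submodule k V)
    (f : QHom k P x y m →ₗ[k] V) {N : ℕ}
    (hf : ∀ n < N, ∀ w : (wordFam k P y n).X x m, f (ofWord n w) ∈ S) {t : QHom k P x y m}
    (ht : t ∈ filLT k P x y m N) : f t ∈ S := by
  classical
  rw [← sum_ofWord t, map_sum]
  refine Submodule.sum_mem _ fun n hn => hf n ?_ _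
  by_contra h
  exact DFinsupp.mem_support_iff.1 hn (ht n (by omega))

theorem snoc_mem_filLT {U : A} (hU : P U) {p q : ℤ} (h : p + q = m + 1) {N : ℕ}
    {t : QHom k P U y p} (ht : t ∈ filLT k P U y p N) (a : Hom k x U q) :
    (snoc hU h t a : QHom k P x y m) ∈ filLT k P x y m (N + 1) :=
  map_mem_of_mem_filLT _ ((snoc hU h).flip a) (fun n hn w => by
    rw [LinearMap.flip_apply, snoc_ofWord]
    exact ofBar_mem_filLT (by omega) _) ht

theorem ract_ofBar {x' : A} (s : Hom k x' x 0) (n : ℕ) (t : Bar P (wordFam k P y n) x m) :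
    ract (add_zero m) (ofBar n t) s = ofBar n (barAct s t) := by
  induction t using bar_induction with
  | h0 => simp
  | hadd t t' ht ht' => simp only [map_add, LinearMap.add_apply, ht, ht']
  | hel U hU p q hpq w a =>
    rw [← snoc_ofWord, ract_snoc hU hpq _ (add_zero q) hpq, snoc_ofWord, barAct_el]

theorem ract_ofBar_mem_filLT {x' : A} {q n : ℤ} (h : m + q = n) (a : Hom k x' x q) {j N : ℕ}
    (hj : j + 1 < N) (t : Bar P (wordFam k P y j) x m) :
    ract h (ofBar j t) a ∈ filLT k P x' y n N := by
  induction t using bar_induction with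
  | h0 => simp
  | hadd t t' ht ht' =>
    rw [map_add, map_add, LinearMap.add_apply]
    exact Submodule.add_mem _ ht ht'
  | hel U hU p q hpq w b =>
    rw [← snoc_ofWord, ract_snoc hU hpq h rfl (by omega), snoc_ofWord]
    exact ofBar_mem_filLT hj _

theorem ract_mem_filLT {x' : A} {q n : ℤ} (h : m + q = n) (a : Hom k x' x q) {N : ℕ}
    {t : QHom k P x y m} (ht : t ∈ filLT k P x y m N) :
    ract h t a ∈ filLT k P x' y n N := by
  refine map_mem_of_mem_filLT _ ((ract h).flip a) (fun j hj w => ?_) ht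
  rw [LinearMap.flip_apply]
  cases j with
  | zero =>
    have e := ract_base (P := P) h w a
    exact (congrArg (· ∈ _) e).mpr (ofWord_mem_filLT hj (DGCategory.comp h w a))
  | succ j => exact ract_ofBar_mem_filLT h a hj w

/-- Up to words with fewer letters, the differential of the dg quotient is that of the bar
complexes. -/
theorem qd_ofWord_sub_mem {n : ℤ} (h : m + 1 = n) (j : ℕ) (w : (wordFam k P y j).X x m) :
    qd m n h (ofWord j w) - ofWord j ((wordFam k P y j).d m n h w) ∈ filLT k P x y n j := by
  induction j generalizing x m n with
  | zero =>
    have e : qd m n h (ofWord 0 w : QHom k P x y m) =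
      ofWord 0 ((wordFam k P y 0).d m n h w) := qd_base m n h w
    rw [e, sub_self]
    exact Submodule.zero_mem _
  | succ j ih =>
    suffices key : ∀ t : Bar P (wordFam k P y j) x m,
        qd m n h (ofBar j t) - ofBar j (barD m n h t) ∈ filLT k P x y n (j + 1) from key w
    intro t
    induction t using bar_induction with
    | h0 => simp
    | hadd t t' ht ht' =>
      have e := Submodule.add_mem _ ht ht'
      rw [← add_sub_add_comm] at e
      simpa only [map_add] using e
    | hel U hU p q hpq w a =>
      rw [← snoc_ofWord,
        qd_snoc hU hpq h rfl rfl (by omega) (by omega) (by omega),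
        barD_el hU hpq h rfl rfl (by omega) (by omega), map_sub, DGMod.map_units_smul_int,
        ← snoc_ofWord, ← snoc_ofWord, smul_sub]
      have e := snoc_mem_filLT hU (by omega : p + 1 + q = n + 1) (ih (rfl : p + 1 = p + 1) w) a
      rw [map_sub, LinearMap.sub_apply] at e
      have e' := ract_mem_filLT (by omega : p + q = n) a
        (ofWord_mem_filLT (Nat.lt_succ_self j) w)
      have e'' : p.negOnePow • ract (by omega : p + q = n) (ofWord j w) a ∈
          filLT k P x y n (j + 1) := by
        rw [Units.smul_def]
        exact zsmul_mem e' _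
      convert Submodule.add_mem _ e e'' using 1
      abel

theorem qd_ofBar_sub_mem {n : ℤ} (h : m + 1 = n) (j : ℕ) (t : Bar P (wordFam k P y j) x m) :
    qd m n h (ofBar j t) - ofBar j (barD m n h t) ∈ filLT k P x y n (j + 1) :=
  qd_ofWord_sub_mem h (j + 1) t

theorem qd_mem_filLT {n : ℤ} (h : m + 1 = n) {N : ℕ} {t : QHom k P x y m}
    (ht : t ∈ filLT k P x y m N) : qd m n h t ∈ filLT k P x y n N := by
  refine map_mem_of_mem_filLT _ (qd m n h) (fun j hj w => ?_) ht
  have e := Submodule.add_mem _ (filLT_mono hj.le (qd_ofWord_sub_mem h j w))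
    (ofWord_mem_filLT hj ((wordFam k P y j).d m n h w))
  rwa [sub_add_cancel] at e

theorem exists_base_of_mem_filLT {t : QHom k P x y m} (ht : t ∈ filLT k P x y m 1) :
    ∃ a : Hom k x y m, base a = t := by
  have : t ∈ LinearMap.range (base : Hom k x y m →ₗ[k] QHom k P x y m) :=
    map_mem_of_mem_filLT _ LinearMap.id (fun j hj w => by
      obtain rfl : j = 0 := by omega
      exact ⟨w, rfl⟩) ht
  exact this

theorem base_injective : Function.Injective (base : Hom k x y m →ₗ[k] QHom k P x y m) :=
  DirectSum.of_injective (β := fun n => Word k P y n x m) 0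

variable {W : ∀ ⦃x' x : A⦄, Z0 k x' x → Prop}

/-- The words with the largest number of letters can be removed from an element with a shorter
boundary, after composition with some member of `W`. -/
theorem exists_ract_sub_qd_mem (hW : IsKilling P W)
    (hflat : ∀ x U : A, P U → HomotopicallyFlat (homComplex k x U)) (j : ℕ) {l n : ℤ}
    (hl : l + 1 = m) (h : m + 1 = n) {t : QHom k P x y m} (ht : t ∈ filLT k P x y m (j + 2))
    (hdt : qd m n h t ∈ filLT k P x y n (j + 1)) :
    ∃ (x' : A) (s : Z0 k x' x), W s ∧ ∃ u : QHom k P x' y l,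
      ract (add_zero m) t s.1 - qd l m hl u ∈ filLT k P x' y m (j + 1) := by
  let τ : Bar P (wordFam k P y j) x m := t (j + 1)
  have hτ : t - ofBar j τ ∈ filLT k P x y m (j + 1) := fun i hi => by
    rw [DirectSum.sub_apply]
    rcases hi.eq_or_lt with rfl | hi
    · exact sub_eq_zero.2 (DirectSum.of_eq_same (β := fun n => Word k P y n x m) (j + 1) τ).symm
    · rw [ht i hi, ofBar_mem_filLT (Nat.lt_succ_self (j + 1)) τ i hi, sub_zero]
  have hd : barD m n h τ = 0 := by
    have e1 := qd_mem_filLT h hτ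
    rw [map_sub] at e1
    have e2 := Submodule.sub_mem _ (Submodule.sub_mem _ hdt e1) (qd_ofBar_sub_mem h j τ)
    rw [sub_sub_cancel, sub_sub_cancel] at e2
    exact (DirectSum.of_eq_same (β := fun i => Word k P y i x n) (j + 1) (barD m n h τ)).symm.trans
      (e2 (j + 1) le_rfl)
  obtain ⟨x', s, hs, u, hu⟩ := exists_barD_eq_barAct_of_closed hW hflat hl h τ hd
  refine ⟨x', s, hs, ofBar j u, ?_⟩
  have e1 := ract_mem_filLT (add_zero m) s.1 hτ
  rw [map_sub, LinearMap.sub_apply, ract_ofBar, ← hu] at e1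
  have e2 := Submodule.sub_mem _ e1 (qd_ofBar_sub_mem hl j u)
  rwa [sub_sub_sub_cancel_right] at e2

/-- An element whose boundary is a morphism of `A` is itself homologous to a morphism of `A`, after
composition with some member of `W`. -/
theorem exists_ract_eq_base_add_qd (hW : IsKilling P W)
    (hflat : ∀ x U : A, P U → HomotopicallyFlat (homComplex k x U)) {l n : ℤ} (hl : l + 1 = m)
    (h : m + 1 = n) (t : QHom k P x y m) (b : Hom k x y n) (hdt : qd m n h t = base b) :
    ∃ (x' : A) (s : Z0 k x' x), W s ∧ ∃ (a : Hom k x' y m) (u : QHom k P x' y l),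
      ract (add_zero m) t s.1 = base a + qd l m hl u := by
  classical
  have key : ∀ (N : ℕ) (x : A) (t : QHom k P x y m), t ∈ filLT k P x y m (N + 1) →
      qd m n h t ∈ filLT k P x y n 1 → ∃ (x' : A) (s : Z0 k x' x), W s ∧
        ∃ (a : Hom k x' y m) (u : QHom k P x' y l),
          ract (add_zero m) t s.1 = base a + qd l m hl u := by
    intro N
    induction N with
    | zero =>
      intro x t ht _
      obtain ⟨a, rfl⟩ := exists_base_of_mem_filLT ht
      exact ⟨x, Z0one x, hW.one x, a, 0, by rw [map_zero, add_zero]; exact ract_one _ _⟩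
    | succ N ih =>
      intro x t ht hdt
      obtain ⟨x', s, hs, u, hu⟩ := exists_ract_sub_qd_mem hW hflat N hl h ht
        (filLT_mono (by omega) hdt)
      have hs0 : DGCategory.d 0 1 (zero_add 1) s.1 = 0 := s.2
      obtain ⟨x'', s', hs', a, u', hu'⟩ := ih x' _ hu (by
        rw [map_sub, qd_qd, sub_zero, qd_ract (add_zero m) h h (add_zero n) (zero_add 1) h, hs0,
          map_zero, smul_zero, add_zero]
        exact ract_mem_filLT _ _ hdt)
      have hs0' : DGCategory.d 0 1 (zero_add 1) s'.1 = 0 := s'.2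
      refine ⟨x'', Z0comp s s', hW.comp s s' hs hs', a, u' + ract (add_zero l) u s'.1, ?_⟩
      rw [map_sub, LinearMap.sub_apply, ract_ract _ _ (zero_add 0) (add_zero m)] at hu'
      rw [map_add, ← add_assoc, ← hu', qd_ract (add_zero l) hl hl (add_zero m) (zero_add 1) hl,
        hs0', map_zero, smul_zero, add_zero, sub_add_cancel]
      rfl
  refine key (DFinsupp.support t |>.sup id) x t (fun j hj => ?_) ?_
  · by_contra hne
    have := Finset.le_sup (f := id) (DFinsupp.mem_support_iff.2 hne)
    simp only [id] at this
    omega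
  · rw [hdt]
    exact ofWord_mem_filLT Nat.zero_lt_one (y := y) (n := 0) b

end DGQuot

section

open DGMod

/-! ### Fractions -/

namespace H0

variable {k : Type u} [CommRing k] {A : Type u} [DGCategory k A]

theorem dMor_app_one {x : A} {N : DGMod k A} {m n : ℤ} (h : m + 1 = n)
    (f : Mor (yonedaObj k x) N m) :
    (dMor _ _ m n h f).app x 0 n (zero_add n) (one x : Hom k x x 0) =
      N.d m n h (f.app x 0 m (zero_add m) (one x : Hom k x x 0)) := by
  have h1 : (yonedaObj k x).d 0 1 (zero_add 1) (one x : Hom k x x 0) = 0 := d_one k x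
  refine (dMor_app h f x (zero_add n) (zero_add m) h (zero_add 1) (by omega) _).trans ?_
  rw [h1, map_zero, smul_zero, sub_zero]

variable [HasShift (H0 k A) ℤ] [HasZeroObject (H0 k A)]
  [∀ n : ℤ, (shiftFunctor (H0 k A) n).Additive] [Pretriangulated (H0 k A)] {P : A → Prop}

/-- A closed morphism to an object of a pretriangulated full dg subcategory `B` becomes a
coboundary after composition with a morphism whose cone lies in `H⁰(B)`: such a morphism completes
its class to a distinguished triangle. -/
theorem exists_trW_comp_eq_d (hB : IsPretriangulatedDG k (DGFull P)) {x U : A} (hU : P U)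
    {p q r : ℤ} (h : p + 1 = q) (h' : q + 1 = r) (a : Hom k x U q)
    (ha : DGCategory.d q r h' a = 0) :
    ∃ (x' : A) (s : Z0 k x' x), (H0.sub k P).trW (homMk s) ∧
      ∃ b : Hom k x' U p, DGCategory.d p q h b = DGCategory.comp (add_zero q) a s.1 := by
  obtain ⟨q, rfl⟩ : ∃ q', q = 0 + q' := ⟨q, by omega⟩
  obtain rfl : p = -1 + q := by omega
  obtain rfl : r = 1 + q := by omega
  obtain ⟨z, ⟨e⟩⟩ := (DGFull.incl k P).exists_iso_shift hB ⟨U, hU⟩ q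
  let N : DGMod k A := (yonedaObj k U).shift q
  let a' : N.X x 0 := a
  have ha' : N.d 0 1 (zero_add 1) a' = 0 := by
    change q.negOnePow • DGCategory.d (0 + q) (1 + q) h' a = 0
    rw [ha, smul_zero]
  let α : Z0 k (yonedaObj k x) N := ⟨ofElem a', (app_one_bijective x N 1).1 (by
    refine (dMor_app_one _ _).trans ?_
    rw [ofElem_app_one, ha']
    rfl)⟩
  let β : (yoneda k A).mapH0.obj ⟨x⟩ ⟶ (⟨N⟩ : H0 k (DGMod k A)) := homMk α
  let e' : (yoneda k A).mapH0.obj ⟨z.1⟩ ≅ (⟨N⟩ : H0 k (DGMod k A)) := e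
  obtain ⟨b, hb⟩ := (yoneda k A).mapH0.map_surjective (β ≫ e'.inv)
  obtain ⟨⟨x'⟩, f, g, hT⟩ := distinguished_cocone_triangle₁ b
  obtain ⟨s, rfl⟩ := homMk_surjective f
  refine ⟨x', s, ObjectProperty.trW.mk _ hT ⟨_, z.2, ⟨Iso.refl _⟩⟩, ?_⟩
  have h0 : (yoneda k A).mapH0.map (homMk s) ≫ β = 0 := by
    rw [← cancel_mono e'.inv, Category.assoc, ← hb, ← Functor.map_comp,
      show homMk s ≫ b = 0 from comp_distTriang_mor_zero₁₂ _ hT, Functor.map_zero, zero_comp]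
  have h1 : homMk (Z0comp α ((yoneda k A).mapZ0 _ _ s)) = homMk 0 := h0
  obtain ⟨t, ht⟩ := homMk_eq_iff_d.1 h1
  refine ⟨q.negOnePow • t.app x' 0 (-1) (zero_add (-1)) (one x' : Hom k x' x' 0), ?_⟩
  have h2 := congrArg (fun f : Mor (yonedaObj k x') N 0 =>
    f.app x' 0 0 (zero_add 0) (one x' : Hom k x' x' 0)) ht
  refine Eq.trans ?_ (((dMor_app_one (neg_add_cancel 1) t).symm.trans h2.symm).trans ?_)
  · exact map_units_smul_int _ _ _
  · refine (sub_zero _).trans ?_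
    refine (compMor_app (zero_add 0) _ _ x' (zero_add 0) (zero_add 0) (zero_add 0) _).trans ?_
    exact congrArg (DGCategory.comp (add_zero (0 + q)) a) (comp_one _ s.1)

variable (P) in
/-- The morphisms whose cone lies in `H⁰(B)` form a killing class. -/
theorem isKilling [IsTriangulated (H0 k A)] [(H0.sub k P).IsTriangulated]
    (hB : IsPretriangulatedDG k (DGFull P)) :
    IsKilling P fun _ _ s => (H0.sub k P).trW (homMk s) where
  one x := (H0.sub k P).trW.id_mem (⟨x⟩ : H0 k A)
  comp _ _ hs hs' := (H0.sub k P).trW.comp_mem _ _ hs' hs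
  kill hU _ _ _ h h' a ha := exists_trW_comp_eq_d hB hU h h' a ha

variable [IsTriangulated (H0 k A)] [(H0.sub k P).IsTriangulated]

/-- Morphisms of `H⁰(A/B)` are represented by fractions. -/
theorem exists_fraction (hB : IsPretriangulatedDG k (DGFull P))
    (hflat : ∀ x U : A, P U → HomotopicallyFlat (homComplex k x U)) {X Y : H0 k A}
    (f : (DGQuot.proj k P).mapH0.obj X ⟶ (DGQuot.proj k P).mapH0.obj Y) :
    ∃ (X' : H0 k A) (s : X' ⟶ X) (g : X' ⟶ Y), (H0.sub k P).trW s ∧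
      (DGQuot.proj k P).mapH0.map s ≫ f = (DGQuot.proj k P).mapH0.map g := by
  obtain ⟨f, rfl⟩ := homMk_surjective f
  obtain ⟨x', s, hs, a, u, h⟩ := DGQuot.exists_ract_eq_base_add_qd (isKilling P hB) hflat
    (neg_add_cancel 1) (zero_add 1) f.1 0 (by rw [map_zero]; exact f.2)
  have ha : DGCategory.d 0 1 (zero_add 1) a = 0 := by
    apply DGQuot.base_injective (P := P)
    have hs0 : DGCategory.d 0 1 (zero_add 1) s.1 = 0 := s.2
    have hf0 : DGQuot.qd 0 1 (zero_add 1) f.1 = 0 := f.2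
    have h1 := congrArg (DGQuot.qd 0 1 (zero_add 1)) h
    rw [map_add, DGQuot.qd_qd, add_zero, DGQuot.qd_base,
      DGQuot.qd_ract (add_zero 0) (zero_add 1) (zero_add 1) (add_zero 1) (zero_add 1) (zero_add 1),
      hs0, hf0, map_zero, map_zero, LinearMap.zero_apply, smul_zero, add_zero] at h1
    rw [map_zero, h1]
  refine ⟨⟨x'⟩, homMk s, homMk ⟨a, ha⟩, hs, ?_⟩
  change homMk (Z0comp f ((DGQuot.proj k P).mapZ0 _ _ s)) = homMk ((DGQuot.proj k P).mapZ0 _ _ _)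
  refine homMk_eq_iff_d.2 ⟨u, ?_⟩
  refine sub_eq_of_eq_add ?_
  refine (DGQuot.qcomp_base (zero_add 0) f.1 s.1).trans (h.trans (add_comm _ _))

/-- A morphism that vanishes in `H⁰(A/B)` is killed by a morphism with cone in `H⁰(B)`. -/
theorem exists_comp_eq_zero (hB : IsPretriangulatedDG k (DGFull P))
    (hflat : ∀ x U : A, P U → HomotopicallyFlat (homComplex k x U)) {X Y : H0 k A}
    (f : X ⟶ Y) (hf : (DGQuot.proj k P).mapH0.map f = 0) :
    ∃ (X' : H0 k A) (s : X' ⟶ X), (H0.sub k P).trW s ∧ s ≫ f = 0 := by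
  obtain ⟨f, rfl⟩ := homMk_surjective f
  have hf' : homMk ((DGQuot.proj k P).mapZ0 _ _ f) = homMk 0 := hf
  obtain ⟨t, ht⟩ := homMk_eq_iff_d.1 hf'
  have ht : DGQuot.base f.1 = DGQuot.qd (-1) 0 (neg_add_cancel 1) t := (sub_zero _).symm.trans ht
  obtain ⟨x', s, hs, a, u, h⟩ := DGQuot.exists_ract_eq_base_add_qd (isKilling P hB) hflat
    (by norm_num : (-2 : ℤ) + 1 = -1) (neg_add_cancel 1) t f.1 ht.symm
  refine ⟨⟨x'⟩, homMk s, hs, ?_⟩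
  change homMk (Z0comp f s) = homMk 0
  refine homMk_eq_iff_d.2 ⟨a, (sub_zero _).trans (DGQuot.base_injective (P := P) ?_)⟩
  have hs0 : DGCategory.d 0 1 (zero_add 1) s.1 = 0 := s.2
  have h1 := congrArg (DGQuot.qd (-1) 0 (neg_add_cancel 1)) h
  rw [map_add, DGQuot.qd_qd, add_zero, DGQuot.qd_base,
    DGQuot.qd_ract (add_zero (-1)) (neg_add_cancel 1) (neg_add_cancel 1) (add_zero 0) (zero_add 1)
      (neg_add_cancel 1), hs0, map_zero, smul_zero, add_zero, ← ht] at h1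
  exact (DGQuot.ract_base (add_zero 0) f.1 s.1).symm.trans h1

end H0

end

section

open DGMod

-- Compositions in homotopy categories are compared factor by factor, not by representatives.
attribute [local irreducible] H0comp

/-! ### The dg quotient is pretriangulated -/

theorem CategoryTheory.Functor.map_comp_iso_eq {C D : Type*} [Category* C] [Category* D] (F : C ⥤ D)
    {X X' Y : C} {M N : D} {f : M ⟶ N} {g : X ⟶ Y} {g' : X' ⟶ Y} (a : F.obj X ≅ M)
    (b : F.obj Y ≅ N) (s : X' ≅ X) (hg : F.map g = a.hom ≫ f ≫ b.inv) (h : s.hom ≫ g = g') :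
    F.map g' ≫ b.hom = (F.mapIso s ≪≫ a).hom ≫ f := by
  simp [← h, hg]

namespace DGFunctor

variable {k : Type u} [CommRing k] {A A' : Type u} [DGCategory k A] [DGCategory k A']
  (F : DGFunctor k A A')

/-- A dg functor that sends the objects of `B` to contractible objects inverts the morphisms whose
cone lies in `H⁰(B)`. -/
theorem isIso_map_of_trW [HasShift (H0 k A) ℤ] [HasZeroObject (H0 k A)]
    [∀ n : ℤ, (shiftFunctor (H0 k A) n).Additive] [Pretriangulated (H0 k A)] {P : A → Prop}
    (hA : YonedaExact k A) (hF : ∀ U, P U → IsZero (F.mapH0.obj ⟨U⟩)) {X Y : H0 k A} {s : X ⟶ Y}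
    (hs : (H0.sub k P).trW s) : IsIso (F.mapH0.map s) := by
  obtain ⟨_, _⟩ := hA
  obtain ⟨_, _⟩ := Functor.exists_isTriangulated_of_comp F.yonedaExtCompIso
  obtain ⟨Z, g, h, hT, ⟨V, hV, ⟨e⟩⟩⟩ := hs
  have hZ : IsZero ((F.yonedaExt.mapH0 ⋙ (Ext.adj F.res).mapH0).obj Z) :=
    ((yoneda k A').mapH0.map_isZero ((hF _ hV).of_iso (F.mapH0.mapIso e))).of_iso
      (F.yonedaExtAdjIso.symm.app Z)
  have hiso : IsIso ((F.yonedaExt.mapH0 ⋙ (Ext.adj F.res).mapH0).map s) :=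
    (Triangle.isZero₃_iff_isIso₁ _
      ((F.yonedaExt.mapH0 ⋙ (Ext.adj F.res).mapH0).map_distinguished _ hT)).1 hZ
  have : IsIso ((yoneda k A').mapH0.map (F.mapH0.map s)) :=
    (NatIso.isIso_map_iff F.yonedaExtAdjIso s).2 hiso
  exact isIso_of_reflects_iso _ (yoneda k A').mapH0

end DGFunctor

namespace DGMod

variable {k : Type u} [CommRing k] {A : Type u} [DGCategory k A]

/-- Isomorphic morphisms of `H⁰(DGMod-A)` have isomorphic cones. -/
theorem nonempty_cone_iso {M N M' N' : DGMod k A} (f : Z0 k M N) (f' : Z0 k M' N')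
    (a : (⟨M⟩ : H0 k (DGMod k A)) ≅ ⟨M'⟩) (b : (⟨N⟩ : H0 k (DGMod k A)) ≅ ⟨N'⟩)
    (h : H0.homMk f ≫ b.hom = a.hom ≫ H0.homMk f') :
    Nonempty ((⟨cone f⟩ : H0 k (DGMod k A)) ≅ ⟨cone f'⟩) := by
  let e := isoTriangleOfIso₁₂ _ _ (StrictPretr.std_mem f) (StrictPretr.std_mem f') a b h
  exact ⟨(coneIso f).symm ≪≫ Triangle.π₃.mapIso e ≪≫ coneIso f'⟩

/-- The cone of a morphism `f` between modules isomorphic to representable ones is the cone of the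
morphism `g` of `H⁰(A)` corresponding to `f`, or of any morphism isomorphic to it. -/
theorem exists_nonempty_cone_iso {x y : A} {M N : DGMod k A} (f : Z0 k M N)
    (a : (⟨yonedaObj k x⟩ : H0 k (DGMod k A)) ≅ ⟨M⟩)
    (b : (⟨yonedaObj k y⟩ : H0 k (DGMod k A)) ≅ ⟨N⟩) :
    ∃ g : (⟨x⟩ : H0 k A) ⟶ ⟨y⟩, ∀ {x' : A} (g' : Z0 k x' y) (s : (⟨x'⟩ : H0 k A) ≅ ⟨x⟩),
      s.hom ≫ g = H0.homMk g' →
        Nonempty ((⟨cone ((yoneda k A).mapZ0 _ _ g')⟩ : H0 k (DGMod k A)) ≅ ⟨cone f⟩) := by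
  obtain ⟨g, hg⟩ := (yoneda k A).mapH0.map_surjective
    (show (yoneda k A).mapH0.obj ⟨x⟩ ⟶ (yoneda k A).mapH0.obj ⟨y⟩ from
      a.hom ≫ H0.homMk f ≫ b.inv)
  exact ⟨g, fun g' s h => nonempty_cone_iso _ f ((yoneda k A).mapH0.mapIso s ≪≫ a) b
    ((yoneda k A).mapH0.map_comp_iso_eq a b s hg h)⟩

end DGMod

namespace DGQuot

variable {k : Type u} [CommRing k] {A : Type u} [DGCategory k A] {P : A → Prop}

theorem isZero_proj {U : A} (hU : P U) : IsZero ((proj k P).mapH0.obj ⟨U⟩) := by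
  refine (IsZero.iff_id_eq_zero _).2 ?_
  change H0.homMk (Z0one (⟨U⟩ : DGQuot k P)) = H0.homMk 0
  exact H0.homMk_eq_iff_d.2 ⟨eps hU, (sub_zero _).trans (d_eps hU).symm⟩

/-- The dg quotient is pretriangulated: the image of `A` is closed under cones up to isomorphism,
since every morphism of `H⁰(A/B)` is isomorphic to the image of a morphism of `H⁰(A)`. -/
theorem isPretriangulatedDG (hA : IsPretriangulatedDG k A) (hB : IsPretriangulatedDG k (DGFull P))
    (hflat : ∀ x U : A, P U → HomotopicallyFlat (homComplex k x U)) :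
    IsPretriangulatedDG k (DGQuot k P) := by
  obtain ⟨S⟩ := nonempty_canonicalTriangulation hA
  let := S.hasShift
  let := S.hasZeroObject
  have := S.shiftAdditive
  let := S.pretriangulated
  have := S.isTriangulated
  have := H0.isTriangulated_sub P S.yonedaExact hB
  rw [isPretriangulatedDG_iff]
  intro M hM
  suffices h : ∃ x : A, Nonempty ((⟨yonedaObj k ((proj k P).obj x)⟩ : H0 k (DGMod k _)) ≅ ⟨M⟩) by
    obtain ⟨x, h⟩ := h
    exact ⟨_, h⟩
  induction hM with
  | zero => exact (proj k P).exists_iso_zero hA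
  | yoneda x => exact ⟨x.obj, ⟨Iso.refl _⟩⟩
  | susp _ ih =>
    obtain ⟨x, ⟨e⟩⟩ := ih
    obtain ⟨z, ⟨e'⟩⟩ := (proj k P).exists_iso_shift hA x 1
    exact ⟨z, ⟨e' ≪≫ (susp k _).mapH0.mapIso e⟩⟩
  | desusp _ ih =>
    obtain ⟨x, ⟨e⟩⟩ := ih
    obtain ⟨z, ⟨e'⟩⟩ := (proj k P).exists_iso_shift hA x (-1)
    exact ⟨z, ⟨e' ≪≫ (shiftFunctor (H0 k (DGMod k _)) (-1 : ℤ)).mapIso e⟩⟩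
  | @cone M N f _ _ ihM ihN =>
    obtain ⟨x, ⟨a⟩⟩ := ihM
    obtain ⟨y, ⟨b⟩⟩ := ihN
    obtain ⟨g, hg⟩ := exists_nonempty_cone_iso f a b
    obtain ⟨⟨x'⟩, s, g', hs, h⟩ := H0.exists_fraction hB hflat (X := ⟨x⟩) (Y := ⟨y⟩) g
    obtain ⟨g', rfl⟩ := H0.homMk_surjective g'
    have := (proj k P).isIso_map_of_trW S.yonedaExact (fun U hU => isZero_proj hU) hs
    obtain ⟨z, ⟨e⟩⟩ := (proj k P).exists_iso_cone hA g'
    obtain ⟨e'⟩ := hg ((proj k P).mapZ0 _ _ g') (@asIso _ _ _ _ _ this) h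
    exact ⟨z, ⟨e ≪≫ e'⟩⟩

end DGQuot

end

/-! ### The Verdier quotient -/

namespace CategoryTheory

theorem Functor.isCatIso_of_bijective {C D : Type*} [Category* C] [Category* D] (F : C ⥤ D)
    [F.Full] [F.Faithful] (hF : Function.Bijective F.obj) : F.IsCatIso := by
  obtain ⟨g, hl, hr⟩ := Function.bijective_iff_has_inverse.1 hF
  let G : D ⥤ C :=
    { obj := g
      map {Y Y'} f := F.preimage (eqToHom (hr Y) ≫ f ≫ eqToHom (hr Y').symm)
      map_id Y := F.map_injective (by simp)
      map_comp f f' := F.map_injective (by simp) }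
  refine ⟨G, Functor.ext hl fun X Y f => F.map_injective ?_, Functor.ext hr fun X Y f => ?_⟩
  · simp [G, eqToHom_map]
  · simp [G]

section

variable {C D : Type*} [Category* C] [Category* D] [HasShift C ℤ] [HasZeroObject C]
  [Preadditive C] [∀ n : ℤ, (shiftFunctor C n).Additive] [Pretriangulated C]
  [CategoryTheory.IsTriangulated C]
  [HasShift D ℤ] [HasZeroObject D] [Preadditive D] [∀ n : ℤ, (shiftFunctor D n).Additive]
  [Pretriangulated D] (Q : ObjectProperty C) [Q.IsTriangulated] (F : C ⥤ D) [F.CommShift ℤ]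
  [F.IsTriangulated]

/-- An exact functor induces an isomorphism of triangulated categories from a Verdier quotient if it
is bijective on objects and its morphisms and their equalities are governed by right fractions. -/
theorem Functor.exists_isTriangulatedIso (hF : Function.Bijective F.obj)
    (hinv : ∀ ⦃X Y : C⦄ (s : X ⟶ Y), Q.trW s → IsIso (F.map s))
    (hfull : ∀ {X Y : C} (f : F.obj X ⟶ F.obj Y), ∃ (X' : C) (s : X' ⟶ X) (g : X' ⟶ Y),
      Q.trW s ∧ F.map s ≫ f = F.map g)
    (hfaithful : ∀ {X Y : C} (f : X ⟶ Y), F.map f = 0 → ∃ (X' : C) (s : X' ⟶ X),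
      Q.trW s ∧ s ≫ f = 0) :
    ∃ Φ : Q.trW.Localization ⥤ D, Q.trW.Q ⋙ Φ = F ∧ IsTriangulatedIso Φ := by
  let Φ : Q.trW.Localization ⥤ D := Localization.Construction.lift F hinv
  have fac : Q.trW.Q ⋙ Φ = F := Localization.Construction.fac F hinv
  let _ : Localization.Lifting Q.trW.Q Q.trW F Φ := ⟨eqToIso fac⟩
  let _ : Φ.CommShift ℤ := Functor.commShiftOfLocalization Q.trW.Q Q.trW ℤ F Φ
  have := Localization.essSurj_mapArrow Q.trW.Q Q.trW
  have : Φ.IsTriangulated := isTriangulated_of_precomp_iso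
    (Localization.Lifting.iso Q.trW.Q Q.trW F Φ)
  let e : Q.trW.Q ⋙ Φ ≅ F := Localization.Lifting.iso Q.trW.Q Q.trW F Φ
  have hmap {X Y : C} (f : X ⟶ Y) :
      Φ.map (Q.trW.Q.map f) = e.hom.app X ≫ F.map f ≫ e.inv.app Y := by
    rw [e.inv.naturality, e.hom_inv_id_app_assoc]
    rfl
  have hsurj (X : Q.trW.Localization) : ∃ X', Q.trW.Q.obj X' = X :=
    (Localization.Construction.objEquiv Q.trW).surjective X
  have : Φ.Full := ⟨fun {X Y} f => by
    obtain ⟨X, rfl⟩ := hsurj X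
    obtain ⟨Y, rfl⟩ := hsurj Y
    obtain ⟨X', s, g, hs, h⟩ := hfull (e.inv.app X ≫ f ≫ e.hom.app Y)
    have := Localization.inverts Q.trW.Q Q.trW s hs
    refine ⟨CategoryTheory.inv (Q.trW.Q.map s) ≫ Q.trW.Q.map g, ?_⟩
    rw [← cancel_epi (Φ.map (Q.trW.Q.map s)), ← Φ.map_comp, IsIso.hom_inv_id_assoc, hmap, hmap, ← h]
    simp⟩
  have : Φ.Faithful := ⟨fun {X Y} f₁ f₂ hf => by
    obtain ⟨X, rfl⟩ := hsurj X
    obtain ⟨Y, rfl⟩ := hsurj Y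
    obtain ⟨φ, hφ⟩ := Localization.exists_rightFraction Q.trW.Q Q.trW (f₁ - f₂)
    have h0 : Q.trW.Q.map φ.s ≫ (f₁ - f₂) = Q.trW.Q.map φ.f := by
      rw [hφ, MorphismProperty.RightFraction.map_s_comp_map]
    have h1 : F.map φ.f = 0 := by
      have h2 := hmap φ.f
      rw [← h0, Φ.map_comp, Φ.map_sub, hf, sub_self, comp_zero] at h2
      rw [← cancel_epi (e.hom.app φ.X'), ← cancel_mono (e.inv.app Y), Category.assoc, ← h2]
      simp
    obtain ⟨X', t, ht, h3⟩ := hfaithful φ.f h1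
    have := Localization.inverts Q.trW.Q Q.trW t ht
    have := Localization.inverts Q.trW.Q Q.trW φ.s φ.hs
    rw [← sub_eq_zero, ← cancel_epi (Q.trW.Q.map φ.s), h0, ← cancel_epi (Q.trW.Q.map t),
      ← Functor.map_comp, h3]
    simp⟩
  refine ⟨Φ, fac, Functor.isCatIso_of_bijective _ ?_, inferInstance, inferInstance,
    fun T => (Φ.map_distinguished_iff T).1⟩
  have hobj : Φ.obj = F.obj ∘ (Localization.Construction.objEquiv Q.trW).symm := by
    funext X
    obtain ⟨X, rfl⟩ := (Localization.Construction.objEquiv Q.trW).surjective X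
    exact (Functor.congr_obj fac X).trans
      (congrArg F.obj ((Localization.Construction.objEquiv Q.trW).symm_apply_apply X).symm)
  rw [hobj]
  exact hF.comp (Equiv.bijective _)

end

end CategoryTheory

theorem corollary6p2 {k : Type u} [CommRing k] {A : Type u} [DGCategory k A] (P : A → Prop)
    (hA : IsPretriangulatedDG k A) (hB : IsPretriangulatedDG k (DGFull P))
    (hflat : ∀ x U : A, P U → HomotopicallyFlat (DGCategory.homComplex k x U)) :
    IsPretriangulatedDG k (DGQuot k P) ∧
    Nonempty (CanonicalTriangulation k A) ∧
    Nonempty (CanonicalTriangulation k (DGQuot k P)) ∧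
    ∀ (S : CanonicalTriangulation k A) (T : CanonicalTriangulation k (DGQuot k P)),
      letI := S.hasShift
      letI := S.hasZeroObject
      letI := S.shiftAdditive
      letI := S.pretriangulated
      letI := S.isTriangulated
      letI := T.hasShift
      letI := T.hasZeroObject
      letI := T.shiftAdditive
      letI := T.pretriangulated
      ∃ (_ : (H0.sub k P).IsTriangulated)
        (Φ : (H0.sub k P).trW.Localization ⥤ H0 k (DGQuot k P)),
        (H0.sub k P).trW.Q ⋙ Φ = (DGQuot.proj k P).mapH0 ∧ IsTriangulatedIso Φ := by
  have hQ := DGQuot.isPretriangulatedDG hA hB hflat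
  refine ⟨hQ, nonempty_canonicalTriangulation hA, nonempty_canonicalTriangulation hQ,
    fun S T => ?_⟩
  let := S.hasShift
  let := S.hasZeroObject
  have := S.shiftAdditive
  let := S.pretriangulated
  have := S.isTriangulated
  let := T.hasShift
  let := T.hasZeroObject
  have := T.shiftAdditive
  let := T.pretriangulated
  have := H0.isTriangulated_sub P S.yonedaExact hB
  refine ⟨this, ?_⟩
  obtain ⟨_, _⟩ := (DGQuot.proj k P).exists_isTriangulated S.yonedaExact T.yonedaExact
  exact Functor.exists_isTriangulatedIso _ _
    ⟨fun X Y h => congrArg (fun Z => (⟨Z.obj.obj⟩ : H0 k A)) h, fun Y => ⟨⟨Y.obj.obj⟩, rfl⟩⟩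
    (fun X Y s hs => (DGQuot.proj k P).isIso_map_of_trW S.yonedaExact
      (fun U hU => DGQuot.isZero_proj hU) hs)
    (fun f => H0.exists_fraction hB hflat f) (fun f hf => H0.exists_comp_eq_zero hB hflat f hf)
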